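/- **Theorem.** Let $\mathbb T^2=[0,2\pi)^2$ carry the normalized Lebesgue measure $d\mu=(2\pi)^{-2}d\mathbf x$, and let all functions be $2\pi$-periodic in each of the two variables and $\mathbb K$-valued, where $\mathbb K=\mathbb R$ or $\mathbb K=\mathbb C$; $\|\cdot\|_p$ is the norm of $L_p(\mathbb T^2,\mu)$. For $r>0$ put $l=[r]+1$. For $t\in\mathbb R$ let $\Delta^l_{t,j}$ be the $l$-th difference with step $t$ in the variable $x_j$ (the $l$-th iterate of $f\mapsto f(\cdot+t\mathbf e_j)-f$), and for $e\subseteq\{1,2\}$ and $\mathbf t=(t_1,t_2)\in\mathbb R^2$ let $\Delta^l_{\mathbf t}(e)=\prod_{j\in e}\Delta^l_{t_j,j}$, with $\Delta^l_{\mathbf t}(\varnothing)=I$. For $1\le p\le\infty$ let $\mathbf H^r_p$ be the class of continuous functions $f$ such that $$\bigl\|\Delta^l_{\mathbf t}(e)f\bigr\|_p\le\prod_{j\in e}|t_j|^r\qquad\text{for all } e\subseteq\{1,2\}\text{ and all }\mathbf t\in\mathbb R^2 .$$ For $m\ge 1$ and points $\xi^1,\dots,\xi^m\in\mathbb T^2$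 put $$E_m(\xi^1,\dots,\xi^m)=\sup_{f\in\mathbf H^r_p}\Bigl|\|f\|_2^2-\frac1m\sum_{j=1}^m|f(\xi^j)|^2\Bigr|,\qquad er_m(\mathbf H^r_p,L_2)=\inf_{\xi^1,\dots,\xi^m\in\mathbb T^2}E_m(\xi^1,\dots,\xi^m).$$ Let $b_0=b_1=1$, $b_n=b_{n-1}+b_{n-2}$ $(n\ge2)$ be the Fibonacci numbers. Let $1\le p\le\infty$ and $r>1/p$ (that is, $r>0$ if $p=\infty$). Then there are constants $0<c\le C<\infty$, independent of $n$, such that for all $n\ge 2$ $$c\,b_n^{-r}\log b_n\;\le\; er_{b_n}(\mathbf H^r_p,L_2)\;\le\; C\,b_n^{-r}\log b_n .$$ Moreover the upper bound is attained by the Fibonacci point sets $\xi^\mu=\bigl(2\pi\mu/b_n,\,2\pi\{\mu b_{n-1}/b_n\}\bigr)$, $\mu=1,\dots,b_n$ (here $\{x\}$ is the fractional part of $x$): for all $n\ge2$, $E_{b_n}(\xi^1,\dots,\xi^{b_n})\le C\,b_n^{-r}\log b_n$. -/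

import Mathlib

open MeasureTheory
open scoped ENNReal Real

noncomputable section

instance factTwoPiPos : Fact ((0 : ℝ) < 2 * π) := ⟨Real.two_pi_pos⟩

/-- The torus `𝕋^d = [0, 2π)^d`, i.e. `(ℝ / 2πℤ)^d`. Functions on it are the functions on `ℝ^d`
that are `2π`-periodic in each variable. -/
abbrev Torus (d : ℕ) : Type := Fin d → AddCircle (2 * π)

/-- The normalized Lebesgue measure `(2π)^{-d} dx` on the torus. -/
def torusMeasure (d : ℕ) : Measure (Torus d) :=
  Measure.pi fun _ => AddCircle.haarAddCircle

instance isProbabilityMeasure_torusMeasure (d : ℕ) : IsProbabilityMeasure (torusMeasure d) := by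
  unfold torusMeasure; infer_instance

/-- The `l`-th difference `Δ^l_{t,j}` with step `t` in the variable `x_j`: the `l`-th iterate of
`g ↦ (x ↦ g (x + t e_j) - g x)`. -/
def coordDiff {𝕜 : Type*} [RCLike 𝕜] {d : ℕ} (l : ℕ) (t : ℝ) (j : Fin d)
    (g : Torus d → 𝕜) : Torus d → 𝕜 :=
  (fwdDiff (Pi.single j (t : AddCircle (2 * π)) : Torus d))^[l] g

/-- The mixed `l`-th difference `Δ^l_t(e) = ∏_{j ∈ e} Δ^l_{t_j,j}`; it is the identity for
`e = ∅`. (The operators commute; they are applied here in the order of increasing `j`.) -/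
def mixedDiff {𝕜 : Type*} [RCLike 𝕜] {d : ℕ} (l : ℕ) (t : Fin d → ℝ) (e : Finset (Fin d))
    (f : Torus d → 𝕜) : Torus d → 𝕜 :=
  (List.finRange d).foldl (fun g j => if j ∈ e then coordDiff l (t j) j g else g) f

/-- The class `H^r_p` of `𝕜`-valued functions on the `d`-dimensional torus, of continuous `f` with
`‖Δ^l_t(e) f‖_p ≤ ∏_{j ∈ e} |t_j|^r` for all `e ⊆ {1, …, d}` and all steps `t`,
where `l = [r] + 1`. -/
def classH (𝕜 : Type*) [RCLike 𝕜] (d : ℕ) (r : ℝ) (p : ℝ≥0∞) : Set C(Torus d, 𝕜) :=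
  {f | ∀ (e : Finset (Fin d)) (t : Fin d → ℝ),
    eLpNorm (mixedDiff (⌊r⌋₊ + 1) t e (⇑f)) p (torusMeasure d)
      ≤ ENNReal.ofReal (∏ j ∈ e, |t j| ^ r)}

section Discretization

variable {𝕜 : Type*} [RCLike 𝕜] {Ω : Type*} [TopologicalSpace Ω] [MeasurableSpace Ω]

/-- The error of discretization of the `L_q(μ)` norm on the class `W` by the points
`ξ^1, …, ξ^m` with equal weights:
`sup_{f ∈ W} | ‖f‖_q^q - (1/m) ∑_j |f(ξ^j)|^q |`, a value in `[0, ∞]`. -/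
def samplingError (μ : Measure Ω) (q : ℝ) (W : Set C(Ω, 𝕜)) {m : ℕ} (ξ : Fin m → Ω) : ℝ≥0∞ :=
  ⨆ f ∈ W, ENNReal.ofReal |(∫ x, ‖f x‖ ^ q ∂μ) - (1 / (m : ℝ)) * ∑ j, ‖f (ξ j)‖ ^ q|

/-- The optimal error `er_m(W, L_q)` of discretization: the infimum of `samplingError` over all
choices of `m` points. -/
def er (μ : Measure Ω) (q : ℝ) (W : Set C(Ω, 𝕜)) (m : ℕ) : ℝ≥0∞ :=
  ⨅ ξ : Fin m → Ω, samplingError μ q W ξ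

end Discretization

/-- The Fibonacci numbers normalized by `b_0 = b_1 = 1`, `b_n = b_{n-1} + b_{n-2}`. -/
def fibB : ℕ → ℕ
  | 0 => 1
  | 1 => 1
  | n + 2 => fibB (n + 1) + fibB n

/-- The points `(2π μ / b_n, 2π {μ b_{n-1} / b_n})`, `μ = 1, …, b_n`, of the `n`-th Fibonacci
cubature formula (`n ≥ 1`); the index `j = 0, …, b_n - 1` stands for `μ = j + 1`. -/
def fibPoint (n : ℕ) (j : Fin (fibB n)) : Torus 2 :=
  ![((2 * π * (((j : ℕ) + 1 : ℝ) / (fibB n : ℝ)) : ℝ) : AddCircle (2 * π)),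
    ((2 * π * Int.fract (((j : ℕ) + 1 : ℝ) * (fibB (n - 1) : ℝ) / (fibB n : ℝ)) : ℝ) :
      AddCircle (2 * π))]

end

/-!
Upper bound. Split `f` into dyadic frequency blocks, of `L_p` norm about `2 ^ (-r * level s)`. The
Fibonacci cubature formula with `m = b_n` nodes integrates exactly all characters in the hyperbolic
cross `max 1 |k₁| * max 1 |k₂| < m / 6`, so a product of two blocks contributes an error only if
its frequencies leave that cross. For such a pair, since every box of volume `1 / m` contains
boundedly many nodes, majorizing the blocks by Cauchy kernels gives a Marcinkiewicz-type bound.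
Summing over all pairs gives `m ^ (-r) * log m`, the logarithm counting the dyadic shapes `s` of a
given level.

Lower bound. Given any `m` points, take `2 ^ N` comparable to `m` but larger. For each of the about
`log m` dyadic shapes of boxes of volume `2 ^ (-N)`, at least half of the boxes contain no node.
Adding to the constant `1 / 2` a multiple of `2 ^ (-r * N)` times the sum of bumps in all these free
boxes, of all shapes, gives a function of the class that equals `1 / 2` at every node and whose mean
square exceeds `1 / 4` by about `m ^ (-r) * log m`.
-/

noncomputable section

/-! ### The circle and kernels of Cauchy type -/

/-- The circle of length `2π`. -/
abbrev Circ : Type := AddCircle (2 * π)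

lemma exists_coe_eq_and_abs_eq_norm (z : Circ) : ∃ x : ℝ, (x : Circ) = z ∧ |x| = ‖z‖ := by
  induction z using QuotientAddGroup.induction_on with
  | H y =>
    refine ⟨y - round ((2 * π)⁻¹ * y) * (2 * π), ?_, (AddCircle.norm_eq (2 * π)).symm⟩
    have hperiod : ((round ((2 * π)⁻¹ * y) * (2 * π) : ℝ) : Circ) = 0 :=
      (AddCircle.coe_eq_zero_iff _).2 ⟨round ((2 * π)⁻¹ * y), zsmul_eq_mul _ _⟩
    rw [AddCircle.coe_sub, hperiod, sub_zero]

/-- A real representative of smallest absolute value of a point of the circle. -/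
def circRep (z : Circ) : ℝ := (exists_coe_eq_and_abs_eq_norm z).choose

lemma coe_circRep (z : Circ) : (circRep z : Circ) = z :=
  (exists_coe_eq_and_abs_eq_norm z).choose_spec.1

lemma abs_circRep (z : Circ) : |circRep z| = ‖z‖ :=
  (exists_coe_eq_and_abs_eq_norm z).choose_spec.2

lemma norm_sub_le_abs_circRep_sub (z w : Circ) : ‖z - w‖ ≤ |circRep z - circRep w| := by
  conv_lhs => rw [← coe_circRep z, ← coe_circRep w, ← AddCircle.coe_sub]
  exact QuotientAddGroup.norm_mk_le_norm

lemma circ_norm_le_pi (z : Circ) : ‖z‖ ≤ π := by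
  have h := AddCircle.norm_le_half_period (2 * π) (x := z) Real.two_pi_pos.ne'
  rwa [abs_of_pos Real.two_pi_pos, mul_div_cancel_left₀ _ (two_ne_zero' ℝ)] at h

/-- The kernel `N / (1 + N² ‖t‖²)` of Cauchy type on the circle: it has bounded mass, is
concentrated at the scale `1 / N`, and dominates the convolution kernels used below. -/
def cauchyKer (N : ℝ) (t : Circ) : ℝ := N / (1 + (N * ‖t‖) ^ 2)

lemma cauchyKer_nonneg {N : ℝ} (hN : 0 ≤ N) (t : Circ) : 0 ≤ cauchyKer N t := by
  unfold cauchyKer; positivity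

lemma cauchyKer_le {N : ℝ} (hN : 0 ≤ N) (t : Circ) : cauchyKer N t ≤ N :=
  div_le_self hN (le_add_of_nonneg_right (sq_nonneg _))

lemma continuous_cauchyKer (N : ℝ) : Continuous (cauchyKer N) := by
  unfold cauchyKer
  exact continuous_const.div (by fun_prop) fun t => by positivity

/-- Up to the factor `N`, a bound for `cauchyKer N` on the arc where `⌊N t⌋ = i`. -/
def cellWeight (i : ℤ) : ℝ := 4 / (1 + (i : ℝ) ^ 2)

lemma cellWeight_pos (i : ℤ) : 0 < cellWeight i := by unfold cellWeight; positivity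

lemma summable_cellWeight : Summable cellWeight := by
  have hsq : Summable fun i : ℤ => 4 / (i : ℝ) ^ 2 :=
    ((Real.summable_one_div_int_pow.2 one_lt_two).mul_left 4).congr fun i => mul_one_div _ _
  refine hsq.of_norm_bounded_eventually ?_
  filter_upwards [(Set.finite_singleton (0 : ℤ)).compl_mem_cofinite] with i hi
  have hi0 : (i : ℝ) ≠ 0 := by exact_mod_cast hi
  rw [Real.norm_of_nonneg (cellWeight_pos i).le, cellWeight]
  gcongr
  linarith

lemma cauchyKer_le_cellWeight {N : ℝ} (hN : 0 < N) (t : Circ) :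
    cauchyKer N t ≤ N * cellWeight ⌊N * circRep t⌋ := by
  set u := N * circRep t
  have hu : (N * ‖t‖) ^ 2 = u ^ 2 := by rw [← abs_circRep, mul_pow, sq_abs, ← mul_pow]
  have hfloor := Int.floor_le u
  have hlt := Int.lt_floor_add_one u
  rw [cauchyKer, cellWeight, hu, ← mul_div_assoc,
    div_le_div_iff₀ (by positivity) (by positivity), mul_assoc]
  refine mul_le_mul_of_nonneg_left ?_ hN.le
  nlinarith [sq_nonneg (u + (u - ⌊u⌋)), sq_nonneg (u - ⌊u⌋)]

/-- The total mass of the cell weights. -/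
def cellMass : ℝ := ∑' i, cellWeight i

lemma cellMass_pos : 0 < cellMass :=
  summable_cellWeight.tsum_pos (fun i => (cellWeight_pos i).le) 0 (cellWeight_pos 0)

/-! ### Node sets adapted to hyperbolic crosses -/

/-- Any two of the `m` nodes are separated by hyperbolic distance `1 / m`. -/
def IsHyperbolicallySeparated {m : ℕ} (ξ : Fin m → Torus 2) : Prop :=
  ∀ ⦃i j⦄, i ≠ j → 1 ≤ m * (‖ξ i 0 - ξ j 0‖ * ‖ξ i 1 - ξ j 1‖)

lemma mul_norm_sub_lt_one_of_floor_eq {N : ℝ} (hN : 0 < N) {u v w : Circ}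
    (h : ⌊N * circRep (u - w)⌋ = ⌊N * circRep (v - w)⌋) : N * ‖u - v‖ < 1 := by
  have hcell := Int.abs_sub_lt_one_of_floor_eq_floor h
  rw [← mul_sub, abs_mul, abs_of_pos hN] at hcell
  refine lt_of_le_of_lt (mul_le_mul_of_nonneg_left ?_ hN.le) hcell
  simpa only [sub_sub_sub_cancel_right] using norm_sub_le_abs_circRep_sub (u - w) (v - w)

/-- The rectangular cell, of side lengths `1 / N₁` and `1 / N₂` and counted from `(y, z)`, in which
a point of the torus lies. -/
def cellIndex (N₁ N₂ : ℝ) (y z : Circ) (x : Torus 2) : ℤ × ℤ :=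
  (⌊N₁ * circRep (x 0 - y)⌋, ⌊N₂ * circRep (x 1 - z)⌋)

section HyperbolicallySeparated

variable {m : ℕ} {ξ : Fin m → Torus 2} {N₁ N₂ : ℝ}

lemma IsHyperbolicallySeparated.injective_cellIndex (hξ : IsHyperbolicallySeparated ξ)
    (h₁ : 0 < N₁) (h₂ : 0 < N₂) (hN : m ≤ N₁ * N₂) (y z : Circ) :
    Function.Injective fun j => cellIndex N₁ N₂ y z (ξ j) := by
  intro i j hij
  by_contra hne
  have hfst := mul_norm_sub_lt_one_of_floor_eq h₁ (congrArg Prod.fst hij)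
  have hsnd := mul_norm_sub_lt_one_of_floor_eq h₂ (congrArg Prod.snd hij)
  refine (hξ hne).not_gt ?_
  calc (m : ℝ) * (‖ξ i 0 - ξ j 0‖ * ‖ξ i 1 - ξ j 1‖)
      ≤ N₁ * N₂ * (‖ξ i 0 - ξ j 0‖ * ‖ξ i 1 - ξ j 1‖) := by gcongr
    _ = (N₁ * ‖ξ i 0 - ξ j 0‖) * (N₂ * ‖ξ i 1 - ξ j 1‖) := by ring
    _ < 1 := mul_lt_one_of_nonneg_of_lt_one_left (by positivity) hfst hsnd.le

/-- Each cell contains at most one node, so the sum is controlled by the mass of the cell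
weights. -/
lemma IsHyperbolicallySeparated.sum_cauchyKer_mul_cauchyKer_le (hξ : IsHyperbolicallySeparated ξ)
    (h₁ : 0 < N₁) (h₂ : 0 < N₂) (hN : m ≤ N₁ * N₂) (y z : Circ) :
    ∑ j, cauchyKer N₁ (ξ j 0 - y) * cauchyKer N₂ (ξ j 1 - z) ≤ cellMass ^ 2 * (N₁ * N₂) := by
  have hnonneg (i : ℤ) : 0 ≤ cellWeight i := (cellWeight_pos i).le
  have hsummable : Summable fun i : ℤ × ℤ => cellWeight i.1 * cellWeight i.2 :=
    summable_cellWeight.mul_of_nonneg summable_cellWeight hnonneg hnonneg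
  set c : Fin m → ℤ × ℤ := fun j => cellIndex N₁ N₂ y z (ξ j)
  calc ∑ j, cauchyKer N₁ (ξ j 0 - y) * cauchyKer N₂ (ξ j 1 - z)
      ≤ ∑ j, (N₁ * cellWeight (c j).1) * (N₂ * cellWeight (c j).2) := by
        gcongr with j
        · exact cauchyKer_nonneg h₂.le _
        · exact mul_nonneg h₁.le (hnonneg _)
        · exact cauchyKer_le_cellWeight h₁ _
        · exact cauchyKer_le_cellWeight h₂ _
    _ = N₁ * N₂ * ∑ j, cellWeight (c j).1 * cellWeight (c j).2 := by
        simp only [mul_mul_mul_comm, Finset.mul_sum]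
    _ = N₁ * N₂ * ∑ i ∈ Finset.univ.image c, cellWeight i.1 * cellWeight i.2 := by
        rw [Finset.sum_image (hξ.injective_cellIndex h₁ h₂ hN y z).injOn]
    _ ≤ N₁ * N₂ * ∑' i : ℤ × ℤ, cellWeight i.1 * cellWeight i.2 := by
        gcongr
        exact hsummable.sum_le_tsum _ fun i _ => mul_nonneg (hnonneg _) (hnonneg _)
    _ = cellMass ^ 2 * (N₁ * N₂) := by
        rw [cellMass, sq, summable_cellWeight.tsum_mul_tsum summable_cellWeight hsummable, mul_comm]

end HyperbolicallySeparated

/-- The character of frequency `(k₁, k₂)` of the two-dimensional torus. -/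
def torusChar (k₁ k₂ : ℤ) (x : Torus 2) : ℂ := fourier k₁ (x 0) * fourier k₂ (x 1)

/-- Nodes adapted to the hyperbolic crosses: they are hyperbolically separated, and their equal
weight cubature formula integrates exactly all characters in a hyperbolic cross of size `m / A`. -/
structure IsHyperbolicNodeSet (A : ℕ) {m : ℕ} (ξ : Fin m → Torus 2) : Prop where
  separated : IsHyperbolicallySeparated ξ
  sum_torusChar_eq_zero : ∀ k₁ k₂ : ℤ, ¬(k₁ = 0 ∧ k₂ = 0) → A * max 1 |k₁| * max 1 |k₂| < m →
    ∑ j, torusChar k₁ k₂ (ξ j) = 0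

/-! ### Dirichlet and de la Vallée Poussin kernels -/

/-- The normalized Lebesgue measure on the circle. -/
abbrev circMeasure : Measure Circ := AddCircle.haarAddCircle

lemma integrable_of_continuous {X E : Type*} [TopologicalSpace X] [CompactSpace X]
    [MeasurableSpace X] [OpensMeasurableSpace X] {μ : Measure X} [IsFiniteMeasureOnCompacts μ]
    [NormedAddCommGroup E] {f : X → E} (hf : Continuous f) : Integrable f μ :=
  hf.integrable_of_hasCompactSupport (HasCompactSupport.of_compactSpace f)

lemma integral_fourier (k : ℤ) : ∫ t, fourier k t ∂circMeasure = if k = 0 then 1 else 0 := by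
  simpa [fourierCoeff, Pi.single_apply, eq_comm] using
    congrFun (fourierCoeff_fourier (T := 2 * π) k) 0

lemma norm_fourier_apply (k : ℤ) (t : Circ) : ‖(fourier k t : ℂ)‖ = 1 := by
  rw [fourier_apply]
  exact Circle.norm_coe _

lemma fourier_eq_exp_circRep (k : ℤ) (t : Circ) :
    (fourier k t : ℂ) = Complex.exp (Complex.I * ((k * circRep t : ℝ) : ℂ)) := by
  conv_lhs => rw [← coe_circRep t]
  have hpi : (π : ℂ) ≠ 0 := by exact_mod_cast Real.pi_ne_zero
  rw [fourier_coe_apply]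
  congr 1
  push_cast
  field_simp

lemma norm_fourier_sub_one_le (k : ℤ) (t : Circ) : ‖(fourier k t : ℂ) - 1‖ ≤ |(k : ℝ)| * ‖t‖ := by
  rw [fourier_eq_exp_circRep, ← abs_circRep, ← abs_mul]
  exact Real.norm_exp_I_mul_ofReal_sub_one_le

lemma le_norm_fourier_one_sub_one (t : Circ) : 2 / π * ‖t‖ ≤ ‖(fourier 1 t : ℂ) - 1‖ := by
  have hhalf : |circRep t / 2| ≤ π / 2 := by
    rw [abs_div, abs_two, abs_circRep]
    linarith [circ_norm_le_pi t]
  have hsin := Real.mul_abs_le_abs_sin hhalf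
  rw [abs_div, abs_two, abs_circRep] at hsin
  rw [fourier_eq_exp_circRep, Complex.norm_exp_I_mul_ofReal_sub_one, Int.cast_one, one_mul,
    norm_mul, Real.norm_eq_abs, Real.norm_eq_abs, abs_two]
  linarith

/-- The Dirichlet kernel of degree `M`. -/
def dirichletKer (M : ℕ) : C(Circ, ℂ) := ∑ k ∈ Finset.Icc (-(M : ℤ)) M, fourier k

lemma dirichletKer_apply (M : ℕ) (t : Circ) :
    dirichletKer M t = ∑ k ∈ Finset.Icc (-(M : ℤ)) M, fourier k t := by
  simp [dirichletKer]

lemma card_Icc_neg_natCast (M : ℕ) : (Finset.Icc (-(M : ℤ)) M).card = 2 * M + 1 := by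
  rw [Int.card_Icc]
  omega

lemma norm_dirichletKer_le (M : ℕ) (t : Circ) : ‖dirichletKer M t‖ ≤ 2 * M + 1 := by
  rw [dirichletKer_apply]
  refine (norm_sum_le _ _).trans_eq ?_
  simp only [norm_fourier_apply, Finset.sum_const, card_Icc_neg_natCast, nsmul_eq_mul, mul_one]
  push_cast
  rfl

lemma dirichletKer_mul_fourier_sub_one (M : ℕ) (t : Circ) :
    dirichletKer M t * (fourier 1 t - 1) = fourier (M + 1 : ℤ) t - fourier (-M : ℤ) t := by
  induction M with
  | zero => simp [dirichletKer_apply]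
  | succ M ih =>
    have hIcc : Finset.Icc (-((M + 1 : ℕ) : ℤ)) ((M + 1 : ℕ) : ℤ)
        = insert (-(M + 1 : ℤ)) (insert (M + 1 : ℤ) (Finset.Icc (-(M : ℤ)) M)) := by
      ext k
      simp only [Finset.mem_Icc, Finset.mem_insert]
      omega
    rw [dirichletKer_apply, hIcc, Finset.sum_insert (by simp; omega),
      Finset.sum_insert (by simp), ← dirichletKer_apply, ← add_assoc, add_mul, ih, sub_eq_add_neg,
      mul_add, add_mul, add_mul, ← fourier_add, ← fourier_add,
      show (-(M + 1 : ℤ)) + 1 = -M by ring]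
    push_cast
    ring_nf

lemma norm_dirichletKer_mul_norm_le (M : ℕ) (t : Circ) : ‖dirichletKer M t‖ * ‖t‖ ≤ π := by
  have hnum : ‖dirichletKer M t‖ * ‖(fourier 1 t : ℂ) - 1‖ ≤ 2 := by
    rw [← norm_mul, dirichletKer_mul_fourier_sub_one]
    refine (norm_sub_le _ _).trans_eq ?_
    rw [norm_fourier_apply, norm_fourier_apply, one_add_one_eq_two]
  have hle : ‖dirichletKer M t‖ * (2 / π * ‖t‖) ≤ 2 :=
    (mul_le_mul_of_nonneg_left (le_norm_fourier_one_sub_one t) (norm_nonneg _)).trans hnum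
  have hpi := Real.pi_pos
  rw [show ‖dirichletKer M t‖ * (2 / π * ‖t‖) = 2 * (‖dirichletKer M t‖ * ‖t‖) / π by ring,
    div_le_iff₀ hpi] at hle
  linarith

lemma norm_natCast_sub_dirichletKer_le (M : ℕ) {t : Circ} (ht : ‖t‖ ≤ 1 / (2 * (2 * M + 1))) :
    ‖((2 * M + 1 : ℕ) : ℂ) - dirichletKer M t‖ ≤ (2 * M + 1) / 2 := by
  have hsum : ((2 * M + 1 : ℕ) : ℂ) - dirichletKer M t
      = ∑ k ∈ Finset.Icc (-(M : ℤ)) M, (1 - fourier k t) := by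
    rw [Finset.sum_sub_distrib, ← dirichletKer_apply, Finset.sum_const, card_Icc_neg_natCast,
      nsmul_one]
  have hterm : ∀ k ∈ Finset.Icc (-(M : ℤ)) M, ‖(1 : ℂ) - fourier k t‖ ≤ 1 / 2 := by
    intro k hk
    have hkM : |(k : ℝ)| ≤ 2 * M + 1 := by
      have : |k| ≤ 2 * M + 1 := by
        rw [Finset.mem_Icc] at hk
        rw [abs_le]
        omega
      exact_mod_cast this
    rw [norm_sub_rev]
    calc ‖(fourier k t : ℂ) - 1‖ ≤ |(k : ℝ)| * ‖t‖ := norm_fourier_sub_one_le k t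
      _ ≤ (2 * M + 1) * (1 / (2 * (2 * M + 1))) := by gcongr
      _ = 1 / 2 := by field_simp
  rw [hsum]
  refine (norm_sum_le_of_le _ hterm).trans_eq ?_
  rw [Finset.sum_const, card_Icc_neg_natCast, nsmul_eq_mul]
  push_cast
  ring

lemma le_norm_dirichletKer (M : ℕ) {t : Circ} (ht : ‖t‖ ≤ 1 / (2 * (2 * M + 1))) :
    (2 * M + 1 : ℝ) / 2 ≤ ‖dirichletKer M t‖ := by
  have htri := (norm_sub_norm_le ((2 * M + 1 : ℕ) : ℂ) (dirichletKer M t)).trans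
    (norm_natCast_sub_dirichletKer_le M ht)
  rw [Complex.norm_natCast] at htri
  push_cast at htri
  linarith

lemma conj_dirichletKer (M : ℕ) (t : Circ) :
    (starRingEnd ℂ) (dirichletKer M t) = dirichletKer M t := by
  rw [dirichletKer_apply, map_sum]
  simp_rw [← fourier_neg]
  refine Finset.sum_nbij' (fun k => -k) (fun k => -k) ?_ ?_ ?_ ?_ ?_ <;> simp <;> omega

lemma ofReal_norm_dirichletKer_pow (M L : ℕ) (t : Circ) :
    ((‖dirichletKer M t‖ ^ (2 * L) : ℝ) : ℂ) = dirichletKer M t ^ (2 * L) := by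
  rw [pow_mul, pow_mul]
  push_cast
  rw [← Complex.conj_mul', conj_dirichletKer, sq]

/-- Trigonometric polynomials of degree at most `N`. -/
def trigPoly (N : ℕ) : Submodule ℂ C(Circ, ℂ) :=
  Submodule.span ℂ ((fun k : ℤ => (fourier k : C(Circ, ℂ))) '' {k | |k| ≤ N})

lemma fourier_mem_trigPoly {N : ℕ} {k : ℤ} (hk : |k| ≤ N) :
    (fourier k : C(Circ, ℂ)) ∈ trigPoly N := Submodule.subset_span ⟨k, hk, rfl⟩

lemma mul_mem_trigPoly {N M : ℕ} {f g : C(Circ, ℂ)} (hf : f ∈ trigPoly N)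
    (hg : g ∈ trigPoly M) : f * g ∈ trigPoly (N + M) := by
  have hmul := Submodule.mul_mem_mul hf hg
  rw [trigPoly, trigPoly, Submodule.span_mul_span] at hmul
  refine Submodule.span_mono ?_ hmul
  rintro _ ⟨_, ⟨k, hk, rfl⟩, _, ⟨m, hm, rfl⟩, rfl⟩
  refine ⟨k + m, ?_, ContinuousMap.ext fun t => fourier_add⟩
  simp only [Set.mem_ofPred_eq] at hk hm ⊢
  push_cast
  exact (abs_add_le _ _).trans (add_le_add hk hm)

lemma dirichletKer_mem_trigPoly (M : ℕ) : dirichletKer M ∈ trigPoly M :=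
  Submodule.sum_mem _ fun _ hk => fourier_mem_trigPoly (abs_le.2 (Finset.mem_Icc.1 hk))

lemma dirichletKer_pow_mem_trigPoly (M L : ℕ) : dirichletKer M ^ L ∈ trigPoly (L * M) := by
  induction L with
  | zero =>
    have hone : (1 : C(Circ, ℂ)) = fourier 0 := ContinuousMap.ext fun _ => fourier_zero.symm
    rw [pow_zero, hone]
    exact fourier_mem_trigPoly (by simp)
  | succ L ih =>
    rw [pow_succ, Nat.succ_mul]
    exact mul_mem_trigPoly ih (dirichletKer_mem_trigPoly M)

lemma integral_trigPoly_mul_fourier {N : ℕ} {f : C(Circ, ℂ)} (hf : f ∈ trigPoly N) {k : ℤ}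
    (hk : (N : ℤ) < |k|) : ∫ t, f t * fourier k t ∂circMeasure = 0 := by
  induction hf using Submodule.span_induction with
  | mem f hf =>
    obtain ⟨m, hm, rfl⟩ := hf
    simp only [Set.mem_ofPred_eq] at hm
    simp_rw [← fourier_add]
    rw [integral_fourier, if_neg]
    rintro h
    rw [eq_neg_of_add_eq_zero_left h, abs_neg] at hm
    omega
  | zero => simp
  | add f g _ _ hf hg =>
    simp only [ContinuousMap.add_apply, add_mul]
    rw [integral_add (integrable_of_continuous (by fun_prop))
      (integrable_of_continuous (by fun_prop)), hf, hg, add_zero]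
  | smul c f _ hf =>
    simp only [ContinuousMap.smul_apply, smul_eq_mul, mul_assoc]
    rw [integral_const_mul, hf, mul_zero]

lemma cauchyKer_coe {N x : ℝ} (hx : |x| ≤ π) :
    cauchyKer N (x : Circ) = N * (1 + (N * x) ^ 2)⁻¹ := by
  have hnorm : ‖(x : Circ)‖ = |x| := by
    rw [AddCircle.norm_coe_eq_abs_iff _ Real.two_pi_pos.ne', abs_of_pos Real.two_pi_pos]
    linarith
  rw [cauchyKer, hnorm, mul_pow, sq_abs, ← mul_pow, div_eq_mul_inv]

lemma integral_cauchyKer_le_one (N : ℝ) : ∫ t, cauchyKer N t ∂circMeasure ≤ 1 := by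
  have hpi := Real.pi_pos
  have hcongr : ∫ a in -π..π, cauchyKer N (a : Circ) = ∫ a in -π..π, N * (1 + (N * a) ^ 2)⁻¹ :=
    intervalIntegral.integral_congr fun a ha => cauchyKer_coe <| abs_le.2 <| by
      rwa [Set.uIcc_of_le (by linarith), Set.mem_Icc] at ha
  rw [AddCircle.integral_haarAddCircle, ← AddCircle.intervalIntegral_preimage (2 * π) (-π),
    show -π + 2 * π = π by ring, hcongr, intervalIntegral.integral_const_mul,
    intervalIntegral.mul_integral_comp_mul_left (f := fun x => (1 + x ^ 2)⁻¹),
    integral_inv_one_add_sq, smul_eq_mul, inv_mul_le_iff₀ (by positivity)]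
  linarith [Real.arctan_lt_pi_div_two (N * π), Real.neg_pi_div_two_lt_arctan (N * -π)]

lemma cauchyKer_le_mul_cauchyKer {N c : ℝ} (hN : 0 ≤ N) (hc : 1 ≤ c) (t : Circ) :
    cauchyKer N t ≤ c * cauchyKer (c * N) t := by
  have hc2 : 0 ≤ N * (c ^ 2 - 1) := mul_nonneg hN (by nlinarith)
  rw [cauchyKer, cauchyKer, ← mul_div_assoc, div_le_div_iff₀ (by positivity) (by positivity)]
  nlinarith

lemma le_mul_cauchyKer {N A B X : ℝ} {t : Circ} (hA : X ≤ A * N)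
    (hB : X * (N * ‖t‖) ^ 2 ≤ B * N) : X ≤ (A + B) * cauchyKer N t := by
  rw [cauchyKer, ← mul_div_assoc, le_div_iff₀ (by positivity)]
  linarith

/-- The trapezoidal multiplier of the de la Vallée Poussin kernel: the normalized convolution of
the indicators of `[-N, N]` and `[-2N, 2N]`. -/
def vpCoeff (N : ℕ) (k : ℤ) : ℝ :=
  (((Finset.Icc (-(N : ℤ)) N).filter fun j => |k - j| ≤ 2 * N).card : ℝ) / (2 * N + 1)

lemma vpCoeff_of_abs_le {N : ℕ} {k : ℤ} (hk : |k| ≤ N) : vpCoeff N k = 1 := by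
  rw [vpCoeff, Finset.filter_true_of_mem, card_Icc_neg_natCast]
  · push_cast
    exact div_self (by positivity)
  · intro j hj
    rw [Finset.mem_Icc] at hj
    rw [abs_le] at hk ⊢
    omega

/-- The de la Vallée Poussin kernel of degree `3N`, whose multiplier `vpCoeff N` is `1` on
`[-N, N]`. -/
def vpKer (N : ℕ) (t : Circ) : ℂ := dirichletKer N t * dirichletKer (2 * N) t / (2 * N + 1)

lemma continuous_vpKer (N : ℕ) : Continuous (vpKer N) := by unfold vpKer; fun_prop

lemma dirichletKer_mul_dirichletKer {N D : ℕ} (hD : 3 * N ≤ D) (t : Circ) :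
    dirichletKer N t * dirichletKer (2 * N) t
      = ∑ j ∈ Finset.Icc (-(N : ℤ)) N, ∑ k ∈ Finset.Icc (-(D : ℤ)) D,
        if |k - j| ≤ 2 * N then (fourier k t : ℂ) else 0 := by
  rw [dirichletKer_apply, dirichletKer_apply, Finset.sum_mul_sum]
  refine Finset.sum_congr rfl fun j hj => ?_
  rw [Finset.mem_Icc] at hj
  simp_rw [← Finset.sum_filter, ← fourier_add]
  refine Finset.sum_nbij' (fun k => j + k) (fun k => k - j) ?_ ?_ (by simp) (by simp) (by simp)
  · intro k hk
    simp only [Finset.mem_Icc, Finset.mem_filter, abs_le] at hk ⊢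
    push_cast at hk
    omega
  · intro k hk
    simp only [Finset.mem_Icc, Finset.mem_filter, abs_le] at hk ⊢
    push_cast
    omega

lemma vpKer_eq_sum {N D : ℕ} (hD : 3 * N ≤ D) (t : Circ) :
    vpKer N t = ∑ k ∈ Finset.Icc (-(D : ℤ)) D, (vpCoeff N k : ℂ) * fourier k t := by
  rw [vpKer, dirichletKer_mul_dirichletKer hD, Finset.sum_comm, Finset.sum_div]
  refine Finset.sum_congr rfl fun k _ => ?_
  rw [← Finset.sum_filter, Finset.sum_const, vpCoeff, nsmul_eq_mul]
  push_cast
  ring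

lemma norm_vpKer_le {N : ℕ} (hN : 1 ≤ N) (t : Circ) : ‖vpKer N t‖ ≤ 10 * cauchyKer N t := by
  have hN' : (1 : ℝ) ≤ N := by exact_mod_cast hN
  have hprod : ‖vpKer N t‖ * (2 * N + 1) = ‖dirichletKer N t‖ * ‖dirichletKer (2 * N) t‖ := by
    rw [vpKer, norm_div, norm_mul, show (2 * N + 1 : ℂ) = ((2 * N + 1 : ℝ) : ℂ) by push_cast; rfl,
      Complex.norm_real, Real.norm_of_nonneg (by positivity), div_mul_cancel₀ _ (by positivity)]
  have hpeak : ‖vpKer N t‖ ≤ 5 * N := by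
    have hle : ‖vpKer N t‖ * (2 * N + 1) ≤ (2 * (2 * N) + 1) * (2 * N + 1) := by
      rw [hprod, mul_comm]
      gcongr
      · exact_mod_cast norm_dirichletKer_le (2 * N) t
      · exact norm_dirichletKer_le N t
    linarith [le_of_mul_le_mul_right hle (by positivity)]
  have hdecay : ‖vpKer N t‖ * (N * ‖t‖) ^ 2 ≤ 5 * N := by
    have hpi : π * π ≤ 10 := by nlinarith [Real.pi_lt_d2, Real.pi_pos]
    have hle : (‖vpKer N t‖ * (2 * N + 1)) * ‖t‖ ^ 2 ≤ π * π := by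
      calc (‖vpKer N t‖ * (2 * N + 1)) * ‖t‖ ^ 2
          = (‖dirichletKer N t‖ * ‖t‖) * (‖dirichletKer (2 * N) t‖ * ‖t‖) := by rw [hprod]; ring
        _ ≤ π * π := by
          gcongr
          · exact norm_dirichletKer_mul_norm_le N t
          · exact norm_dirichletKer_mul_norm_le (2 * N) t
    have hnonneg : 0 ≤ ‖vpKer N t‖ * ‖t‖ ^ 2 := by positivity
    have hhalf : ‖vpKer N t‖ * ‖t‖ ^ 2 * N ≤ 5 := by linarith [hle, hpi, hnonneg]
    calc ‖vpKer N t‖ * (N * ‖t‖) ^ 2 = (‖vpKer N t‖ * ‖t‖ ^ 2 * N) * N := by ring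
      _ ≤ 5 * (N : ℝ) := by gcongr
  calc ‖vpKer N t‖ ≤ (5 + 5) * cauchyKer N t := le_mul_cauchyKer hpeak hdecay
    _ = 10 * cauchyKer N t := by norm_num

/-- The multiplier of the `s`-th dyadic block, with base frequency `Q`. -/
def blockCoeff (Q s : ℕ) (k : ℤ) : ℝ :=
  match s with
  | 0 => vpCoeff Q k
  | s + 1 => vpCoeff (Q * 2 ^ (s + 1)) k - vpCoeff (Q * 2 ^ s) k

lemma blockCoeff_succ_of_abs_le {Q s : ℕ} {k : ℤ} (hk : |k| ≤ (Q * 2 ^ s : ℕ)) :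
    blockCoeff Q (s + 1) k = 0 := by
  have hk' : |k| ≤ (Q * 2 ^ (s + 1) : ℕ) := hk.trans (by push_cast; gcongr <;> simp)
  rw [blockCoeff, vpCoeff_of_abs_le hk, vpCoeff_of_abs_le hk', sub_self]

/-- The frequencies of the `s`-th dyadic block. -/
def blockFreq (Q s : ℕ) : Finset ℤ :=
  Finset.Icc (-((3 * (Q * 2 ^ s) : ℕ) : ℤ)) (3 * (Q * 2 ^ s) : ℕ)

/-- The kernel of the `s`-th dyadic block, a difference of two consecutive de la Vallée Poussin
kernels. -/
def blockKer (Q s : ℕ) (t : Circ) : ℂ :=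
  ∑ k ∈ blockFreq Q s, (blockCoeff Q s k : ℂ) * fourier k t

lemma continuous_blockKer (Q s : ℕ) : Continuous (blockKer Q s) := by
  unfold blockKer; fun_prop

lemma blockKer_zero (Q : ℕ) (t : Circ) : blockKer Q 0 t = vpKer Q t := by
  rw [vpKer_eq_sum (D := 3 * (Q * 2 ^ 0)) (by simp)]
  rfl

lemma blockKer_succ (Q s : ℕ) (t : Circ) :
    blockKer Q (s + 1) t = vpKer (Q * 2 ^ (s + 1)) t - vpKer (Q * 2 ^ s) t := by
  rw [vpKer_eq_sum (D := 3 * (Q * 2 ^ (s + 1))) le_rfl,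
    vpKer_eq_sum (D := 3 * (Q * 2 ^ (s + 1))) (by gcongr <;> simp), ← Finset.sum_sub_distrib,
    blockKer, blockFreq]
  refine Finset.sum_congr rfl fun k _ => ?_
  rw [blockCoeff]
  push_cast
  ring

lemma sum_blockKer (Q S : ℕ) (t : Circ) :
    ∑ s ∈ Finset.range (S + 1), blockKer Q s t = vpKer (Q * 2 ^ S) t := by
  induction S with
  | zero => simp [blockKer_zero]
  | succ S ih => rw [Finset.sum_range_succ, ih, blockKer_succ, add_sub_cancel]

lemma norm_blockKer_le {Q : ℕ} (hQ : 1 ≤ Q) (s : ℕ) (t : Circ) :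
    ‖blockKer Q s t‖ ≤ 30 * cauchyKer (Q * 2 ^ s) t := by
  have hvp (s : ℕ) : ‖vpKer (Q * 2 ^ s) t‖ ≤ 10 * cauchyKer (Q * 2 ^ s) t := by
    exact_mod_cast norm_vpKer_le (Nat.mul_pos hQ (by positivity)) t
  cases s with
  | zero =>
    have hnonneg : 0 ≤ cauchyKer (Q * 2 ^ 0) t := cauchyKer_nonneg (by positivity) t
    calc ‖blockKer Q 0 t‖ = ‖vpKer (Q * 2 ^ 0) t‖ := by rw [blockKer_zero, pow_zero, mul_one]
      _ ≤ 10 * cauchyKer (Q * 2 ^ 0) t := hvp 0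
      _ ≤ 30 * cauchyKer (Q * 2 ^ 0) t := by linarith
  | succ s =>
    have hscale : cauchyKer (Q * 2 ^ s) t ≤ 2 * cauchyKer (Q * 2 ^ (s + 1)) t := by
      rw [show (Q : ℝ) * 2 ^ (s + 1) = 2 * (Q * 2 ^ s) by ring]
      exact cauchyKer_le_mul_cauchyKer (by positivity) one_le_two t
    calc ‖blockKer Q (s + 1) t‖ ≤ ‖vpKer (Q * 2 ^ (s + 1)) t‖ + ‖vpKer (Q * 2 ^ s) t‖ := by
          rw [blockKer_succ]
          exact norm_sub_le _ _
      _ ≤ 30 * cauchyKer (Q * 2 ^ (s + 1)) t := by linarith [hvp (s + 1), hvp s]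

/-! ### Jackson kernels -/

/-- The mass of the unnormalized Jackson kernel. -/
def jacksonMass (L M : ℕ) : ℝ := ∫ t, ‖dirichletKer M t‖ ^ (2 * L) ∂circMeasure

/-- The generalized Jackson kernel: the normalized `2L`-th power of the Dirichlet kernel. -/
def jacksonKer (L M : ℕ) (t : Circ) : ℝ := ‖dirichletKer M t‖ ^ (2 * L) / jacksonMass L M

lemma continuous_jacksonKer (L M : ℕ) : Continuous (jacksonKer L M) := by
  unfold jacksonKer; fun_prop

lemma measureReal_closedBall_circ {ε : ℝ} (hε : 0 ≤ ε) (hεpi : ε ≤ π) (t : Circ) :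
    circMeasure.real (Metric.closedBall t ε) = ε / π := by
  have hvol := congrArg ENNReal.toReal (AddCircle.volume_closedBall (2 * π) (x := t) ε)
  rw [AddCircle.volume_eq_smul_haarAddCircle, Measure.smul_apply, smul_eq_mul,
    min_eq_right (by linarith), ENNReal.toReal_mul, ENNReal.toReal_ofReal Real.two_pi_pos.le,
    ENNReal.toReal_ofReal (by positivity)] at hvol
  rw [Measure.real, eq_div_iff Real.pi_ne_zero]
  linarith

lemma le_jacksonMass (L M : ℕ) :
    ((2 * M + 1 : ℝ) / 2) ^ (2 * L) / (2 * π * (2 * M + 1)) ≤ jacksonMass L M := by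
  set ε : ℝ := 1 / (2 * (2 * M + 1)) with hε
  have hεpi : ε ≤ π := by
    refine le_trans ?_ (one_le_two.trans Real.two_le_pi)
    rw [hε, div_le_one (by positivity)]
    linarith [Nat.cast_nonneg (α := ℝ) M]
  have hint : Integrable (fun t => ‖dirichletKer M t‖ ^ (2 * L)) circMeasure :=
    integrable_of_continuous (by fun_prop)
  calc ((2 * M + 1 : ℝ) / 2) ^ (2 * L) / (2 * π * (2 * M + 1))
      = ∫ _ in Metric.closedBall (0 : Circ) ε, ((2 * M + 1 : ℝ) / 2) ^ (2 * L) ∂circMeasure := by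
        rw [setIntegral_const, measureReal_closedBall_circ (by positivity) hεpi, smul_eq_mul, hε]
        field_simp
    _ ≤ ∫ t in Metric.closedBall (0 : Circ) ε, ‖dirichletKer M t‖ ^ (2 * L) ∂circMeasure := by
        refine setIntegral_mono_on (integrable_const _).integrableOn hint.integrableOn
          Metric.isClosed_closedBall.measurableSet fun t ht => ?_
        gcongr
        exact le_norm_dirichletKer M (mem_closedBall_zero_iff.1 ht)
    _ ≤ jacksonMass L M :=
        setIntegral_le_integral hint (Filter.Eventually.of_forall fun t => by positivity)

lemma jacksonMass_pos (L M : ℕ) : 0 < jacksonMass L M :=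
  lt_of_lt_of_le (by positivity) (le_jacksonMass L M)

lemma jacksonKer_nonneg (L M : ℕ) (t : Circ) : 0 ≤ jacksonKer L M t :=
  div_nonneg (by positivity) (jacksonMass_pos L M).le

lemma integral_jacksonKer (L M : ℕ) : ∫ t, jacksonKer L M t ∂circMeasure = 1 := by
  unfold jacksonKer
  rw [integral_div]
  exact div_self (jacksonMass_pos L M).ne'

lemma norm_dirichletKer_sq_le (M : ℕ) (t : Circ) :
    ‖dirichletKer M t‖ ^ 2 ≤ 11 * (2 * M + 1) * cauchyKer (2 * M + 1) t := by
  have hpi : π ^ 2 ≤ 10 := by nlinarith [Real.pi_lt_d2, Real.pi_pos]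
  have hpeak : ‖dirichletKer M t‖ ^ 2 ≤ (2 * M + 1) * (2 * M + 1) := by
    rw [← sq]
    gcongr
    exact norm_dirichletKer_le M t
  have hdecay :
      ‖dirichletKer M t‖ ^ 2 * ((2 * M + 1) * ‖t‖) ^ 2 ≤ 10 * (2 * M + 1) * (2 * M + 1) :=
    calc ‖dirichletKer M t‖ ^ 2 * ((2 * M + 1) * ‖t‖) ^ 2
        = (2 * M + 1) ^ 2 * (‖dirichletKer M t‖ * ‖t‖) ^ 2 := by ring
      _ ≤ (2 * M + 1) ^ 2 * π ^ 2 := by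
        gcongr
        exact norm_dirichletKer_mul_norm_le M t
      _ ≤ (2 * M + 1) ^ 2 * 10 := by gcongr
      _ = 10 * (2 * M + 1) * (2 * M + 1) := by ring
  exact (le_mul_cauchyKer hpeak hdecay).trans_eq (by ring)

lemma integral_norm_dirichletKer_sq_le (M : ℕ) :
    ∫ t, ‖dirichletKer M t‖ ^ 2 ∂circMeasure ≤ 11 * (2 * M + 1) :=
  calc ∫ t, ‖dirichletKer M t‖ ^ 2 ∂circMeasure
      ≤ ∫ t, 11 * (2 * M + 1) * cauchyKer (2 * M + 1) t ∂circMeasure :=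
        integral_mono (integrable_of_continuous (by fun_prop))
          (integrable_of_continuous ((continuous_cauchyKer _).const_mul _))
          (norm_dirichletKer_sq_le M)
    _ ≤ 11 * (2 * M + 1) := by
        rw [integral_const_mul]
        exact mul_le_of_le_one_right (by positivity) (integral_cauchyKer_le_one _)

section Moments

variable {L : ℕ} {q : ℝ}

lemma norm_dirichletKer_pow_mul_rpow_le (hq : 0 ≤ q) (hL : q + 2 ≤ 2 * L) (M : ℕ) (t : Circ) :
    ‖dirichletKer M t‖ ^ (2 * L) * ‖t‖ ^ q
      ≤ π ^ q * (2 * M + 1) ^ (2 * L - 2 - q) * ‖dirichletKer M t‖ ^ 2 := by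
  have hL0 : L ≠ 0 := by
    rintro rfl
    norm_num at hL
    linarith
  rcases (norm_nonneg (dirichletKer M t)).eq_or_lt with h0 | h0
  · simp [← h0, hL0]
  · have hsplit : ‖dirichletKer M t‖ ^ (2 * L)
        = ‖dirichletKer M t‖ ^ q * ‖dirichletKer M t‖ ^ (2 * L - 2 - q)
          * ‖dirichletKer M t‖ ^ 2 := by
      rw [← Real.rpow_natCast, ← Real.rpow_natCast _ 2, ← Real.rpow_add h0, ← Real.rpow_add h0]
      congr 1
      push_cast
      ring
    calc ‖dirichletKer M t‖ ^ (2 * L) * ‖t‖ ^ q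
        = (‖dirichletKer M t‖ * ‖t‖) ^ q * ‖dirichletKer M t‖ ^ (2 * L - 2 - q)
            * ‖dirichletKer M t‖ ^ 2 := by
          rw [hsplit, Real.mul_rpow (norm_nonneg _) (norm_nonneg _)]
          ring
      _ ≤ π ^ q * (2 * M + 1) ^ (2 * L - 2 - q) * ‖dirichletKer M t‖ ^ 2 := by
          gcongr
          · exact norm_dirichletKer_mul_norm_le M t
          · linarith
          · exact norm_dirichletKer_le M t

lemma integral_jacksonKer_mul_rpow_le_div (hq : 0 ≤ q) (hL : q + 2 ≤ 2 * L) (M : ℕ) :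
    ∫ t, jacksonKer L M t * ‖t‖ ^ q ∂circMeasure
      ≤ π ^ q * (2 * M + 1) ^ (2 * L - 2 - q) * (11 * (2 * M + 1)) / jacksonMass L M := by
  have hmass := jacksonMass_pos L M
  have hpt (t : Circ) : jacksonKer L M t * ‖t‖ ^ q
      ≤ π ^ q * (2 * M + 1) ^ (2 * L - 2 - q) / jacksonMass L M * ‖dirichletKer M t‖ ^ 2 := by
    rw [jacksonKer, div_mul_eq_mul_div, div_mul_eq_mul_div]
    exact div_le_div_of_nonneg_right (norm_dirichletKer_pow_mul_rpow_le hq hL M t) hmass.le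
  calc ∫ t, jacksonKer L M t * ‖t‖ ^ q ∂circMeasure
      ≤ ∫ t, π ^ q * (2 * M + 1) ^ (2 * L - 2 - q) / jacksonMass L M * ‖dirichletKer M t‖ ^ 2
          ∂circMeasure := by
        refine integral_mono (integrable_of_continuous ?_)
          (integrable_of_continuous (by fun_prop)) hpt
        exact (continuous_jacksonKer L M).mul (continuous_norm.rpow_const fun _ => Or.inr hq)
    _ ≤ π ^ q * (2 * M + 1) ^ (2 * L - 2 - q) / jacksonMass L M * (11 * (2 * M + 1)) := by
        rw [integral_const_mul]
        gcongr
        exact integral_norm_dirichletKer_sq_le M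
    _ = _ := by ring

lemma exists_integral_jacksonKer_mul_rpow_le (hq : 0 ≤ q) (hL : q + 2 ≤ 2 * L) :
    ∃ C : ℝ, 0 < C ∧ ∀ M : ℕ,
      ∫ t, jacksonKer L M t * ‖t‖ ^ q ∂circMeasure ≤ C * (2 * M + 1 : ℝ) ^ (-q) := by
  refine ⟨π ^ q * 11 * (2 * π) * 2 ^ (2 * L), by positivity, fun M => ?_⟩
  set A : ℝ := 2 * M + 1
  have hA : 0 < A := by positivity
  calc ∫ t, jacksonKer L M t * ‖t‖ ^ q ∂circMeasure
      ≤ π ^ q * A ^ (2 * L - 2 - q) * (11 * A) / jacksonMass L M :=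
        integral_jacksonKer_mul_rpow_le_div hq hL M
    _ ≤ π ^ q * A ^ (2 * L - 2 - q) * (11 * A) / ((A / 2) ^ (2 * L) / (2 * π * A)) := by
        gcongr
        exact le_jacksonMass L M
    _ = π ^ q * 11 * (2 * π) * 2 ^ (2 * L) * A ^ (-q) := by
        have hexp : A ^ (2 * L - 2 - q : ℝ) = A ^ (2 * L) * A ^ (-q) / A ^ 2 := by
          rw [← Real.rpow_natCast, ← Real.rpow_natCast, ← Real.rpow_add hA, ← Real.rpow_sub hA]
          congr 1
          push_cast
          ring
        rw [hexp, div_pow]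
        field_simp

end Moments

lemma fourier_apply_pow (k : ℤ) (i : ℕ) (t : Circ) :
    (fourier k t : ℂ) ^ i = fourier (i * k : ℤ) t := by
  induction i with
  | zero => simp
  | succ i ih => rw [pow_succ, ih, ← fourier_add, Nat.cast_succ, add_one_mul]

section HighFrequency

variable {L M : ℕ} {k : ℤ}

lemma integral_jacksonKer_mul_fourier_pow (hk : ((2 * L * M : ℕ) : ℤ) < |k|) (i : ℕ) :
    ∫ t, (jacksonKer L M t : ℂ) * fourier k t ^ i ∂circMeasure = if i = 0 then 1 else 0 := by
  split_ifs with hi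
  · simp only [hi, pow_zero, mul_one, integral_complex_ofReal, integral_jacksonKer,
      Complex.ofReal_one]
  · have hpoly (t : Circ) : (jacksonKer L M t : ℂ) * fourier k t ^ i
        = (jacksonMass L M : ℂ)⁻¹ * ((dirichletKer M ^ (2 * L)) t * fourier (i * k : ℤ) t) := by
      rw [fourier_apply_pow, jacksonKer, Complex.ofReal_div, ofReal_norm_dirichletKer_pow,
        ContinuousMap.pow_apply]
      ring
    have hik : ((2 * L * M : ℕ) : ℤ) < |i * k| := by
      rw [abs_mul, Nat.abs_cast]
      exact hk.trans_le (le_mul_of_one_le_left (abs_nonneg k)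
        (by exact_mod_cast Nat.one_le_iff_ne_zero.2 hi))
    simp_rw [hpoly]
    rw [integral_const_mul, integral_trigPoly_mul_fourier
      (dirichletKer_pow_mem_trigPoly M (2 * L)) hik, mul_zero]

lemma integral_jacksonKer_mul_fourier_sub_one_pow (l : ℕ) (hk : ((2 * L * M : ℕ) : ℤ) < |k|) :
    ∫ t, (jacksonKer L M t : ℂ) * (fourier k t - 1) ^ l ∂circMeasure = (-1) ^ l := by
  have hbinom (t : Circ) : (jacksonKer L M t : ℂ) * (fourier k t - 1) ^ l
      = ∑ i ∈ Finset.range (l + 1), ((-1) ^ (l - i) * (l.choose i : ℂ)) *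
        ((jacksonKer L M t : ℂ) * fourier k t ^ i) := by
    rw [sub_eq_add_neg, add_pow, Finset.mul_sum]
    refine Finset.sum_congr rfl fun i _ => ?_
    ring
  have hcont := continuous_jacksonKer L M
  simp_rw [hbinom]
  rw [integral_finsetSum _ fun i _ => integrable_of_continuous (by fun_prop)]
  simp_rw [integral_const_mul, integral_jacksonKer_mul_fourier_pow hk]
  simp

end HighFrequency

/-! ### Differences and Fourier coefficients on the torus -/

instance isAddLeftInvariant_torusMeasure (d : ℕ) : (torusMeasure d).IsAddLeftInvariant := by
  unfold torusMeasure; infer_instance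

instance isNegInvariant_torusMeasure (d : ℕ) : (torusMeasure d).IsNegInvariant := by
  have : circMeasure.IsNegInvariant := Measure.IsAddHaarMeasure.isNegInvariant_of_regular _
  unfold torusMeasure
  infer_instance

lemma integral_torus_mul {R : Type*} [RCLike R] (a b : Circ → R) :
    ∫ x, a (x 0) * b (x 1) ∂torusMeasure 2
      = (∫ t, a t ∂circMeasure) * ∫ t, b t ∂circMeasure := by
  have hprod := integral_fintype_prod_eq_prod (𝕜 := R) (ι := Fin 2) (E := fun _ => Circ)
    (f := ![a, b]) (μ := fun _ => circMeasure)
  simpa [Fin.prod_univ_two, torusMeasure] using hprod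

lemma continuous_integral_torus {E : Type*} [NormedAddCommGroup E] [NormedSpace ℝ E] {d : ℕ}
    {F : Torus d → Torus d → E} (hF : Continuous fun p : Torus d × Torus d => F p.1 p.2) :
    Continuous fun x => ∫ y, F x y ∂torusMeasure d := by
  simpa using continuous_parametric_integral_of_continuous (μ := torusMeasure d) hF isCompact_univ

/-- The `l`-th difference in the `j`-th variable, with a step on the circle. -/
def circDiff (l : ℕ) (t : Circ) (j : Fin 2) (g : Torus 2 → ℂ) : Torus 2 → ℂ :=
  (fwdDiff (Pi.single j t : Torus 2))^[l] g

/-- The order of the difference applied in a variable whose dyadic index is `u`: no difference is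
taken at `u = 0`. -/
def diffOrder (l u : ℕ) : ℕ := if u = 0 then 0 else l

/-- The mixed difference over the variables `j` with `s j ≠ 0`. -/
def blockDiff (l : ℕ) (s : Fin 2 → ℕ) (t : Torus 2) (f : Torus 2 → ℂ) : Torus 2 → ℂ :=
  circDiff (diffOrder l (s 1)) (t 1) 1 (circDiff (diffOrder l (s 0)) (t 0) 0 f)

lemma mixedDiff_eq_coordDiff {𝕜 : Type*} [RCLike 𝕜] (l : ℕ) (t : Fin 2 → ℝ)
    (e : Finset (Fin 2)) (f : Torus 2 → 𝕜) :
    mixedDiff l t e f = coordDiff (if 1 ∈ e then l else 0) (t 1) 1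
      (coordDiff (if 0 ∈ e then l else 0) (t 0) 0 f) := by
  simp only [mixedDiff, List.finRange_succ, List.finRange_zero, List.map_nil,
    List.map_cons, List.foldl_cons, List.foldl_nil, Fin.succ_zero_eq_one]
  split_ifs <;> rfl

lemma mixedDiff_eq_blockDiff (l : ℕ) (s : Fin 2 → ℕ) (t : Fin 2 → ℝ) (f : Torus 2 → ℂ) :
    mixedDiff l t {j | s j ≠ 0} f = blockDiff l s (fun j => (t j : Circ)) f := by
  simp only [mixedDiff_eq_coordDiff, Finset.mem_filter, Finset.mem_univ, true_and, ne_eq, ite_not]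
  rfl

lemma continuous_circDiff_apply {X : Type*} [TopologicalSpace X] (l : ℕ) (j : Fin 2) {τ : X → Circ}
    (hτ : Continuous τ) {G : X → Torus 2 → ℂ}
    (hG : Continuous fun p : X × Torus 2 => G p.1 p.2) :
    Continuous fun p : X × Torus 2 => circDiff l (τ p.1) j (G p.1) p.2 := by
  simp only [circDiff, fwdDiff_iter_eq_sum_shift]
  refine continuous_finsetSum _ fun k _ => Continuous.const_smul ?_ _
  have hsingle : Continuous fun p : X × Torus 2 => (Pi.single j (τ p.1) : Torus 2) :=
    (continuous_single (A := fun _ : Fin 2 => Circ) j).comp (hτ.comp continuous_fst)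
  exact hG.comp (continuous_fst.prodMk (continuous_snd.add (hsingle.const_smul k)))

lemma continuous_blockDiff_apply (l : ℕ) (s : Fin 2 → ℕ) {f : Torus 2 → ℂ} (hf : Continuous f) :
    Continuous fun p : Torus 2 × Torus 2 => blockDiff l s p.1 f p.2 := by
  refine continuous_circDiff_apply (τ := fun t : Torus 2 => t 1)
    (G := fun t => circDiff (diffOrder l (s 0)) (t 0) 0 f) _ _ (continuous_apply 1) ?_
  exact continuous_circDiff_apply (τ := fun t : Torus 2 => t 0) (G := fun _ => f) _ _
    (continuous_apply 0) (hf.comp continuous_snd)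

lemma continuous_circDiff {f : Torus 2 → ℂ} (hf : Continuous f) (l : ℕ) (t : Circ) (j : Fin 2) :
    Continuous (circDiff l t j f) :=
  (continuous_circDiff_apply (X := Unit) (τ := fun _ => t) (G := fun _ => f) l j continuous_const
    (hf.comp continuous_snd)).comp (Continuous.prodMk_right ())

lemma continuous_torusChar (k₁ k₂ : ℤ) : Continuous (torusChar k₁ k₂) := by
  unfold torusChar; fun_prop

lemma torusChar_add_apply (k₁ k₂ : ℤ) (x y : Torus 2) :
    torusChar k₁ k₂ (x + y) = torusChar k₁ k₂ x * torusChar k₁ k₂ y := by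
  simp only [torusChar, Pi.add_apply, fourier_apply, smul_add, AddCircle.toCircle_add,
    Circle.coe_mul]
  ring

lemma torusChar_mul_torusChar (k₁ k₂ m₁ m₂ : ℤ) (x : Torus 2) :
    torusChar k₁ k₂ x * torusChar m₁ m₂ x = torusChar (k₁ + m₁) (k₂ + m₂) x := by
  simp only [torusChar, fourier_add]
  ring

lemma torusChar_zero_zero (x : Torus 2) : torusChar 0 0 x = 1 := by simp [torusChar]

/-- The Fourier coefficients on the torus. -/
def torusCoeff (f : Torus 2 → ℂ) (k₁ k₂ : ℤ) : ℂ :=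
  ∫ y, f y * torusChar (-k₁) (-k₂) y ∂torusMeasure 2

section TorusCoeff

variable {f : Torus 2 → ℂ}

lemma integral_add_mul_torusChar (h : Torus 2) (k₁ k₂ : ℤ) :
    ∫ y, f (y + h) * torusChar (-k₁) (-k₂) y ∂torusMeasure 2
      = torusChar k₁ k₂ h * torusCoeff f k₁ k₂ := by
  have hshift (y : Torus 2) : f (y + h) * torusChar (-k₁) (-k₂) y
      = torusChar k₁ k₂ h * (f (y + h) * torusChar (-k₁) (-k₂) (y + h)) := by
    have hinv : torusChar k₁ k₂ h * torusChar (-k₁) (-k₂) h = 1 := by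
      rw [torusChar_mul_torusChar, add_neg_cancel, add_neg_cancel, torusChar_zero_zero]
    rw [torusChar_add_apply]
    linear_combination (-(f (y + h)) * torusChar (-k₁) (-k₂) y) * hinv
  simp_rw [hshift]
  rw [integral_const_mul, torusCoeff,
    integral_add_right_eq_self (fun y => f y * torusChar (-k₁) (-k₂) y) h]

variable (hf : Continuous f)
include hf

lemma torusCoeff_fwdDiff (h : Torus 2) (k₁ k₂ : ℤ) :
    torusCoeff (fwdDiff h f) k₁ k₂ = (torusChar k₁ k₂ h - 1) * torusCoeff f k₁ k₂ := by
  have hchar := continuous_torusChar (-k₁) (-k₂)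
  simp only [torusCoeff, fwdDiff, sub_mul]
  rw [integral_sub (integrable_of_continuous (by fun_prop))
    (integrable_of_continuous (by fun_prop)), integral_add_mul_torusChar, one_mul, torusCoeff]

lemma torusCoeff_circDiff (l : ℕ) (t : Circ) (j : Fin 2) (k₁ k₂ : ℤ) :
    torusCoeff (circDiff l t j f) k₁ k₂
      = (torusChar k₁ k₂ (Pi.single j t) - 1) ^ l * torusCoeff f k₁ k₂ := by
  induction l with
  | zero => simp [circDiff]
  | succ l ih =>
    rw [circDiff, Function.iterate_succ_apply', ← circDiff,
      torusCoeff_fwdDiff (continuous_circDiff hf l t j), ih]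
    ring

lemma torusCoeff_blockDiff (l : ℕ) (s : Fin 2 → ℕ) (t : Torus 2) (k₁ k₂ : ℤ) :
    torusCoeff (blockDiff l s t f) k₁ k₂
      = ((fourier k₁ (t 0) - 1) ^ diffOrder l (s 0) *
        (fourier k₂ (t 1) - 1) ^ diffOrder l (s 1)) * torusCoeff f k₁ k₂ := by
  have hfst : torusChar k₁ k₂ (Pi.single 0 (t 0)) = fourier k₁ (t 0) := by simp [torusChar]
  have hsnd : torusChar k₁ k₂ (Pi.single 1 (t 1)) = fourier k₂ (t 1) := by simp [torusChar]
  rw [blockDiff, torusCoeff_circDiff (continuous_circDiff hf _ _ _), torusCoeff_circDiff hf,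
    hfst, hsnd]
  ring

end TorusCoeff

/-! ### Dyadic blocks and averaged differences -/

/-- The product of two one-dimensional block kernels. -/
def blockKer₂ (Q : ℕ) (s : Fin 2 → ℕ) (x : Torus 2) : ℂ :=
  blockKer Q (s 0) (x 0) * blockKer Q (s 1) (x 1)

lemma continuous_blockKer₂ (Q : ℕ) (s : Fin 2 → ℕ) : Continuous (blockKer₂ Q s) := by
  have h0 := continuous_blockKer Q (s 0)
  have h1 := continuous_blockKer Q (s 1)
  unfold blockKer₂
  fun_prop

/-- The dyadic block of index `s` of a function, as a convolution. -/
def block (Q : ℕ) (s : Fin 2 → ℕ) (f : Torus 2 → ℂ) (x : Torus 2) : ℂ :=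
  ∫ y, blockKer₂ Q s (x - y) * f y ∂torusMeasure 2

/-- The product of two Jackson kernels at the scales `2 ^ s 0` and `2 ^ s 1`. -/
def jacksonKer₂ (L : ℕ) (s : Fin 2 → ℕ) (t : Torus 2) : ℝ :=
  jacksonKer L (2 ^ s 0) (t 0) * jacksonKer L (2 ^ s 1) (t 1)

lemma continuous_jacksonKer₂ (L : ℕ) (s : Fin 2 → ℕ) : Continuous (jacksonKer₂ L s) := by
  have h0 := continuous_jacksonKer L (2 ^ s 0)
  have h1 := continuous_jacksonKer L (2 ^ s 1)
  unfold jacksonKer₂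
  fun_prop

lemma jacksonKer₂_nonneg (L : ℕ) (s : Fin 2 → ℕ) (t : Torus 2) : 0 ≤ jacksonKer₂ L s t :=
  mul_nonneg (jacksonKer_nonneg _ _ _) (jacksonKer_nonneg _ _ _)

lemma integral_jacksonKer₂ (L : ℕ) (s : Fin 2 → ℕ) :
    ∫ t, jacksonKer₂ L s t ∂torusMeasure 2 = 1 := by
  simp only [jacksonKer₂]
  rw [integral_torus_mul, integral_jacksonKer, integral_jacksonKer, one_mul]

/-- The mixed difference averaged over its step. Its Fourier coefficients at the frequencies of the
block `s` are, up to sign, those of the function. -/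
def avgDiff (L l : ℕ) (s : Fin 2 → ℕ) (f : Torus 2 → ℂ) (x : Torus 2) : ℂ :=
  ∫ t, (jacksonKer₂ L s t : ℂ) * blockDiff l s t f x ∂torusMeasure 2

lemma integral_jacksonKer_mul_fourier_sub_one_pow_diffOrder (L l : ℕ) {u : ℕ} {k : ℤ}
    (hk : u ≠ 0 → ((2 * L * 2 ^ u : ℕ) : ℤ) < |k|) :
    ∫ t, (jacksonKer L (2 ^ u) t : ℂ) * (fourier k t - 1) ^ diffOrder l u ∂circMeasure
      = (-1) ^ diffOrder l u := by
  rw [diffOrder]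
  split_ifs with hu
  · simp only [pow_zero, mul_one]
    rw [integral_complex_ofReal, integral_jacksonKer, Complex.ofReal_one]
  · exact integral_jacksonKer_mul_fourier_sub_one_pow l (hk hu)

section Blocks

variable {f : Torus 2 → ℂ} (hf : Continuous f) (s : Fin 2 → ℕ)
include hf

lemma continuous_block (Q : ℕ) : Continuous (block Q s f) := by
  have hker := continuous_blockKer₂ Q s
  exact continuous_integral_torus (by fun_prop)

lemma continuous_jacksonKer₂_mul_blockDiff (L l : ℕ) : Continuous fun p : Torus 2 × Torus 2 =>
    (jacksonKer₂ L s p.2 : ℂ) * blockDiff l s p.2 f p.1 :=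
  (Complex.continuous_ofReal.comp ((continuous_jacksonKer₂ L s).comp continuous_snd)).mul
    ((continuous_blockDiff_apply l s hf).comp continuous_swap)

lemma continuous_avgDiff (L l : ℕ) : Continuous (avgDiff L l s f) :=
  continuous_integral_torus (continuous_jacksonKer₂_mul_blockDiff hf s L l)

lemma torusCoeff_avgDiff_eq_integral (L l : ℕ) (k₁ k₂ : ℤ) :
    torusCoeff (avgDiff L l s f) k₁ k₂
      = ∫ t, (jacksonKer₂ L s t : ℂ) * torusCoeff (blockDiff l s t f) k₁ k₂ ∂torusMeasure 2 := by
  calc torusCoeff (avgDiff L l s f) k₁ k₂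
      = ∫ x, ∫ t, (jacksonKer₂ L s t : ℂ) * blockDiff l s t f x * torusChar (-k₁) (-k₂) x
          ∂torusMeasure 2 ∂torusMeasure 2 := by
        simp only [torusCoeff, avgDiff, integral_mul_const]
    _ = ∫ t, ∫ x, (jacksonKer₂ L s t : ℂ) * blockDiff l s t f x * torusChar (-k₁) (-k₂) x
          ∂torusMeasure 2 ∂torusMeasure 2 :=
        integral_integral_swap <| integrable_of_continuous
          ((continuous_jacksonKer₂_mul_blockDiff hf s L l).mul
            ((continuous_torusChar (-k₁) (-k₂)).comp continuous_fst))
    _ = ∫ t, (jacksonKer₂ L s t : ℂ) * torusCoeff (blockDiff l s t f) k₁ k₂ ∂torusMeasure 2 := by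
        simp only [mul_assoc, integral_const_mul, torusCoeff]

lemma torusCoeff_avgDiff (L l : ℕ) {k₁ k₂ : ℤ} (h₁ : s 0 ≠ 0 → ((2 * L * 2 ^ s 0 : ℕ) : ℤ) < |k₁|)
    (h₂ : s 1 ≠ 0 → ((2 * L * 2 ^ s 1 : ℕ) : ℤ) < |k₂|) :
    torusCoeff (avgDiff L l s f) k₁ k₂
      = (-1) ^ (diffOrder l (s 0) + diffOrder l (s 1)) * torusCoeff f k₁ k₂ := by
  calc torusCoeff (avgDiff L l s f) k₁ k₂
      = ∫ t, (((jacksonKer L (2 ^ s 0) (t 0) : ℂ) * (fourier k₁ (t 0) - 1) ^ diffOrder l (s 0)) *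
          ((jacksonKer L (2 ^ s 1) (t 1) : ℂ) * (fourier k₂ (t 1) - 1) ^ diffOrder l (s 1)))
          * torusCoeff f k₁ k₂ ∂torusMeasure 2 := by
        rw [torusCoeff_avgDiff_eq_integral hf]
        congr 1 with t
        rw [torusCoeff_blockDiff hf, jacksonKer₂]
        push_cast
        ring
    _ = (-1) ^ (diffOrder l (s 0) + diffOrder l (s 1)) * torusCoeff f k₁ k₂ := by
        rw [integral_mul_const, integral_torus_mul
            (fun t => (jacksonKer L (2 ^ s 0) t : ℂ) * (fourier k₁ t - 1) ^ diffOrder l (s 0))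
            (fun t => (jacksonKer L (2 ^ s 1) t : ℂ) * (fourier k₂ t - 1) ^ diffOrder l (s 1)),
          integral_jacksonKer_mul_fourier_sub_one_pow_diffOrder L l h₁,
          integral_jacksonKer_mul_fourier_sub_one_pow_diffOrder L l h₂, pow_add]

end Blocks

section Jensen

variable {q : ℝ} (hq : 1 ≤ q)
include hq

lemma rpow_add_mul_sub_le_rpow {a b : ℝ} (ha : 0 < a) (hb : 0 ≤ b) :
    a ^ q + q * a ^ (q - 1) * (b - a) ≤ b ^ q := by
  have hbernoulli : 1 + q * (b / a - 1) ≤ (1 + (b / a - 1)) ^ q :=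
    one_add_mul_self_le_rpow_one_add (by linarith [div_nonneg hb ha.le]) hq
  rw [add_sub_cancel, Real.div_rpow hb ha.le, le_div_iff₀ (by positivity)] at hbernoulli
  refine le_of_eq_of_le ?_ hbernoulli
  rw [Real.rpow_sub_one ha.ne']
  field_simp

lemma rpow_integral_mul_le {Ω : Type*} [MeasurableSpace Ω] {μ : Measure Ω} {g w : Ω → ℝ}
    (hg : ∀ x, 0 ≤ g x) (hw : ∀ x, 0 ≤ w x) (hwi : Integrable w μ)
    (hgw : Integrable (fun x => g x * w x) μ) (hgq : Integrable (fun x => g x ^ q * w x) μ)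
    (hmass : ∫ x, w x ∂μ ≤ 1) :
    (∫ x, g x * w x ∂μ) ^ q ≤ ∫ x, g x ^ q * w x ∂μ := by
  set a := ∫ x, g x * w x ∂μ
  have ha : 0 ≤ a := integral_nonneg fun x => mul_nonneg (hg x) (hw x)
  rcases ha.eq_or_lt with ha0 | ha0
  · rw [← ha0, Real.zero_rpow (by linarith)]
    exact integral_nonneg fun x => mul_nonneg (Real.rpow_nonneg (hg x) _) (hw x)
  have hpow : a ^ (q - 1) * a = a ^ q := by
    rw [Real.rpow_sub_one ha0.ne', div_mul_cancel₀ _ ha0.ne']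
  have htangent (x : Ω) :
      (1 - q) * a ^ q * w x + q * a ^ (q - 1) * (g x * w x) ≤ g x ^ q * w x := by
    calc (1 - q) * a ^ q * w x + q * a ^ (q - 1) * (g x * w x)
        = (a ^ q + q * a ^ (q - 1) * (g x - a)) * w x := by rw [← hpow]; ring
      _ ≤ g x ^ q * w x :=
        mul_le_mul_of_nonneg_right (rpow_add_mul_sub_le_rpow hq ha0 (hg x)) (hw x)
  calc a ^ q = (1 - q) * a ^ q + q * (a ^ (q - 1) * a) := by rw [hpow]; ring
    _ ≤ (1 - q) * a ^ q * ∫ x, w x ∂μ + q * a ^ (q - 1) * a := by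
      have hneg : (1 - q) * a ^ q ≤ 0 :=
        mul_nonpos_of_nonpos_of_nonneg (sub_nonpos.2 hq) (Real.rpow_nonneg ha _)
      linarith [mul_le_mul_of_nonpos_left hmass hneg]
    _ = ∫ x, ((1 - q) * a ^ q * w x + q * a ^ (q - 1) * (g x * w x)) ∂μ := by
      rw [integral_add (hwi.const_mul _) (hgw.const_mul _), integral_const_mul,
        integral_const_mul]
    _ ≤ ∫ x, g x ^ q * w x ∂μ :=
      integral_mono ((hwi.const_mul _).add (hgw.const_mul _)) hgq htangent

end Jensen

section BlockBounds

variable {f : Torus 2 → ℂ}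

lemma blockKer₂_sub_eq_sum (Q : ℕ) (s : Fin 2 → ℕ) (x y : Torus 2) :
    blockKer₂ Q s (x - y) = ∑ k ∈ blockFreq Q (s 0) ×ˢ blockFreq Q (s 1),
      ((blockCoeff Q (s 0) k.1 : ℂ) * blockCoeff Q (s 1) k.2 * torusChar k.1 k.2 x)
        * torusChar (-k.1) (-k.2) y := by
  rw [blockKer₂, blockKer, blockKer, Finset.sum_mul_sum, ← Finset.sum_product']
  refine Finset.sum_congr rfl fun k _ => ?_
  have hchar : torusChar k.1 k.2 (x - y) = torusChar k.1 k.2 x * torusChar (-k.1) (-k.2) y := by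
    conv_rhs => rw [← sub_add_cancel x y, torusChar_add_apply, mul_assoc, torusChar_mul_torusChar,
      add_neg_cancel, add_neg_cancel, torusChar_zero_zero, mul_one]
  rw [mul_assoc _ (torusChar _ _ _), ← hchar, torusChar]
  ring

lemma block_eq_sum (hf : Continuous f) (Q : ℕ) (s : Fin 2 → ℕ) (x : Torus 2) :
    block Q s f x = ∑ k ∈ blockFreq Q (s 0) ×ˢ blockFreq Q (s 1),
      ((blockCoeff Q (s 0) k.1 : ℂ) * blockCoeff Q (s 1) k.2 * torusCoeff f k.1 k.2)
        * torusChar k.1 k.2 x := by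
  simp_rw [block, blockKer₂_sub_eq_sum, Finset.sum_mul]
  rw [integral_finsetSum]
  · refine Finset.sum_congr rfl fun k _ => ?_
    simp_rw [mul_assoc _ (torusChar (-k.1) (-k.2) _), integral_const_mul, torusCoeff,
      mul_comm (f _)]
    ring
  · intro k _
    have hchar := continuous_torusChar (-k.1) (-k.2)
    exact integrable_of_continuous (by fun_prop)

lemma lt_abs_of_blockCoeff_ne_zero {L u : ℕ} {k : ℤ} (hk : blockCoeff (4 * L) u k ≠ 0)
    (hu : u ≠ 0) : ((2 * L * 2 ^ u : ℕ) : ℤ) < |k| := by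
  obtain ⟨v, rfl⟩ := Nat.exists_eq_succ_of_ne_zero hu
  by_contra! hle
  refine hk (blockCoeff_succ_of_abs_le (hle.trans_eq ?_))
  rw [Nat.succ_eq_add_one, pow_succ]
  push_cast
  ring

lemma norm_block_avgDiff (hf : Continuous f) (L l : ℕ) (s : Fin 2 → ℕ) (x : Torus 2) :
    ‖block (4 * L) s (avgDiff L l s f) x‖ = ‖block (4 * L) s f x‖ := by
  have hsign : block (4 * L) s (avgDiff L l s f) x
      = (-1) ^ (diffOrder l (s 0) + diffOrder l (s 1)) * block (4 * L) s f x := by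
    rw [block_eq_sum (continuous_avgDiff hf s L l), block_eq_sum hf, Finset.mul_sum]
    refine Finset.sum_congr rfl fun k _ => ?_
    by_cases h₁ : blockCoeff (4 * L) (s 0) k.1 = 0
    · simp [h₁]
    by_cases h₂ : blockCoeff (4 * L) (s 1) k.2 = 0
    · simp [h₂]
    rw [torusCoeff_avgDiff hf s L l (lt_abs_of_blockCoeff_ne_zero h₁)
      (lt_abs_of_blockCoeff_ne_zero h₂)]
    ring
  rw [hsign, norm_mul, norm_pow, norm_neg, norm_one, one_pow, one_mul]

/-- The product of Cauchy kernels which dominates `blockKer₂ Q s`. -/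
def majKer (Q : ℕ) (s : Fin 2 → ℕ) (x : Torus 2) : ℝ :=
  cauchyKer (Q * 2 ^ s 0) (x 0) * cauchyKer (Q * 2 ^ s 1) (x 1)

lemma continuous_majKer (Q : ℕ) (s : Fin 2 → ℕ) : Continuous (majKer Q s) := by
  have h0 := continuous_cauchyKer (Q * 2 ^ s 0)
  have h1 := continuous_cauchyKer (Q * 2 ^ s 1)
  unfold majKer
  fun_prop

lemma majKer_nonneg (Q : ℕ) (s : Fin 2 → ℕ) (x : Torus 2) : 0 ≤ majKer Q s x :=
  mul_nonneg (cauchyKer_nonneg (by positivity) _) (cauchyKer_nonneg (by positivity) _)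

lemma integral_majKer_sub_le_one (Q : ℕ) (s : Fin 2 → ℕ) (x : Torus 2) :
    ∫ y, majKer Q s (x - y) ∂torusMeasure 2 ≤ 1 := by
  rw [integral_sub_left_eq_self (majKer Q s)]
  simp only [majKer]
  rw [integral_torus_mul]
  exact mul_le_one₀ (integral_cauchyKer_le_one _)
    (integral_nonneg fun t => cauchyKer_nonneg (by positivity) t) (integral_cauchyKer_le_one _)

lemma norm_blockKer₂_le {Q : ℕ} (hQ : 1 ≤ Q) (s : Fin 2 → ℕ) (x : Torus 2) :
    ‖blockKer₂ Q s x‖ ≤ 900 * majKer Q s x := by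
  calc ‖blockKer₂ Q s x‖
      ≤ (30 * cauchyKer (Q * 2 ^ s 0) (x 0)) * (30 * cauchyKer (Q * 2 ^ s 1) (x 1)) := by
        rw [blockKer₂, norm_mul]
        exact mul_le_mul (norm_blockKer_le hQ _ _) (norm_blockKer_le hQ _ _) (norm_nonneg _)
          (mul_nonneg (by norm_num) (cauchyKer_nonneg (by positivity) _))
    _ = 900 * majKer Q s x := by rw [majKer]; ring

lemma norm_block_le (hf : Continuous f) {Q : ℕ} (hQ : 1 ≤ Q) (s : Fin 2 → ℕ) (x : Torus 2) :
    ‖block Q s f x‖ ≤ 900 * ∫ y, ‖f y‖ * majKer Q s (x - y) ∂torusMeasure 2 := by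
  have hmaj := continuous_majKer Q s
  have hker := continuous_blockKer₂ Q s
  rw [block, ← integral_const_mul]
  refine (norm_integral_le_integral_norm _).trans
    (integral_mono (integrable_of_continuous (by fun_prop))
      (integrable_of_continuous (by fun_prop)) fun y => ?_)
  calc ‖blockKer₂ Q s (x - y) * f y‖ = ‖blockKer₂ Q s (x - y)‖ * ‖f y‖ := norm_mul _ _
    _ ≤ (900 * majKer Q s (x - y)) * ‖f y‖ := by gcongr; exact norm_blockKer₂_le hQ s _
    _ = 900 * (‖f y‖ * majKer Q s (x - y)) := by ring

lemma norm_block_rpow_le (hf : Continuous f) {L : ℕ} (hL : 1 ≤ L) (l : ℕ) (s : Fin 2 → ℕ) {q : ℝ}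
    (hq : 1 ≤ q) (x : Torus 2) :
    ‖block (4 * L) s f x‖ ^ q ≤ 900 ^ q *
      ∫ y, ‖avgDiff L l s f y‖ ^ q * majKer (4 * L) s (x - y) ∂torusMeasure 2 := by
  have havg : Continuous fun y => ‖avgDiff L l s f y‖ := (continuous_avgDiff hf s L l).norm
  have havgq : Continuous fun y => ‖avgDiff L l s f y‖ ^ q :=
    havg.rpow_const fun _ => Or.inr (by linarith)
  have hmaj : Continuous fun y => majKer (4 * L) s (x - y) :=
    (continuous_majKer (4 * L) s).comp (continuous_sub_left x)
  have hnonneg : 0 ≤ ∫ y, ‖avgDiff L l s f y‖ * majKer (4 * L) s (x - y) ∂torusMeasure 2 :=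
    integral_nonneg fun y => mul_nonneg (norm_nonneg _) (majKer_nonneg _ _ _)
  calc ‖block (4 * L) s f x‖ ^ q
      ≤ (900 * ∫ y, ‖avgDiff L l s f y‖ * majKer (4 * L) s (x - y) ∂torusMeasure 2) ^ q := by
        rw [← norm_block_avgDiff hf L l]
        gcongr
        exact norm_block_le (continuous_avgDiff hf s L l) (by lia) s x
    _ = 900 ^ q *
        (∫ y, ‖avgDiff L l s f y‖ * majKer (4 * L) s (x - y) ∂torusMeasure 2) ^ q :=
        Real.mul_rpow (by positivity) hnonneg
    _ ≤ 900 ^ q * ∫ y, ‖avgDiff L l s f y‖ ^ q * majKer (4 * L) s (x - y) ∂torusMeasure 2 := by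
        gcongr
        exact rpow_integral_mul_le hq (fun _ => norm_nonneg _) (fun _ => majKer_nonneg _ _ _)
          (integrable_of_continuous hmaj) (integrable_of_continuous (havg.mul hmaj))
          (integrable_of_continuous (havgq.mul hmaj)) (integral_majKer_sub_le_one _ _ _)

end BlockBounds

/-! ### Mixed smoothness -/

/-- The bound imposed on the step `t` in a variable whose dyadic index is `u`: no difference is
taken in that variable when `u = 0`. -/
def stepWeight (a : ℝ) (u : ℕ) (t : Circ) : ℝ := if u = 0 then 1 else ‖t‖ ^ a

lemma stepWeight_nonneg (a : ℝ) (u : ℕ) (t : Circ) : 0 ≤ stepWeight a u t := by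
  unfold stepWeight
  split_ifs <;> positivity

lemma continuous_stepWeight {a : ℝ} (ha : 0 ≤ a) (u : ℕ) : Continuous (stepWeight a u) := by
  unfold stepWeight
  split_ifs
  · exact continuous_const
  · exact continuous_norm.rpow_const fun _ => Or.inr ha

lemma exists_integral_jacksonKer_mul_stepWeight_le {L : ℕ} {a : ℝ} (ha : 0 ≤ a)
    (hL : a + 2 ≤ 2 * L) : ∃ C : ℝ, 0 < C ∧ ∀ u : ℕ,
      ∫ t, jacksonKer L (2 ^ u) t * stepWeight a u t ∂circMeasure ≤ C * ((2 : ℝ) ^ u) ^ (-a) := by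
  obtain ⟨C, hC, hmoment⟩ := exists_integral_jacksonKer_mul_rpow_le ha hL
  refine ⟨C + 1, by positivity, fun u => ?_⟩
  by_cases hu : u = 0
  · simp only [hu, stepWeight, if_true, mul_one, pow_zero, Real.one_rpow, integral_jacksonKer]
    linarith
  simp only [stepWeight, if_neg hu]
  have hdecr : (2 * ((2 ^ u : ℕ) : ℝ) + 1) ^ (-a) ≤ ((2 : ℝ) ^ u) ^ (-a) := by
    refine Real.rpow_le_rpow_of_nonpos (by positivity) ?_ (by linarith)
    push_cast
    linarith [pow_pos (two_pos (α := ℝ)) u]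
  calc ∫ t, jacksonKer L (2 ^ u) t * ‖t‖ ^ a ∂circMeasure
      ≤ C * (2 * ((2 ^ u : ℕ) : ℝ) + 1) ^ (-a) := hmoment (2 ^ u)
    _ ≤ (C + 1) * ((2 : ℝ) ^ u) ^ (-a) := by gcongr; linarith

/-- Bounds of order `r` on the `L_q` norms of the mixed `l`-th differences. -/
def HasMixedBound (l : ℕ) (r q : ℝ) (f : Torus 2 → ℂ) : Prop :=
  ∀ (s : Fin 2 → ℕ) (t : Torus 2), ∫ x, ‖blockDiff l s t f x‖ ^ q ∂torusMeasure 2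
    ≤ stepWeight (r * q) (s 0) (t 0) * stepWeight (r * q) (s 1) (t 1)

section AvgDiffBounds

variable {f : Torus 2 → ℂ} (hf : Continuous f) (L l : ℕ) (s : Fin 2 → ℕ) {q : ℝ} (hq : 1 ≤ q)
include hf hq

lemma continuous_norm_blockDiff_rpow_mul_jacksonKer₂ : Continuous fun p : Torus 2 × Torus 2 =>
    ‖blockDiff l s p.2 f p.1‖ ^ q * jacksonKer₂ L s p.2 :=
  (((continuous_blockDiff_apply l s hf).comp continuous_swap).norm.rpow_const
    fun _ => Or.inr (by linarith)).mul ((continuous_jacksonKer₂ L s).comp continuous_snd)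

lemma norm_avgDiff_rpow_le (x : Torus 2) :
    ‖avgDiff L l s f x‖ ^ q
      ≤ ∫ t, ‖blockDiff l s t f x‖ ^ q * jacksonKer₂ L s t ∂torusMeasure 2 := by
  have hker := continuous_jacksonKer₂ L s
  have hdiff : Continuous fun t => ‖blockDiff l s t f x‖ :=
    ((continuous_blockDiff_apply l s hf).comp (Continuous.prodMk_left x)).norm
  have hdiffq : Continuous fun t => ‖blockDiff l s t f x‖ ^ q :=
    hdiff.rpow_const fun _ => Or.inr (by linarith)
  have hnorm : ‖avgDiff L l s f x‖
      ≤ ∫ t, ‖blockDiff l s t f x‖ * jacksonKer₂ L s t ∂torusMeasure 2 := by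
    refine (norm_integral_le_integral_norm _).trans_eq (integral_congr_ae (.of_forall fun t => ?_))
    simp only [norm_mul, Complex.norm_real, Real.norm_of_nonneg (jacksonKer₂_nonneg L s t),
      mul_comm]
  calc ‖avgDiff L l s f x‖ ^ q
      ≤ (∫ t, ‖blockDiff l s t f x‖ * jacksonKer₂ L s t ∂torusMeasure 2) ^ q := by gcongr
    _ ≤ ∫ t, ‖blockDiff l s t f x‖ ^ q * jacksonKer₂ L s t ∂torusMeasure 2 :=
      rpow_integral_mul_le hq (fun _ => norm_nonneg _) (jacksonKer₂_nonneg L s)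
        (integrable_of_continuous hker) (integrable_of_continuous (hdiff.mul hker))
        (integrable_of_continuous (hdiffq.mul hker)) (integral_jacksonKer₂ L s).le

lemma integral_norm_avgDiff_rpow_le :
    ∫ x, ‖avgDiff L l s f x‖ ^ q ∂torusMeasure 2
      ≤ ∫ t, (∫ x, ‖blockDiff l s t f x‖ ^ q ∂torusMeasure 2) * jacksonKer₂ L s t
          ∂torusMeasure 2 := by
  have hcont := continuous_norm_blockDiff_rpow_mul_jacksonKer₂ hf L l s hq
  calc ∫ x, ‖avgDiff L l s f x‖ ^ q ∂torusMeasure 2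
      ≤ ∫ x, ∫ t, ‖blockDiff l s t f x‖ ^ q * jacksonKer₂ L s t ∂torusMeasure 2
          ∂torusMeasure 2 :=
        integral_mono (integrable_of_continuous ((continuous_avgDiff hf s L l).norm.rpow_const
          fun _ => Or.inr (by linarith)))
          (integrable_of_continuous (continuous_integral_torus hcont))
          (norm_avgDiff_rpow_le hf L l s hq)
    _ = ∫ t, ∫ x, ‖blockDiff l s t f x‖ ^ q * jacksonKer₂ L s t ∂torusMeasure 2
          ∂torusMeasure 2 := integral_integral_swap (integrable_of_continuous hcont)
    _ = ∫ t, (∫ x, ‖blockDiff l s t f x‖ ^ q ∂torusMeasure 2) * jacksonKer₂ L s t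
          ∂torusMeasure 2 := by simp only [integral_mul_const]

lemma HasMixedBound.integral_norm_avgDiff_rpow_le {r : ℝ} (hr : 0 ≤ r)
    (hbound : HasMixedBound l r q f) :
    ∫ x, ‖avgDiff L l s f x‖ ^ q ∂torusMeasure 2
      ≤ (∫ t, jacksonKer L (2 ^ s 0) t * stepWeight (r * q) (s 0) t ∂circMeasure) *
        ∫ t, jacksonKer L (2 ^ s 1) t * stepWeight (r * q) (s 1) t ∂circMeasure := by
  have hrq : 0 ≤ r * q := mul_nonneg hr (by linarith)
  have hker := continuous_jacksonKer₂ L s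
  have h0 := continuous_stepWeight hrq (s 0)
  have h1 := continuous_stepWeight hrq (s 1)
  have hswap := (continuous_norm_blockDiff_rpow_mul_jacksonKer₂ hf L l s hq).comp continuous_swap
  calc ∫ x, ‖avgDiff L l s f x‖ ^ q ∂torusMeasure 2
      ≤ ∫ t, (∫ x, ‖blockDiff l s t f x‖ ^ q ∂torusMeasure 2) * jacksonKer₂ L s t
          ∂torusMeasure 2 := _root_.integral_norm_avgDiff_rpow_le hf L l s hq
    _ ≤ ∫ t, (stepWeight (r * q) (s 0) (t 0) * stepWeight (r * q) (s 1) (t 1))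
          * jacksonKer₂ L s t ∂torusMeasure 2 := by
        refine integral_mono ?_ (integrable_of_continuous (by fun_prop)) fun t =>
          mul_le_mul_of_nonneg_right (hbound s t) (jacksonKer₂_nonneg L s t)
        simp_rw [← integral_mul_const]
        exact integrable_of_continuous (continuous_integral_torus hswap)
    _ = ∫ t, (jacksonKer L (2 ^ s 0) (t 0) * stepWeight (r * q) (s 0) (t 0)) *
          (jacksonKer L (2 ^ s 1) (t 1) * stepWeight (r * q) (s 1) (t 1)) ∂torusMeasure 2 := by
        congr 1 with t
        rw [jacksonKer₂]
        ring
    _ = _ := integral_torus_mul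
        (fun t => jacksonKer L (2 ^ s 0) t * stepWeight (r * q) (s 0) t)
        (fun t => jacksonKer L (2 ^ s 1) t * stepWeight (r * q) (s 1) t)

end AvgDiffBounds

/-- The total dyadic level of a block; the block `s` consists of about `2 ^ level s` frequencies. -/
def level (s : Fin 2 → ℕ) : ℕ := s 0 + s 1

lemma exists_integral_norm_avgDiff_rpow_le {L : ℕ} {r q : ℝ} (hr : 0 ≤ r) (hq : 1 ≤ q)
    (hL : r * q + 2 ≤ 2 * L) (l : ℕ) :
    ∃ C : ℝ, 0 < C ∧ ∀ f : Torus 2 → ℂ, Continuous f → HasMixedBound l r q f →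
      ∀ s : Fin 2 → ℕ, ∫ x, ‖avgDiff L l s f x‖ ^ q ∂torusMeasure 2
        ≤ C * ((2 : ℝ) ^ level s) ^ (-(r * q)) := by
  obtain ⟨C, hC, hmoment⟩ :=
    exists_integral_jacksonKer_mul_stepWeight_le (mul_nonneg hr (by linarith : 0 ≤ q)) hL
  refine ⟨C * C, by positivity, fun f hf hbound s => ?_⟩
  calc ∫ x, ‖avgDiff L l s f x‖ ^ q ∂torusMeasure 2
      ≤ (∫ t, jacksonKer L (2 ^ s 0) t * stepWeight (r * q) (s 0) t ∂circMeasure) *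
        ∫ t, jacksonKer L (2 ^ s 1) t * stepWeight (r * q) (s 1) t ∂circMeasure :=
        hbound.integral_norm_avgDiff_rpow_le hf L l s hq hr
    _ ≤ (C * ((2 : ℝ) ^ s 0) ^ (-(r * q))) * (C * ((2 : ℝ) ^ s 1) ^ (-(r * q))) :=
        mul_le_mul (hmoment _) (hmoment _) (integral_nonneg fun t =>
          mul_nonneg (jacksonKer_nonneg _ _ _) (stepWeight_nonneg _ _ _)) (by positivity)
    _ = C * C * ((2 : ℝ) ^ level s) ^ (-(r * q)) := by
        rw [level, pow_add, Real.mul_rpow (by positivity) (by positivity)]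
        ring

/-! ### Convergence of the block decomposition -/

section PartialSums

variable {f : Torus 2 → ℂ}

lemma integral_vpKer (N : ℕ) : ∫ t, vpKer N t ∂circMeasure = 1 := by
  simp_rw [vpKer_eq_sum (le_refl (3 * N))]
  rw [integral_finsetSum _ fun k _ => integrable_of_continuous (by fun_prop)]
  simp_rw [integral_const_mul, integral_fourier]
  rw [Finset.sum_eq_single_of_mem 0 (by simp) fun k _ hk => by simp [hk],
    vpCoeff_of_abs_le (by simp)]
  simp

lemma norm_sq_mul_cauchyKer_le {N : ℝ} (hN : 0 < N) (t : Circ) :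
    ‖t‖ ^ 2 * cauchyKer N t ≤ 1 / N := by
  unfold cauchyKer
  rw [← mul_div_assoc, div_le_div_iff₀ (by positivity) hN]
  nlinarith

/-- The sum of the blocks of `f` over the square `{0, …, S}²`. -/
def partialSum (Q S : ℕ) (f : Torus 2 → ℂ) (x : Torus 2) : ℂ :=
  ∑ i ∈ Finset.range (S + 1) ×ˢ Finset.range (S + 1), block Q ![i.1, i.2] f x

lemma partialSum_eq_integral (Q S : ℕ) (hf : Continuous f) (x : Torus 2) :
    partialSum Q S f x
      = ∫ t, vpKer (Q * 2 ^ S) (t 0) * vpKer (Q * 2 ^ S) (t 1) * f (x - t) ∂torusMeasure 2 := by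
  have hsum (y : Torus 2) :
      vpKer (Q * 2 ^ S) ((x - y) 0) * vpKer (Q * 2 ^ S) ((x - y) 1) * f y
        = ∑ i ∈ Finset.range (S + 1) ×ˢ Finset.range (S + 1),
          blockKer₂ Q ![i.1, i.2] (x - y) * f y := by
    rw [← sum_blockKer, ← sum_blockKer, Finset.sum_mul_sum, ← Finset.sum_product', Finset.sum_mul]
    rfl
  rw [← integral_sub_left_eq_self
    (fun t => vpKer (Q * 2 ^ S) (t 0) * vpKer (Q * 2 ^ S) (t 1) * f (x - t)) (torusMeasure 2) x]
  simp_rw [sub_sub_cancel, hsum]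
  rw [integral_finsetSum _ fun i _ => integrable_of_continuous (by
    have hker := continuous_blockKer₂ Q ![i.1, i.2]; fun_prop)]
  rfl

lemma partialSum_sub_eq_integral (Q S : ℕ) (hf : Continuous f) (x : Torus 2) :
    partialSum Q S f x - f x
      = ∫ t, vpKer (Q * 2 ^ S) (t 0) * vpKer (Q * 2 ^ S) (t 1) * (f (x - t) - f x)
        ∂torusMeasure 2 := by
  have hv := continuous_vpKer (Q * 2 ^ S)
  simp only [mul_sub]
  rw [integral_sub (integrable_of_continuous (by fun_prop))
      (integrable_of_continuous (by fun_prop)), ← partialSum_eq_integral Q S hf,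
    integral_mul_const, integral_torus_mul (vpKer _) (vpKer _), integral_vpKer, one_mul, one_mul]

lemma exists_norm_sub_le_add_norm_sq (hf : Continuous f) {ε : ℝ} (hε : 0 < ε) :
    ∃ B : ℝ, 0 ≤ B ∧ ∀ x t : Torus 2, ‖f (x - t) - f x‖ ≤ ε + B * (‖t 0‖ ^ 2 + ‖t 1‖ ^ 2) := by
  obtain ⟨η, hη, hclose⟩ :=
    Metric.uniformContinuous_iff.1 (CompactSpace.uniformContinuous_of_continuous hf) ε hε
  obtain ⟨K, hK⟩ := (isCompact_range hf).isBounded.exists_norm_le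
  replace hK (x : Torus 2) : ‖f x‖ ≤ K := hK _ ⟨x, rfl⟩
  have hK0 : 0 ≤ K := (norm_nonneg _).trans (hK 0)
  refine ⟨2 * K / η ^ 2, by positivity, fun x t => ?_⟩
  rcases lt_or_ge ‖t‖ η with ht | ht
  · have hdist : dist (x - t) x < η := by rwa [dist_eq_norm, sub_sub_cancel_left, norm_neg]
    have hf_close := (hclose hdist).le
    rw [dist_eq_norm] at hf_close
    exact hf_close.trans (le_add_of_nonneg_right (by positivity))
  · have hfar : η ^ 2 ≤ ‖t 0‖ ^ 2 + ‖t 1‖ ^ 2 := by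
      obtain ⟨i, hi⟩ : ∃ i, η ≤ ‖t i‖ := by
        by_contra! hlt
        exact ht.not_gt ((pi_norm_lt_iff hη).2 hlt)
      calc η ^ 2 ≤ ‖t i‖ ^ 2 := by gcongr
        _ ≤ ∑ j, ‖t j‖ ^ 2 :=
          Finset.single_le_sum (fun j _ => sq_nonneg ‖t j‖) (Finset.mem_univ i)
        _ = ‖t 0‖ ^ 2 + ‖t 1‖ ^ 2 := Fin.sum_univ_two _
    calc ‖f (x - t) - f x‖ ≤ K + K := (norm_sub_le _ _).trans (add_le_add (hK _) (hK _))
      _ = 2 * K / η ^ 2 * η ^ 2 := by field_simp; ring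
      _ ≤ 2 * K / η ^ 2 * (‖t 0‖ ^ 2 + ‖t 1‖ ^ 2) := by gcongr
      _ ≤ ε + 2 * K / η ^ 2 * (‖t 0‖ ^ 2 + ‖t 1‖ ^ 2) := by linarith

lemma integral_cauchyKer_mul_norm_sq_le {N ε B : ℝ} (hN : 0 < N) (hε : 0 ≤ ε) (hB : 0 ≤ B) :
    ∫ t : Torus 2, cauchyKer N (t 0) * cauchyKer N (t 1) * (ε + B * (‖t 0‖ ^ 2 + ‖t 1‖ ^ 2))
      ∂torusMeasure 2 ≤ ε + 2 * B / N := by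
  have hc := continuous_cauchyKer N
  have hpos := cauchyKer_nonneg hN.le
  have hsq := norm_sq_mul_cauchyKer_le hN
  set I := ∫ t, cauchyKer N t ∂circMeasure
  have hI0 : 0 ≤ I := integral_nonneg hpos
  have hI1 : I ≤ 1 := integral_cauchyKer_le_one N
  calc _ ≤ ∫ t : Torus 2, (ε * (cauchyKer N (t 0) * cauchyKer N (t 1))
        + (B / N * cauchyKer N (t 1) + cauchyKer N (t 0) * (B / N))) ∂torusMeasure 2 := by
        refine integral_mono (integrable_of_continuous (by fun_prop))
          (integrable_of_continuous (by fun_prop)) fun t => ?_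
        calc _ = ε * (cauchyKer N (t 0) * cauchyKer N (t 1))
              + (B * (‖t 0‖ ^ 2 * cauchyKer N (t 0)) * cauchyKer N (t 1)
                + cauchyKer N (t 0) * (B * (‖t 1‖ ^ 2 * cauchyKer N (t 1)))) := by ring
          _ ≤ ε * (cauchyKer N (t 0) * cauchyKer N (t 1))
              + (B * (1 / N) * cauchyKer N (t 1) + cauchyKer N (t 0) * (B * (1 / N))) := by
              gcongr <;> first | exact hpos _ | exact hsq _
          _ = _ := by ring
    _ = ε * (I * I) + (B / N * I + I * (B / N)) := by
        rw [integral_add (integrable_of_continuous (by fun_prop))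
          (integrable_of_continuous (by fun_prop)), integral_const_mul,
          integral_add (integrable_of_continuous (by fun_prop))
          (integrable_of_continuous (by fun_prop)), integral_torus_mul,
          integral_torus_mul (fun _ => B / N) (cauchyKer N),
          integral_torus_mul (cauchyKer N) (fun _ => B / N)]
        simp only [integral_const, probReal_univ, smul_eq_mul, one_mul]
        rfl
    _ ≤ ε * 1 + (B / N * 1 + 1 * (B / N)) := by
        gcongr
        exact mul_le_one₀ hI1 hI0 hI1
    _ = ε + 2 * B / N := by ring

lemma exists_norm_partialSum_sub_le {Q : ℕ} (hQ : 1 ≤ Q) (hf : Continuous f) {ε : ℝ}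
    (hε : 0 < ε) : ∃ S, ∀ x, ‖partialSum Q S f x - f x‖ ≤ ε := by
  obtain ⟨B, hB, hmod⟩ := exists_norm_sub_le_add_norm_sq hf (ε := ε / 200) (by positivity)
  obtain ⟨S, hS⟩ := pow_unbounded_of_one_lt (400 * B / ε) (one_lt_two (α := ℝ))
  refine ⟨S, fun x => ?_⟩
  have hN : 1 ≤ Q * 2 ^ S := Nat.mul_pos hQ (by positivity)
  have hS_le : (2 : ℝ) ^ S ≤ (Q * 2 ^ S : ℕ) := by
    exact_mod_cast Nat.le_mul_of_pos_left (2 ^ S) hQ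
  rw [partialSum_sub_eq_integral Q S hf]
  set N := Q * 2 ^ S
  have hN0 : (0 : ℝ) < N := by exact_mod_cast hN
  have hv := continuous_vpKer N
  have hc := continuous_cauchyKer N
  have hpos := cauchyKer_nonneg hN0.le
  have hBN : 200 * B / N ≤ ε / 2 := by
    rw [div_lt_iff₀ hε] at hS
    rw [div_le_iff₀ hN0]
    nlinarith
  calc _ ≤ ∫ t : Torus 2, 100 * (cauchyKer N (t 0) * cauchyKer N (t 1)
        * (ε / 200 + B * (‖t 0‖ ^ 2 + ‖t 1‖ ^ 2))) ∂torusMeasure 2 := by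
        refine (norm_integral_le_integral_norm _).trans
          (integral_mono (integrable_of_continuous (by fun_prop))
            (integrable_of_continuous (by fun_prop)) fun t => ?_)
        simp only [norm_mul]
        calc _ ≤ (10 * cauchyKer N (t 0)) * (10 * cauchyKer N (t 1))
              * (ε / 200 + B * (‖t 0‖ ^ 2 + ‖t 1‖ ^ 2)) := by
              have hpos₀ := hpos (t 0)
              have hpos₁ := hpos (t 1)
              gcongr
              exacts [norm_vpKer_le hN _, norm_vpKer_le hN _, hmod x t]
          _ = _ := by ring
    _ ≤ 100 * (ε / 200 + 2 * B / N) := by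
        rw [integral_const_mul]
        gcongr
        exact integral_cauchyKer_mul_norm_sq_le hN0 (by positivity) hB
    _ = ε / 2 + 200 * B / N := by ring
    _ ≤ ε := by linarith

end PartialSums

/-! ### The error of equal weight cubature on products of blocks -/

/-- The error of the equal weight cubature formula with nodes `ξ`. -/
def cubatureError {m : ℕ} (ξ : Fin m → Torus 2) (F : Torus 2 → ℂ) : ℂ :=
  ∫ x, F x ∂torusMeasure 2 - (∑ j, F (ξ j)) / m

section CubatureError

variable {m : ℕ} (ξ : Fin m → Torus 2)

lemma cubatureError_sum {ι : Type*} (I : Finset ι) {F : ι → Torus 2 → ℂ}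
    (hF : ∀ i ∈ I, Continuous (F i)) :
    cubatureError ξ (fun x => ∑ i ∈ I, F i x) = ∑ i ∈ I, cubatureError ξ (F i) := by
  simp only [cubatureError]
  rw [integral_finsetSum _ fun i hi => integrable_of_continuous (hF i hi),
    Finset.sum_sub_distrib, Finset.sum_comm, ← Finset.sum_div]

lemma cubatureError_const_mul (c : ℂ) (F : Torus 2 → ℂ) :
    cubatureError ξ (fun x => c * F x) = c * cubatureError ξ F := by
  simp only [cubatureError]
  rw [integral_const_mul, ← Finset.mul_sum]
  ring

lemma norm_cubatureError_sub_le {F G : Torus 2 → ℂ} (hF : Continuous F) (hG : Continuous G)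
    {K : ℝ} (hK : ∀ x, ‖F x - G x‖ ≤ K) : ‖cubatureError ξ F - cubatureError ξ G‖ ≤ 2 * K := by
  have hdiff : cubatureError ξ F - cubatureError ξ G
      = ∫ x, (F x - G x) ∂torusMeasure 2 - (∑ j, (F (ξ j) - G (ξ j))) / m := by
    simp only [cubatureError]
    rw [integral_sub (integrable_of_continuous hF) (integrable_of_continuous hG),
      Finset.sum_sub_distrib]
    ring
  have hintegral : ‖∫ x, (F x - G x) ∂torusMeasure 2‖ ≤ K := by
    simpa using norm_integral_le_of_norm_le_const (μ := torusMeasure 2)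
      (Filter.Eventually.of_forall hK)
  have hmean : ‖(∑ j, (F (ξ j) - G (ξ j))) / m‖ ≤ K := by
    rw [norm_div, Complex.norm_natCast]
    refine div_le_of_le_mul₀ (by positivity) ((norm_nonneg _).trans (hK 0))
      ((norm_sum_le_of_le _ fun j _ => hK (ξ j)).trans_eq ?_)
    simp [mul_comm]
  rw [hdiff]
  exact (norm_sub_le _ _).trans (by linarith)

lemma integral_eq_integral_mean_add (hm : 0 < m) {F : Torus 2 → ℝ} (hF : Continuous F) :
    ∫ x, F x ∂torusMeasure 2 = ∫ g, (∑ j, F (ξ j + g)) / m ∂torusMeasure 2 := by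
  rw [integral_div, integral_finsetSum _ fun j _ => integrable_of_continuous (by fun_prop)]
  simp_rw [integral_add_left_eq_self F]
  simp [hm.ne']

variable {ξ} in
/-- The integral is the average over all shifts of the node mean, so a bound for the `q`-th power
means at the shifted nodes controls both terms of the error. -/
lemma norm_cubatureError_le_of_mean_le (hm : 0 < m) {F : Torus 2 → ℂ} (hF : Continuous F)
    {q X : ℝ} (hq : 1 ≤ q) (hX : ∀ g, (∑ j, ‖F (ξ j + g)‖ ^ q) / m ≤ X) :
    ‖cubatureError ξ F‖ ≤ 2 * X ^ (1 / q) := by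
  have hmean (g : Torus 2) : (∑ j, ‖F (ξ j + g)‖) / m ≤ X ^ (1 / q) := by
    have hpower := Real.rpow_arith_mean_le_arith_mean_rpow Finset.univ (fun _ => 1 / (m : ℝ))
      (fun j => ‖F (ξ j + g)‖) (fun _ _ => by positivity) (by simp [hm.ne'])
      (fun _ _ => norm_nonneg _) hq
    rw [← Finset.mul_sum, ← Finset.mul_sum, one_div_mul_eq_div, one_div_mul_eq_div] at hpower
    rw [one_div, Real.le_rpow_inv_iff_of_pos (by positivity)
      ((by positivity : (0 : ℝ) ≤ (∑ j, ‖F (ξ j + g)‖ ^ q) / m).trans (hX g)) (by linarith)]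
    exact hpower.trans (hX g)
  have hintegral : ‖∫ x, F x ∂torusMeasure 2‖ ≤ X ^ (1 / q) := by
    refine (norm_integral_le_integral_norm _).trans ?_
    rw [integral_eq_integral_mean_add ξ hm hF.norm]
    refine (integral_mono (integrable_of_continuous (by fun_prop))
      (integrable_const _) hmean).trans_eq ?_
    simp
  have hsum : ‖(∑ j, F (ξ j)) / m‖ ≤ X ^ (1 / q) := by
    rw [norm_div, Complex.norm_natCast]
    refine le_trans ?_ (hmean 0)
    gcongr
    simpa using norm_sum_le _ _
  exact (norm_sub_le _ _).trans (by linarith)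

end CubatureError

section Exactness

variable {A m : ℕ} {ξ : Fin m → Torus 2}

lemma integral_torusChar {k₁ k₂ : ℤ} (hk : ¬(k₁ = 0 ∧ k₂ = 0)) :
    ∫ x, torusChar k₁ k₂ x ∂torusMeasure 2 = 0 := by
  simp only [torusChar]
  rw [integral_torus_mul (fun t => (fourier k₁ t : ℂ)) (fun t => (fourier k₂ t : ℂ)),
    integral_fourier, integral_fourier]
  rcases not_and_or.1 hk with hk | hk <;> simp [hk]

lemma IsHyperbolicNodeSet.cubatureError_torusChar (hξ : IsHyperbolicNodeSet A ξ) {k₁ k₂ : ℤ}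
    (hm : 0 < m) (hk : A * max 1 |k₁| * max 1 |k₂| < m) :
    cubatureError ξ (torusChar k₁ k₂) = 0 := by
  unfold cubatureError
  by_cases hzero : k₁ = 0 ∧ k₂ = 0
  · obtain ⟨rfl, rfl⟩ := hzero
    simp [torusChar, hm.ne']
  · rw [integral_torusChar hzero, hξ.sum_torusChar_eq_zero k₁ k₂ hzero hk]
    simp

lemma conj_torusChar (k₁ k₂ : ℤ) (x : Torus 2) :
    (starRingEnd ℂ) (torusChar k₁ k₂ x) = torusChar (-k₁) (-k₂) x := by
  simp only [torusChar, map_mul, ← fourier_neg]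

lemma max_one_abs_sub_le_of_mem_blockFreq {Q a b : ℕ} (hQ : 1 ≤ Q) {i j : ℤ}
    (hi : i ∈ blockFreq Q a) (hj : j ∈ blockFreq Q b) :
    max 1 |i - j| ≤ ((6 * Q * 2 ^ max a b : ℕ) : ℤ) := by
  have hpos : 1 ≤ Q * 2 ^ max a b := Nat.mul_pos hQ (by positivity)
  have ha : Q * 2 ^ a ≤ Q * 2 ^ max a b := by gcongr <;> simp
  have hb : Q * 2 ^ b ≤ Q * 2 ^ max a b := by gcongr <;> simp
  rw [blockFreq, Finset.mem_Icc] at hi hj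
  rw [max_le_iff, abs_le, mul_assoc]
  omega

lemma block_mul_conj_eq_sum {f : Torus 2 → ℂ} (hf : Continuous f) (Q : ℕ) (s s' : Fin 2 → ℕ)
    (x : Torus 2) :
    block Q s f x * (starRingEnd ℂ) (block Q s' f x)
      = ∑ k ∈ (blockFreq Q (s 0) ×ˢ blockFreq Q (s 1)) ×ˢ
          (blockFreq Q (s' 0) ×ˢ blockFreq Q (s' 1)),
        (((blockCoeff Q (s 0) k.1.1 : ℂ) * blockCoeff Q (s 1) k.1.2 * torusCoeff f k.1.1 k.1.2)
          * (starRingEnd ℂ) ((blockCoeff Q (s' 0) k.2.1 : ℂ) * blockCoeff Q (s' 1) k.2.2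
            * torusCoeff f k.2.1 k.2.2))
        * torusChar (k.1.1 - k.2.1) (k.1.2 - k.2.2) x := by
  rw [block_eq_sum hf, block_eq_sum hf, map_sum, Finset.sum_mul_sum, ← Finset.sum_product']
  refine Finset.sum_congr rfl fun k _ => ?_
  rw [sub_eq_add_neg, sub_eq_add_neg, ← torusChar_mul_torusChar, ← conj_torusChar,
    map_mul _ _ (torusChar _ _ _)]
  ring

lemma IsHyperbolicNodeSet.cubatureError_block_mul_conj_eq_zero (hξ : IsHyperbolicNodeSet A ξ)
    {f : Torus 2 → ℂ} (hf : Continuous f) {Q : ℕ} (hQ : 1 ≤ Q) {s s' : Fin 2 → ℕ}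
    (hlevel : 36 * A * Q ^ 2 * 2 ^ level (s ⊔ s') < m) :
    cubatureError ξ (fun x => block Q s f x * (starRingEnd ℂ) (block Q s' f x)) = 0 := by
  simp_rw [block_mul_conj_eq_sum hf]
  rw [cubatureError_sum]
  · refine Finset.sum_eq_zero fun k hk => ?_
    simp only [Finset.mem_product] at hk
    rw [cubatureError_const_mul, hξ.cubatureError_torusChar (by omega), mul_zero]
    calc (A : ℤ) * max 1 |k.1.1 - k.2.1| * max 1 |k.1.2 - k.2.2|
        ≤ A * (6 * Q * 2 ^ max (s 0) (s' 0) : ℕ) * (6 * Q * 2 ^ max (s 1) (s' 1) : ℕ) := by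
          gcongr
          exacts [max_one_abs_sub_le_of_mem_blockFreq hQ hk.1.1 hk.2.1,
            max_one_abs_sub_le_of_mem_blockFreq hQ hk.1.2 hk.2.2]
      _ = (36 * A * Q ^ 2 * 2 ^ level (s ⊔ s') : ℕ) := by
          rw [level, Pi.sup_apply, Pi.sup_apply, pow_add]
          push_cast
          ring
      _ < m := by exact_mod_cast hlevel
  · exact fun k _ => continuous_const.mul (continuous_torusChar _ _)

end Exactness

section PairEstimate

lemma exists_cauchyKer_mul_le {N N' : ℝ} (hN : 0 ≤ N) (hN' : 0 ≤ N') (y z : Circ) :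
    ∃ w, ∀ x, cauchyKer N (x - y) * cauchyKer N' (x - z)
      ≤ min N N' * cauchyKer (max N N') (x - w) := by
  rcases le_total N N' with h | h
  · refine ⟨z, fun x => ?_⟩
    rw [min_eq_left h, max_eq_right h]
    exact mul_le_mul_of_nonneg_right (cauchyKer_le hN _) (cauchyKer_nonneg hN' _)
  · refine ⟨y, fun x => ?_⟩
    rw [min_eq_right h, max_eq_left h, mul_comm]
    exact mul_le_mul_of_nonneg_right (cauchyKer_le hN' _) (cauchyKer_nonneg hN _)

variable {m : ℕ} {ξ : Fin m → Torus 2}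

lemma IsHyperbolicallySeparated.sum_cauchyKer_mul_cauchyKer_le_of_le
    (hξ : IsHyperbolicallySeparated ξ) {N₁ N₂ c : ℝ} (h₁ : 0 < N₁) (h₂ : 0 < N₂) (hc : 1 ≤ c)
    (hN : m ≤ c ^ 2 * (N₁ * N₂)) (y z : Circ) :
    ∑ j, cauchyKer N₁ (ξ j 0 - y) * cauchyKer N₂ (ξ j 1 - z)
      ≤ c ^ 4 * cellMass ^ 2 * (N₁ * N₂) := by
  have hc0 : 0 < c := by linarith
  calc ∑ j, cauchyKer N₁ (ξ j 0 - y) * cauchyKer N₂ (ξ j 1 - z)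
      ≤ ∑ j, (c * cauchyKer (c * N₁) (ξ j 0 - y)) * (c * cauchyKer (c * N₂) (ξ j 1 - z)) := by
        gcongr with j
        · exact cauchyKer_nonneg h₂.le _
        · exact mul_nonneg hc0.le (cauchyKer_nonneg (by positivity) _)
        · exact cauchyKer_le_mul_cauchyKer h₁.le hc _
        · exact cauchyKer_le_mul_cauchyKer h₂.le hc _
    _ = c ^ 2 * ∑ j, cauchyKer (c * N₁) (ξ j 0 - y) * cauchyKer (c * N₂) (ξ j 1 - z) := by
        rw [Finset.mul_sum]
        exact Finset.sum_congr rfl fun j _ => by ring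
    _ ≤ c ^ 2 * (cellMass ^ 2 * ((c * N₁) * (c * N₂))) := by
        gcongr
        exact hξ.sum_cauchyKer_mul_cauchyKer_le (by positivity) (by positivity)
          (hN.trans_eq (by ring)) y z
    _ = c ^ 4 * cellMass ^ 2 * (N₁ * N₂) := by ring

lemma IsHyperbolicallySeparated.sum_cauchyKer_mul_mul_le (hξ : IsHyperbolicallySeparated ξ)
    {N N' : Fin 2 → ℝ} (hN : ∀ i, 0 < N i) (hN' : ∀ i, 0 < N' i) {c : ℝ} (hc : 1 ≤ c)
    (hm : m ≤ c ^ 2 * ((N ⊔ N') 0 * (N ⊔ N') 1)) (y z : Torus 2) :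
    ∑ j, (cauchyKer (N 0) (ξ j 0 - y 0) * cauchyKer (N 1) (ξ j 1 - y 1))
        * (cauchyKer (N' 0) (ξ j 0 - z 0) * cauchyKer (N' 1) (ξ j 1 - z 1))
      ≤ c ^ 4 * cellMass ^ 2 * ((N 0 * N 1) * (N' 0 * N' 1)) := by
  have hinf (i : Fin 2) : 0 < (N ⊓ N') i := lt_min (hN i) (hN' i)
  have hsup (i : Fin 2) : 0 < (N ⊔ N') i := lt_max_of_lt_left (hN i)
  have hminmax (i : Fin 2) : (N ⊓ N') i * (N ⊔ N') i = N i * N' i := min_mul_max (N i) (N' i)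
  choose w hw using fun i => exists_cauchyKer_mul_le (hN i).le (hN' i).le (y i) (z i)
  calc _ = ∑ j, (cauchyKer (N 0) (ξ j 0 - y 0) * cauchyKer (N' 0) (ξ j 0 - z 0))
        * (cauchyKer (N 1) (ξ j 1 - y 1) * cauchyKer (N' 1) (ξ j 1 - z 1)) :=
        Finset.sum_congr rfl fun j _ => mul_mul_mul_comm _ _ _ _
    _ ≤ ∑ j, ((N ⊓ N') 0 * cauchyKer ((N ⊔ N') 0) (ξ j 0 - w 0))
        * ((N ⊓ N') 1 * cauchyKer ((N ⊔ N') 1) (ξ j 1 - w 1)) :=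
        Finset.sum_le_sum fun j _ => mul_le_mul (hw 0 _) (hw 1 _)
          (mul_nonneg (cauchyKer_nonneg (hN 1).le _) (cauchyKer_nonneg (hN' 1).le _))
          (mul_nonneg (hinf 0).le (cauchyKer_nonneg (hsup 0).le _))
    _ = ((N ⊓ N') 0 * (N ⊓ N') 1) * ∑ j, cauchyKer ((N ⊔ N') 0) (ξ j 0 - w 0)
        * cauchyKer ((N ⊔ N') 1) (ξ j 1 - w 1) := by
        simp only [mul_mul_mul_comm, Finset.mul_sum]
    _ ≤ ((N ⊓ N') 0 * (N ⊓ N') 1) * (c ^ 4 * cellMass ^ 2 * ((N ⊔ N') 0 * (N ⊔ N') 1)) :=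
        mul_le_mul_of_nonneg_left
          (hξ.sum_cauchyKer_mul_cauchyKer_le_of_le (hsup 0) (hsup 1) hc hm _ _)
          (mul_nonneg (hinf 0).le (hinf 1).le)
    _ = c ^ 4 * cellMass ^ 2 * (((N ⊓ N') 0 * (N ⊔ N') 0) * ((N ⊓ N') 1 * (N ⊔ N') 1)) := by ring
    _ = c ^ 4 * cellMass ^ 2 * ((N 0 * N 1) * (N' 0 * N' 1)) := by
        rw [hminmax, hminmax]
        ring

lemma IsHyperbolicallySeparated.sum_majKer_mul_majKer_le (hξ : IsHyperbolicallySeparated ξ)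
    {Q : ℕ} (hQ : 1 ≤ Q) {c : ℝ} (hc : 1 ≤ c) {s s' : Fin 2 → ℕ}
    (hlevel : m ≤ c ^ 2 * 2 ^ level (s ⊔ s')) (y z : Torus 2) :
    ∑ j, majKer Q s (ξ j - y) * majKer Q s' (ξ j - z)
      ≤ c ^ 4 * cellMass ^ 2 * Q ^ 4 * 2 ^ (level s + level s') := by
  have hQ1 : (1 : ℝ) ≤ Q := by exact_mod_cast hQ
  set N : ℕ → ℝ := fun a => Q * 2 ^ a with hN
  have hpos (a : ℕ) : 0 < N a := by positivity
  have hmono : Monotone N := fun a b hab => by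
    simp only [hN]
    gcongr
    exact one_le_two
  have hmax (i : Fin 2) : ((N ∘ s) ⊔ (N ∘ s')) i = N ((s ⊔ s') i) := (hmono.map_sup _ _).symm
  have hcount : (m : ℝ) ≤ c ^ 2 * (((N ∘ s) ⊔ (N ∘ s')) 0 * ((N ∘ s) ⊔ (N ∘ s')) 1) := by
    calc (m : ℝ) ≤ c ^ 2 * 2 ^ level (s ⊔ s') := hlevel
      _ ≤ c ^ 2 * (Q ^ 2 * 2 ^ level (s ⊔ s')) := by
        gcongr
        exact le_mul_of_one_le_left (by positivity) (one_le_pow₀ hQ1)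
      _ = c ^ 2 * (((N ∘ s) ⊔ (N ∘ s')) 0 * ((N ∘ s) ⊔ (N ∘ s')) 1) := by
        rw [hmax, hmax]
        simp only [hN, level, pow_add]
        ring
  calc _ ≤ c ^ 4 * cellMass ^ 2 * ((N (s 0) * N (s 1)) * (N (s' 0) * N (s' 1))) :=
        hξ.sum_cauchyKer_mul_mul_le (fun _ => hpos _) (fun _ => hpos _) hc hcount y z
    _ = c ^ 4 * cellMass ^ 2 * Q ^ 4 * 2 ^ (level s + level s') := by
        simp only [hN, level, pow_add]
        ring

lemma sum_integral_mul_integral_le {X Y ι : Type*} [MeasurableSpace X] [MeasurableSpace Y]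
    {μ : Measure X} {ν : Measure Y} [SFinite μ] [SFinite ν] (I : Finset ι) {g : X → ℝ} {h : Y → ℝ}
    {a : ι → X → ℝ} {b : ι → Y → ℝ} (hg : Integrable g μ) (hh : Integrable h ν)
    (hga : ∀ i, Integrable (fun x => g x * a i x) μ)
    (hhb : ∀ i, Integrable (fun y => h y * b i y) ν) (hg0 : ∀ x, 0 ≤ g x) (hh0 : ∀ y, 0 ≤ h y)
    {K : ℝ} (hK : ∀ x y, ∑ i ∈ I, a i x * b i y ≤ K) :
    ∑ i ∈ I, (∫ x, g x * a i x ∂μ) * ∫ y, h y * b i y ∂ν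
      ≤ K * ((∫ x, g x ∂μ) * ∫ y, h y ∂ν) := by
  simp_rw [← integral_prod_mul]
  rw [← integral_finsetSum _ fun i _ => (hga i).mul_prod (hhb i), ← integral_const_mul]
  refine integral_mono (integrable_finsetSum _ fun i _ => (hga i).mul_prod (hhb i))
    ((hg.mul_prod hh).const_mul K) fun p => ?_
  calc ∑ i ∈ I, (g p.1 * a i p.1) * (h p.2 * b i p.2)
      = (∑ i ∈ I, a i p.1 * b i p.2) * (g p.1 * h p.2) := by
        rw [Finset.sum_mul]
        exact Finset.sum_congr rfl fun i _ => by ring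
    _ ≤ K * (g p.1 * h p.2) :=
        mul_le_mul_of_nonneg_right (hK _ _) (mul_nonneg (hg0 _) (hh0 _))

lemma IsHyperbolicallySeparated.sum_norm_block_mul_conj_rpow_le (hξ : IsHyperbolicallySeparated ξ)
    {f : Torus 2 → ℂ} (hf : Continuous f) {L : ℕ} (hL : 1 ≤ L) (l : ℕ) {q c : ℝ} (hq : 1 ≤ q)
    (hc : 1 ≤ c) {s s' : Fin 2 → ℕ} (hlevel : m ≤ c ^ 2 * 2 ^ level (s ⊔ s')) (g : Torus 2) :
    ∑ j, ‖block (4 * L) s f (ξ j + g) * (starRingEnd ℂ) (block (4 * L) s' f (ξ j + g))‖ ^ q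
      ≤ (900 ^ q) ^ 2 * (c ^ 4 * cellMass ^ 2 * (4 * L : ℕ) ^ 4 * 2 ^ (level s + level s') *
        ((∫ y, ‖avgDiff L l s f y‖ ^ q ∂torusMeasure 2) *
          ∫ y, ‖avgDiff L l s' f y‖ ^ q ∂torusMeasure 2)) := by
  have hmaj (u : Fin 2 → ℕ) := continuous_majKer (4 * L) u
  have havg (u : Fin 2 → ℕ) : Continuous fun y => ‖avgDiff L l u f y‖ ^ q :=
    (continuous_avgDiff hf u L l).norm.rpow_const fun _ => Or.inr (by linarith)
  set M : (Fin 2 → ℕ) → Fin m → ℝ := fun u j =>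
    ∫ y, ‖avgDiff L l u f y‖ ^ q * majKer (4 * L) u (ξ j + g - y) ∂torusMeasure 2
  have hM0 (u : Fin 2 → ℕ) (j : Fin m) : 0 ≤ M u j :=
    integral_nonneg fun y => mul_nonneg (by positivity) (majKer_nonneg _ _ _)
  have hpoint (u : Fin 2 → ℕ) (j : Fin m) : ‖block (4 * L) u f (ξ j + g)‖ ^ q ≤ 900 ^ q * M u j :=
    norm_block_rpow_le hf hL l u hq _
  simp only [norm_mul, RCLike.norm_conj, Real.mul_rpow (norm_nonneg _) (norm_nonneg _)]
  calc _ ≤ ∑ j, (900 ^ q * M s j) * (900 ^ q * M s' j) := by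
        gcongr with j
        exacts [mul_nonneg (by positivity) (hM0 s j), hpoint s j, hpoint s' j]
    _ = (900 ^ q) ^ 2 * ∑ j, M s j * M s' j := by
        rw [Finset.mul_sum]
        exact Finset.sum_congr rfl fun j _ => by ring
    _ ≤ _ := by
        gcongr
        refine sum_integral_mul_integral_le Finset.univ (integrable_of_continuous (havg s))
          (integrable_of_continuous (havg s'))
          (fun j => integrable_of_continuous (by fun_prop))
          (fun j => integrable_of_continuous (by fun_prop))
          (fun _ => by positivity) (fun _ => by positivity) fun y z => ?_
        simpa only [sub_sub_eq_add_sub] using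
          hξ.sum_majKer_mul_majKer_le (Q := 4 * L) (by lia) hc hlevel (y - g) (z - g)

lemma exists_norm_cubatureError_block_mul_conj_le {L : ℕ} {r q c : ℝ} (hr : 0 ≤ r) (hq : 1 ≤ q)
    (hL : r * q + 2 ≤ 2 * L) (l : ℕ) (hc : 1 ≤ c) :
    ∃ C : ℝ, 0 < C ∧ ∀ {m : ℕ} {ξ : Fin m → Torus 2}, 0 < m → IsHyperbolicallySeparated ξ →
      ∀ f : Torus 2 → ℂ, Continuous f → HasMixedBound l r q f →
      ∀ s s' : Fin 2 → ℕ, (m : ℝ) ≤ c ^ 2 * 2 ^ level (s ⊔ s') →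
      ‖cubatureError ξ (fun x => block (4 * L) s f x * (starRingEnd ℂ) (block (4 * L) s' f x))‖
        ≤ C * (m : ℝ) ^ (-(1 / q)) * ((2 : ℝ) ^ (level s + level s')) ^ (-(r - 1 / q)) := by
  have hrq : 0 ≤ r * q := by positivity
  have hL1 : 1 ≤ L := by
    have : (1 : ℝ) ≤ L := by linarith
    exact_mod_cast this
  have hcell := cellMass_pos
  obtain ⟨C, hC, havg⟩ := exists_integral_norm_avgDiff_rpow_le hr hq hL l
  set D : ℝ := (900 ^ q) ^ 2 * (c ^ 4 * cellMass ^ 2 * (4 * L : ℕ) ^ 4) * C ^ 2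
  refine ⟨2 * D ^ (1 / q), by positivity, fun {m ξ} hm hξ f hf hbound s s' hlevel => ?_⟩
  have hm0 : (0 : ℝ) < m := by exact_mod_cast hm
  set P : ℝ := 2 ^ (level s + level s') with hP
  have hP0 : 0 < P := by positivity
  have hmean (g : Torus 2) : (∑ j, ‖block (4 * L) s f (ξ j + g) *
      (starRingEnd ℂ) (block (4 * L) s' f (ξ j + g))‖ ^ q) / m ≤ D * P ^ (1 - r * q) / m := by
    gcongr
    calc _ ≤ (900 ^ q) ^ 2 * (c ^ 4 * cellMass ^ 2 * (4 * L : ℕ) ^ 4 * P *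
          ((C * ((2 : ℝ) ^ level s) ^ (-(r * q))) * (C * ((2 : ℝ) ^ level s') ^ (-(r * q))))) := by
          refine (hξ.sum_norm_block_mul_conj_rpow_le hf hL1 l hq hc hlevel g).trans ?_
          gcongr
          exacts [havg f hf hbound s, havg f hf hbound s']
      _ = D * (P * P ^ (-(r * q))) := by
          rw [hP, pow_add, Real.mul_rpow (by positivity) (by positivity)]
          ring
      _ = D * P ^ (1 - r * q) := by
          rw [sub_eq_add_neg, Real.rpow_add hP0, Real.rpow_one]
  have hcont (u : Fin 2 → ℕ) := continuous_block hf u (4 * L)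
  refine (norm_cubatureError_le_of_mean_le hm
    ((hcont s).mul (Complex.continuous_conj.comp (hcont s'))) hq hmean).trans_eq ?_
  have hexp : (1 - r * q) * (1 / q) = -(r - 1 / q) := by field_simp; ring
  rw [div_eq_mul_inv, Real.mul_rpow (by positivity) (by positivity),
    Real.mul_rpow (by positivity) (by positivity), ← Real.rpow_mul hP0.le, hexp,
    Real.inv_rpow hm0.le, ← Real.rpow_neg hm0.le]
  ring

end PairEstimate

/-! ### Hyperbolic sums -/

section HyperbolicSums

variable {β : ℝ} (hβ₀ : 0 ≤ β) (hβ₁ : β < 1)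

include hβ₀ hβ₁ in
lemma sum_max_mul_pow_le (n : ℕ) {F : ℕ → ℝ} (hF : ∀ i, 0 ≤ F i) :
    ∑ i ∈ Finset.range n, ∑ i' ∈ Finset.range n, F (max i i') * (β ^ i * β ^ i')
      ≤ 2 / (1 - β) * ∑ i ∈ Finset.range n, F i * β ^ i := by
  have hgeom : ∑ i ∈ Finset.range n, β ^ i ≤ 1 / (1 - β) := by
    simpa using geom_sum_Ico_le_of_lt_one (m := 0) (n := n) hβ₀ hβ₁
  have hsum : 0 ≤ ∑ i ∈ Finset.range n, F i * β ^ i :=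
    Finset.sum_nonneg fun i _ => mul_nonneg (hF i) (by positivity)
  calc _ ≤ ∑ i ∈ Finset.range n, ∑ i' ∈ Finset.range n,
        ((F i * β ^ i) * β ^ i' + β ^ i * (F i' * β ^ i')) := by
        gcongr with i _ i'
        have hmax : F (max i i') ≤ F i + F i' := by
          rcases max_choice i i' with h | h <;> rw [h] <;> linarith [hF i, hF i']
        exact (mul_le_mul_of_nonneg_right hmax (by positivity)).trans_eq (by ring)
    _ = 2 * ((∑ i ∈ Finset.range n, β ^ i) * ∑ i ∈ Finset.range n, F i * β ^ i) := by
        simp only [Finset.sum_add_distrib, ← Finset.sum_mul_sum]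
        ring
    _ ≤ 2 * (1 / (1 - β) * ∑ i ∈ Finset.range n, F i * β ^ i) := by gcongr
    _ = _ := by ring

include hβ₀ hβ₁ in
lemma sum_sum_max_mul_pow_le (n : ℕ) {G : ℕ → ℕ → ℝ} (hG : ∀ i j, 0 ≤ G i j) :
    ∑ a ∈ Finset.range n ×ˢ Finset.range n, ∑ a' ∈ Finset.range n ×ˢ Finset.range n,
        G (max a.1 a'.1) (max a.2 a'.2) * β ^ (a.1 + a.2 + (a'.1 + a'.2))
      ≤ (2 / (1 - β)) ^ 2 *
        ∑ i ∈ Finset.range n, ∑ j ∈ Finset.range n, G i j * β ^ (i + j) := by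
  set row : ℕ → ℝ := fun i => ∑ j ∈ Finset.range n, G i j * β ^ j
  have hrow (i : ℕ) : 0 ≤ row i :=
    Finset.sum_nonneg fun j _ => mul_nonneg (hG i j) (by positivity)
  calc _ = ∑ i ∈ Finset.range n, ∑ i' ∈ Finset.range n,
        (∑ j ∈ Finset.range n, ∑ j' ∈ Finset.range n,
          G (max i i') (max j j') * (β ^ j * β ^ j')) * (β ^ i * β ^ i') := by
        simp only [Finset.sum_product, Finset.sum_mul]
        refine Finset.sum_congr rfl fun i _ => ?_
        rw [Finset.sum_comm]
        refine Finset.sum_congr rfl fun i' _ => Finset.sum_congr rfl fun j _ =>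
          Finset.sum_congr rfl fun j' _ => ?_
        ring
    _ ≤ ∑ i ∈ Finset.range n, ∑ i' ∈ Finset.range n,
        (2 / (1 - β) * row (max i i')) * (β ^ i * β ^ i') := by
        gcongr with i _ i'
        exact sum_max_mul_pow_le hβ₀ hβ₁ n fun j => hG _ j
    _ = 2 / (1 - β) * ∑ i ∈ Finset.range n, ∑ i' ∈ Finset.range n,
        row (max i i') * (β ^ i * β ^ i') := by
        simp only [Finset.mul_sum, mul_assoc]
    _ ≤ 2 / (1 - β) * (2 / (1 - β) * ∑ i ∈ Finset.range n, row i * β ^ i) := by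
        have : 0 ≤ 2 / (1 - β) := div_nonneg zero_le_two (by linarith)
        gcongr
        exact sum_max_mul_pow_le hβ₀ hβ₁ n hrow
    _ = _ := by
        rw [← mul_assoc, ← sq]
        congr 1
        refine Finset.sum_congr rfl fun i _ => ?_
        rw [Finset.sum_mul]
        exact Finset.sum_congr rfl fun j _ => by ring

include hβ₀ hβ₁ in
lemma sum_ite_le_add_mul_pow_le (n M i : ℕ) :
    ∑ j ∈ Finset.range n, (if M ≤ i + j then 1 else 0) * β ^ (i + j)
      ≤ β ^ max i M / (1 - β) := by
  calc _ = β ^ i * ∑ j ∈ Finset.range n with M ≤ i + j, β ^ j := by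
        rw [Finset.mul_sum, Finset.sum_filter]
        refine Finset.sum_congr rfl fun j _ => ?_
        split_ifs
        · rw [one_mul, pow_add]
        · rw [zero_mul]
    _ ≤ β ^ i * ∑ j ∈ Finset.Ico (M - i) n, β ^ j := by
        gcongr
        intro j hj
        simp only [Finset.mem_filter, Finset.mem_range, Finset.mem_Ico] at hj ⊢
        omega
    _ ≤ β ^ i * (β ^ (M - i) / (1 - β)) := by
        gcongr
        exact geom_sum_Ico_le_of_lt_one hβ₀ hβ₁
    _ = β ^ max i M / (1 - β) := by
        rw [← mul_div_assoc, ← pow_add, add_tsub_eq_max]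

include hβ₀ hβ₁ in
lemma sum_pow_max_le (n M : ℕ) :
    ∑ i ∈ Finset.range n, β ^ max i M ≤ (M + 1) * β ^ M / (1 - β) := by
  have hβ : 0 < 1 - β := by linarith
  have hgeom : ∑ i ∈ Finset.Ico M (M + n), β ^ i ≤ β ^ M / (1 - β) :=
    geom_sum_Ico_le_of_lt_one hβ₀ hβ₁
  have hle : (1 : ℝ) ≤ 1 / (1 - β) := by
    rw [one_le_div hβ]
    linarith
  calc ∑ i ∈ Finset.range n, β ^ max i M
      ≤ ∑ i ∈ Finset.range (M + n), β ^ max i M := by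
        gcongr
        lia
    _ = ∑ i ∈ Finset.range M, β ^ max i M + ∑ i ∈ Finset.Ico M (M + n), β ^ max i M :=
        (Finset.sum_range_add_sum_Ico _ (by lia)).symm
    _ = M * β ^ M + ∑ i ∈ Finset.Ico M (M + n), β ^ i := by
        congr 1
        · rw [Finset.sum_congr rfl fun i hi => by
            rw [max_eq_right (Finset.mem_range.1 hi).le], Finset.sum_const, Finset.card_range,
            nsmul_eq_mul]
        · exact Finset.sum_congr rfl fun i hi => by rw [max_eq_left (Finset.mem_Ico.1 hi).1]
    _ ≤ M * β ^ M * (1 / (1 - β)) + β ^ M / (1 - β) :=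
        add_le_add (le_mul_of_one_le_right (by positivity) hle) hgeom
    _ = (M + 1) * β ^ M / (1 - β) := by ring

include hβ₀ hβ₁ in
lemma sum_sum_ite_le_add_mul_pow_le (n M : ℕ) :
    ∑ i ∈ Finset.range n, ∑ j ∈ Finset.range n, (if M ≤ i + j then 1 else 0) * β ^ (i + j)
      ≤ (M + 1) * β ^ M / (1 - β) ^ 2 := by
  have : 0 < 1 - β := by linarith
  calc _ ≤ ∑ i ∈ Finset.range n, β ^ max i M / (1 - β) :=
        Finset.sum_le_sum fun i _ => sum_ite_le_add_mul_pow_le hβ₀ hβ₁ n M i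
    _ = (∑ i ∈ Finset.range n, β ^ max i M) / (1 - β) := (Finset.sum_div _ _ _).symm
    _ ≤ (M + 1) * β ^ M / (1 - β) / (1 - β) := by
        gcongr
        exact sum_pow_max_le hβ₀ hβ₁ n M
    _ = (M + 1) * β ^ M / (1 - β) ^ 2 := by rw [div_div, sq]

end HyperbolicSums

lemma natLog_div_add_one_le {m : ℕ} (hm : 2 ≤ m) (κ : ℕ) :
    (Nat.log 2 (m / κ) : ℝ) + 1 ≤ 2 / Real.log 2 * Real.log m := by
  have hlog : 0 < Real.log 2 := Real.log_pos one_lt_two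
  have hpow : (2 : ℝ) ^ Nat.log 2 (m / κ) ≤ m := by
    exact_mod_cast Nat.pow_le_of_le_log (by omega) (Nat.log_mono_right (Nat.div_le_self m κ))
  have hle := Real.log_le_log (by positivity) hpow
  have htwo : Real.log 2 ≤ Real.log m := Real.log_le_log two_pos (by exact_mod_cast hm)
  rw [Real.log_pow] at hle
  rw [div_mul_eq_mul_div, le_div_iff₀ hlog]
  linarith

lemma two_rpow_neg_pow_natLog_div_le {m κ : ℕ} (hm : 0 < m) (hκ : 0 < κ) {α : ℝ} (hα : 0 ≤ α) :
    ((2 : ℝ) ^ (-α)) ^ Nat.log 2 (m / κ) ≤ (2 * κ) ^ α * (m : ℝ) ^ (-α) := by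
  have hm0 : (0 : ℝ) < m := by exact_mod_cast hm
  have : (0 : ℝ) < κ := by exact_mod_cast hκ
  have hpow : (m : ℝ) / (2 * κ) ≤ 2 ^ Nat.log 2 (m / κ) := by
    have hlt : m < 2 ^ (Nat.log 2 (m / κ) + 1) * κ :=
      (Nat.div_lt_iff_lt_mul hκ).1 (Nat.lt_pow_succ_log_self one_lt_two _)
    rw [div_le_iff₀ (by positivity)]
    exact_mod_cast hlt.le.trans_eq (by ring)
  calc ((2 : ℝ) ^ (-α)) ^ Nat.log 2 (m / κ) = ((2 : ℝ) ^ Nat.log 2 (m / κ)) ^ (-α) :=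
        (Real.rpow_pow_comm two_pos.le _ _)
    _ ≤ ((m : ℝ) / (2 * κ)) ^ (-α) :=
        Real.rpow_le_rpow_of_nonpos (by positivity) hpow (by linarith)
    _ = (2 * κ) ^ α * (m : ℝ) ^ (-α) := by
        rw [Real.div_rpow hm0.le (by positivity), Real.rpow_neg (by positivity : (0 : ℝ) ≤ 2 * κ),
          div_inv_eq_mul, mul_comm]

/-! ### Cubature of the squared modulus -/

section SquaredModulus

lemma exists_norm_cubatureError_block_mul_conj_le_ite {L : ℕ} {r q : ℝ} (hr : 0 ≤ r) (hq : 1 ≤ q)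
    (hL : r * q + 2 ≤ 2 * L) (l A : ℕ) :
    ∃ (C : ℝ) (κ : ℕ), 0 < C ∧ 0 < κ ∧ ∀ {m : ℕ} {ξ : Fin m → Torus 2}, 0 < m →
      IsHyperbolicNodeSet A ξ → ∀ f : Torus 2 → ℂ, Continuous f → HasMixedBound l r q f →
      ∀ s s' : Fin 2 → ℕ,
      ‖cubatureError ξ (fun x => block (4 * L) s f x * (starRingEnd ℂ) (block (4 * L) s' f x))‖
        ≤ C * (m : ℝ) ^ (-(1 / q)) * ((if Nat.log 2 (m / κ) ≤ level (s ⊔ s') then 1 else 0) *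
          ((2 : ℝ) ^ (-(r - 1 / q))) ^ (level s + level s')) := by
  have hL1 : 1 ≤ 4 * L := by
    have hrq : 0 ≤ r * q := by positivity
    have : (0 : ℝ) < L := by linarith
    have : 0 < L := by exact_mod_cast this
    omega
  set κ := 36 * A * (4 * L) ^ 2 + 1
  have hκ : (1 : ℝ) ≤ κ := by exact_mod_cast Nat.le_add_left 1 _
  obtain ⟨C, hC, hpair⟩ := exists_norm_cubatureError_block_mul_conj_le hr hq hL l hκ
  refine ⟨C, κ, hC, Nat.succ_pos _, fun {m ξ} hm hξ f hf hbound s s' => ?_⟩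
  by_cases hlevel : m ≤ κ * 2 ^ level (s ⊔ s')
  · have hlog : Nat.log 2 (m / κ) ≤ level (s ⊔ s') :=
      (Nat.log_mono_right (Nat.div_le_of_le_mul hlevel)).trans_eq (Nat.log_pow one_lt_two _)
    have hcount : (m : ℝ) ≤ (κ : ℝ) ^ 2 * 2 ^ level (s ⊔ s') := by
      calc (m : ℝ) ≤ κ * 2 ^ level (s ⊔ s') := by exact_mod_cast hlevel
        _ ≤ (κ : ℝ) ^ 2 * 2 ^ level (s ⊔ s') := by
          gcongr
          exact le_self_pow₀ hκ two_ne_zero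
    rw [if_pos hlog, one_mul, Real.rpow_pow_comm two_pos.le]
    exact hpair hm hξ.separated f hf hbound s s' hcount
  · rw [hξ.cubatureError_block_mul_conj_eq_zero hf hL1, norm_zero]
    · positivity
    · refine lt_of_le_of_lt ?_ (not_le.1 hlevel)
      gcongr
      exact Nat.le_succ _

variable {m : ℕ} (ξ : Fin m → Torus 2) {f : Torus 2 → ℂ} (hf : Continuous f)

include hf in
lemma norm_cubatureError_partialSum_mul_conj_le (Q S : ℕ) :
    ‖cubatureError ξ (fun x => partialSum Q S f x * (starRingEnd ℂ) (partialSum Q S f x))‖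
      ≤ ∑ a ∈ Finset.range (S + 1) ×ˢ Finset.range (S + 1),
        ∑ a' ∈ Finset.range (S + 1) ×ˢ Finset.range (S + 1), ‖cubatureError ξ (fun x =>
          block Q ![a.1, a.2] f x * (starRingEnd ℂ) (block Q ![a'.1, a'.2] f x))‖ := by
  have hcont (a a' : ℕ × ℕ) : Continuous fun x =>
      block Q ![a.1, a.2] f x * (starRingEnd ℂ) (block Q ![a'.1, a'.2] f x) :=
    (continuous_block hf _ Q).mul (Complex.continuous_conj.comp (continuous_block hf _ Q))
  simp only [partialSum, map_sum, Finset.sum_mul_sum]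
  rw [cubatureError_sum _ _ fun a _ => continuous_finsetSum _ fun a' _ => hcont a a']
  refine norm_sum_le_of_le _ fun a _ => ?_
  rw [cubatureError_sum _ _ fun a' _ => hcont a a']
  exact norm_sum_le _ _

lemma exists_norm_cubatureError_partialSum_le {L : ℕ} {r q : ℝ} (hq : 1 ≤ q) (hr : 1 / q < r)
    (hL : r * q + 2 ≤ 2 * L) (l A : ℕ) :
    ∃ C : ℝ, 0 < C ∧ ∀ {m : ℕ} {ξ : Fin m → Torus 2}, 2 ≤ m → IsHyperbolicNodeSet A ξ →
      ∀ f : Torus 2 → ℂ, Continuous f → HasMixedBound l r q f → ∀ S,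
      ‖cubatureError ξ
          (fun x => partialSum (4 * L) S f x * (starRingEnd ℂ) (partialSum (4 * L) S f x))‖
        ≤ C * ((m : ℝ) ^ (-r) * Real.log m) := by
  have hr0 : 0 ≤ r := hr.le.trans' (by positivity)
  obtain ⟨C, κ, hC, hκ, hpair⟩ := exists_norm_cubatureError_block_mul_conj_le_ite hr0 hq hL l A
  set α := r - 1 / q
  have hα : 0 < α := sub_pos.2 hr
  set β : ℝ := 2 ^ (-α)
  have hβ₀ : 0 ≤ β := by positivity
  have hβ₁ : β < 1 := Real.rpow_lt_one_of_one_lt_of_neg one_lt_two (by linarith)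
  have : 0 < 1 - β := by linarith
  have : 0 < Real.log 2 := Real.log_pos one_lt_two
  refine ⟨C * ((2 / (1 - β)) ^ 2 * (2 / Real.log 2 * (2 * κ) ^ α / (1 - β) ^ 2)),
    by positivity, fun {m ξ} hm hξ f hf hbound S => ?_⟩
  have hm0 : (0 : ℝ) < m := by exact_mod_cast two_pos.trans_le hm
  set I := Finset.range (S + 1)
  set M := Nat.log 2 (m / κ)
  set G : ℕ → ℕ → ℝ := fun i j => if M ≤ i + j then 1 else 0
  have hG (i j : ℕ) : 0 ≤ G i j := by positivity
  calc _ ≤ ∑ a ∈ I ×ˢ I, ∑ a' ∈ I ×ˢ I, C * (m : ℝ) ^ (-(1 / q)) *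
        (G (max a.1 a'.1) (max a.2 a'.2) * β ^ (a.1 + a.2 + (a'.1 + a'.2))) :=
        (norm_cubatureError_partialSum_mul_conj_le ξ hf _ S).trans
          (Finset.sum_le_sum fun a _ => Finset.sum_le_sum fun a' _ =>
            hpair (by lia) hξ f hf hbound ![a.1, a.2] ![a'.1, a'.2])
    _ = C * (m : ℝ) ^ (-(1 / q)) * ∑ a ∈ I ×ˢ I, ∑ a' ∈ I ×ˢ I,
        G (max a.1 a'.1) (max a.2 a'.2) * β ^ (a.1 + a.2 + (a'.1 + a'.2)) := by
        simp only [Finset.mul_sum]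
    _ ≤ C * (m : ℝ) ^ (-(1 / q)) *
        ((2 / (1 - β)) ^ 2 * ((M + 1) * β ^ M / (1 - β) ^ 2)) := by
        gcongr
        refine (sum_sum_max_mul_pow_le hβ₀ hβ₁ (S + 1) hG).trans ?_
        gcongr
        exact sum_sum_ite_le_add_mul_pow_le hβ₀ hβ₁ (S + 1) M
    _ ≤ C * (m : ℝ) ^ (-(1 / q)) * ((2 / (1 - β)) ^ 2 *
        ((2 / Real.log 2 * Real.log m) * ((2 * κ) ^ α * (m : ℝ) ^ (-α)) / (1 - β) ^ 2)) := by
        gcongr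
        · exact natLog_div_add_one_le hm κ
        · exact two_rpow_neg_pow_natLog_div_le (by lia) hκ hα.le
    _ = C * ((2 / (1 - β)) ^ 2 * (2 / Real.log 2 * (2 * κ) ^ α / (1 - β) ^ 2)) *
        ((m : ℝ) ^ (-(1 / q)) * (m : ℝ) ^ (-α) * Real.log m) := by ring
    _ = _ := by rw [← Real.rpow_add hm0, ← neg_add, add_sub_cancel]

lemma norm_mul_conj_sub_mul_conj_le {z w : ℂ} {η K : ℝ} (hz : ‖z‖ ≤ K) (hzw : ‖w - z‖ ≤ η)
    (hη : η ≤ 1) :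
    ‖z * (starRingEnd ℂ) z - w * (starRingEnd ℂ) w‖ ≤ η * (2 * K + 1) := by
  have hw : ‖w‖ ≤ K + 1 := by linarith [norm_le_norm_add_norm_sub z w, norm_sub_rev z w]
  have hsplit : z * (starRingEnd ℂ) z - w * (starRingEnd ℂ) w
      = -((w - z) * (starRingEnd ℂ) w + z * (starRingEnd ℂ) (w - z)) := by
    rw [map_sub]
    ring
  have hη0 : 0 ≤ η := (norm_nonneg _).trans hzw
  have hK0 : 0 ≤ K := (norm_nonneg _).trans hz
  calc _ ≤ ‖w - z‖ * ‖w‖ + ‖z‖ * ‖w - z‖ := by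
        rw [hsplit, norm_neg]
        refine (norm_add_le _ _).trans_eq ?_
        simp only [norm_mul, RCLike.norm_conj]
    _ ≤ η * (K + 1) + K * η := by gcongr
    _ = η * (2 * K + 1) := by ring

include hf in
lemma exists_norm_cubatureError_mul_conj_le_add {Q : ℕ} (hQ : 1 ≤ Q) {ε : ℝ} (hε : 0 < ε) :
    ∃ S, ‖cubatureError ξ (fun x => f x * (starRingEnd ℂ) (f x))‖
      ≤ ‖cubatureError ξ (fun x => partialSum Q S f x * (starRingEnd ℂ) (partialSum Q S f x))‖
        + ε := by
  obtain ⟨K, hK⟩ := (isCompact_range hf).isBounded.exists_norm_le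
  replace hK (x : Torus 2) : ‖f x‖ ≤ K := hK _ ⟨x, rfl⟩
  have hK0 : 0 ≤ K := (norm_nonneg _).trans (hK 0)
  set η := min 1 (ε / (2 * (2 * K + 1)))
  have hη : 2 * (η * (2 * K + 1)) ≤ ε := by
    calc 2 * (η * (2 * K + 1)) ≤ 2 * (ε / (2 * (2 * K + 1)) * (2 * K + 1)) := by
          gcongr
          exact min_le_right _ _
      _ = ε := by field_simp
  obtain ⟨S, hS⟩ := exists_norm_partialSum_sub_le hQ hf (ε := η) (by positivity)
  have hpartial : Continuous (partialSum Q S f) :=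
    continuous_finsetSum _ fun a _ => continuous_block hf _ Q
  have hdiff := norm_cubatureError_sub_le ξ (F := fun x => f x * (starRingEnd ℂ) (f x))
    (G := fun x => partialSum Q S f x * (starRingEnd ℂ) (partialSum Q S f x))
    (hf.mul (Complex.continuous_conj.comp hf))
    (hpartial.mul (Complex.continuous_conj.comp hpartial))
    fun x => norm_mul_conj_sub_mul_conj_le (hK x) (hS x) (min_le_left _ _)
  refine ⟨S, ?_⟩
  linarith [norm_sub_norm_le (cubatureError ξ (fun x => f x * (starRingEnd ℂ) (f x)))
    (cubatureError ξ (fun x => partialSum Q S f x * (starRingEnd ℂ) (partialSum Q S f x)))]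

lemma exists_norm_cubatureError_mul_conj_le {r q : ℝ} (hq : 1 ≤ q) (hr : 1 / q < r) (l A : ℕ) :
    ∃ C : ℝ, 0 < C ∧ ∀ {m : ℕ} {ξ : Fin m → Torus 2}, 2 ≤ m → IsHyperbolicNodeSet A ξ →
      ∀ f : Torus 2 → ℂ, Continuous f → HasMixedBound l r q f →
      ‖cubatureError ξ (fun x => f x * (starRingEnd ℂ) (f x))‖
        ≤ C * ((m : ℝ) ^ (-r) * Real.log m) := by
  obtain ⟨L, hL⟩ := exists_nat_ge (r * q + 2)
  obtain ⟨C, hC, hpartial⟩ := exists_norm_cubatureError_partialSum_le (L := L + 1) hq hr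
    (by push_cast; linarith [(Nat.cast_nonneg L : (0 : ℝ) ≤ L)]) l A
  refine ⟨C, hC, fun {m ξ} hm hξ f hf hbound => le_of_forall_pos_le_add fun ε hε => ?_⟩
  obtain ⟨S, hS⟩ := exists_norm_cubatureError_mul_conj_le_add ξ hf
    (Q := 4 * (L + 1)) (by lia) hε
  exact hS.trans (add_le_add_left (hpartial hm hξ f hf hbound S) ε)

end SquaredModulus

/-! ### Fibonacci nodes -/

section FibonacciLattice

lemma fibB_eq_fib (n : ℕ) : fibB n = Nat.fib (n + 1) := by
  induction n using Nat.twoStepInduction with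
  | zero => rfl
  | one => rfl
  | more n ih₀ ih₁ => rw [fibB, ih₀, ih₁, Nat.fib_add_two (n := n + 1), add_comm]

lemma fibB_pos (n : ℕ) : 0 < fibB n := by
  rw [fibB_eq_fib]
  exact Nat.fib_pos.2 n.succ_pos

lemma two_le_fibB {n : ℕ} (hn : 2 ≤ n) : 2 ≤ fibB n := by
  rw [fibB_eq_fib]
  exact Nat.fib_mono (by lia : 3 ≤ n + 1)

lemma fibB_le_fibB_succ (n : ℕ) : fibB n ≤ fibB (n + 1) := by
  simpa only [fibB_eq_fib] using Nat.fib_le_fib_succ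

lemma abs_fibB_sq_add_mul_sub_sq (n : ℕ) :
    |(fibB n : ℤ) ^ 2 + fibB n * fibB (n + 1) - (fibB (n + 1) : ℤ) ^ 2| = 1 := by
  induction n with
  | zero => simp [fibB]
  | succ n ih =>
    rw [fibB, ← ih, ← abs_neg]
    push_cast
    ring_nf

lemma sq_ne_five_mul_sq {x y : ℤ} (hy : y ≠ 0) : x ^ 2 ≠ 5 * y ^ 2 := by
  intro h
  obtain ⟨c, rfl⟩ : y ∣ x := (Int.pow_dvd_pow_iff two_ne_zero).1 ⟨5, by rw [h, mul_comm]⟩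
  have hc : c ^ 2 = 5 := mul_left_cancel₀ (pow_ne_zero 2 hy) (by linear_combination h)
  have hlow : -3 < c := by nlinarith
  have hhigh : c < 3 := by nlinarith
  interval_cases c <;> omega

lemma one_le_abs_golden_form {k μ : ℤ} (h : ¬(μ = 0 ∧ k = 0)) :
    1 ≤ |k ^ 2 + k * μ - μ ^ 2| := by
  refine Int.one_le_abs fun hzero => ?_
  by_cases hμ : μ = 0
  · subst hμ
    exact h ⟨rfl, by simpa using hzero⟩
  · exact sq_ne_five_mul_sq (x := 2 * k + μ) hμ (by linear_combination 4 * hzero)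

/-- Substituting `ν = μ a - k b` turns `k ^ 2 + k μ - μ ^ 2`, which is a nonzero integer, into a
form in `μ / b` and `ν / b` whose `μ ^ 2` coefficient is bounded by Cassini's identity. -/
lemma fibB_succ_sq_le (n : ℕ) {μ ν : ℤ} (hdvd : (fibB (n + 1) : ℤ) ∣ μ * fibB n - ν)
    (h : ¬(μ = 0 ∧ ν = 0)) :
    (fibB (n + 1) : ℤ) ^ 2 ≤ μ ^ 2 + ν ^ 2 + 3 * fibB (n + 1) * |μ * ν| := by
  obtain ⟨k, hk⟩ := hdvd
  have hab : (fibB n : ℤ) ≤ fibB (n + 1) := by exact_mod_cast fibB_le_fibB_succ n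
  have hcassini := abs_fibB_sq_add_mul_sub_sq n
  set a := ((fibB n : ℕ) : ℤ)
  set b := ((fibB (n + 1) : ℕ) : ℤ)
  have ha : 0 ≤ a := Int.natCast_nonneg _
  have : 0 ≤ b := ha.trans hab
  obtain rfl : ν = μ * a - b * k := by linarith
  have hform : 1 ≤ |k ^ 2 + k * μ - μ ^ 2| :=
    one_le_abs_golden_form fun ⟨hμ, hk⟩ => h (by simp [hμ, hk])
  set ν := μ * a - b * k with hν
  have hid : b ^ 2 * (k ^ 2 + k * μ - μ ^ 2)
      = μ ^ 2 * (a ^ 2 + a * b - b ^ 2) - μ * ν * (2 * a + b) + ν ^ 2 := by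
    rw [hν]
    ring
  calc b ^ 2 ≤ b ^ 2 * |k ^ 2 + k * μ - μ ^ 2| := le_mul_of_one_le_right (sq_nonneg b) hform
    _ = |μ ^ 2 * (a ^ 2 + a * b - b ^ 2) - μ * ν * (2 * a + b) + ν ^ 2| := by
        rw [← hid, abs_mul, abs_of_nonneg (sq_nonneg b)]
    _ ≤ |μ ^ 2 * (a ^ 2 + a * b - b ^ 2)| + |μ * ν * (2 * a + b)| + |ν ^ 2| :=
        (abs_add_le _ _).trans (add_le_add_left (abs_sub _ _) _)
    _ = μ ^ 2 + ν ^ 2 + (2 * a + b) * |μ * ν| := by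
        rw [abs_mul, hcassini, abs_mul (μ * ν), abs_of_nonneg (by positivity : 0 ≤ 2 * a + b),
          abs_of_nonneg (sq_nonneg μ), abs_of_nonneg (sq_nonneg ν)]
        ring
    _ ≤ μ ^ 2 + ν ^ 2 + 3 * b * |μ * ν| := by
        gcongr
        linarith

lemma fibB_succ_le_six_mul (n : ℕ) {μ ν : ℤ} (hdvd : (fibB (n + 1) : ℤ) ∣ μ * fibB n - ν)
    (h : ¬(μ = 0 ∧ ν = 0)) : (fibB (n + 1) : ℤ) ≤ 6 * max 1 |μ| * max 1 |ν| := by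
  have hsq := fibB_succ_sq_le n hdvd h
  set b := ((fibB (n + 1) : ℕ) : ℤ)
  have hb : 0 ≤ b := Int.natCast_nonneg _
  set M := max 1 |μ|
  set V := max 1 |ν|
  have hM : 1 ≤ M := le_max_left _ _
  have hV : 1 ≤ V := le_max_left _ _
  have hμ : |μ| ≤ M := le_max_right _ _
  have hν : |ν| ≤ V := le_max_right _ _
  have hM0 : 0 < M := one_pos.trans_le hM
  have hV0 : 0 < V := one_pos.trans_le hV
  have hμ_sq : μ ^ 2 ≤ (M * V) ^ 2 :=
    sq_le_sq.2 ((hμ.trans (le_mul_of_one_le_right hM0.le hV)).trans (le_abs_self _))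
  have hν_sq : ν ^ 2 ≤ (M * V) ^ 2 :=
    sq_le_sq.2 ((hν.trans (le_mul_of_one_le_left hV0.le hM)).trans (le_abs_self _))
  have hμν : |μ * ν| ≤ M * V := by
    rw [abs_mul]
    gcongr
  have hquad : b ^ 2 ≤ 2 * (M * V) ^ 2 + 3 * b * (M * V) := by
    linarith [mul_le_mul_of_nonneg_left hμν hb]
  by_contra! hlt
  nlinarith [mul_pos hM0 hV0]

end FibonacciLattice

section FibonacciNodes

lemma exists_norm_coe_two_pi_mul_div_eq (k : ℤ) {b : ℕ} (hb : 0 < b) :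
    ∃ μ : ℤ, (b : ℤ) ∣ k - μ ∧ 2 * |μ| ≤ b ∧
      ‖((2 * π * ((k : ℝ) / b) : ℝ) : Circ)‖ = 2 * π * (|(μ : ℝ)| / b) := by
  have hb0 : (0 : ℝ) < b := by exact_mod_cast hb
  set μ : ℤ := k - b * round ((k : ℝ) / b) with hμ
  have hround : (k : ℝ) / b - round ((k : ℝ) / b) = μ / b := by
    rw [hμ]
    push_cast
    field_simp
  have hhalf : |(μ : ℝ) / b| ≤ 1 / 2 := hround ▸ abs_sub_round _
  rw [abs_div, Nat.abs_cast, div_le_div_iff₀ hb0 two_pos] at hhalf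
  refine ⟨μ, ⟨round ((k : ℝ) / b), sub_sub_cancel _ _⟩, ?_, ?_⟩
  · exact_mod_cast (by linarith : 2 * |(μ : ℝ)| ≤ b)
  · rw [AddCircle.norm_eq' (2 * π) Real.two_pi_pos, inv_mul_cancel_left₀ Real.two_pi_pos.ne',
      hround, abs_div, Nat.abs_cast]

lemma fibPoint_apply_zero (n : ℕ) (j : Fin (fibB n)) :
    fibPoint n j 0 = ((2 * π * (((j + 1 : ℤ) : ℝ) / fibB n) : ℝ) : Circ) := by
  simp [fibPoint]

lemma fibPoint_apply_one (n : ℕ) (j : Fin (fibB n)) :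
    fibPoint n j 1
      = ((2 * π * ((((j + 1) * fibB (n - 1) : ℤ) : ℝ) / fibB n) : ℝ) : Circ) := by
  simp only [fibPoint, Matrix.cons_val_one, Matrix.cons_val_zero]
  rw [← sub_eq_zero, ← AddCircle.coe_sub, AddCircle.coe_eq_zero_iff]
  refine ⟨-⌊((j : ℕ) + 1 : ℝ) * (fibB (n - 1) : ℝ) / (fibB n : ℝ)⌋, ?_⟩
  rw [Int.fract, zsmul_eq_mul]
  push_cast
  ring

lemma fibPoint_sub_apply_zero (n : ℕ) (i j : Fin (fibB n)) :
    fibPoint n i 0 - fibPoint n j 0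
      = ((2 * π * (((i - j : ℤ) : ℝ) / fibB n) : ℝ) : Circ) := by
  rw [fibPoint_apply_zero, fibPoint_apply_zero, ← AddCircle.coe_sub]
  congr 1
  push_cast
  ring

lemma fibPoint_sub_apply_one (n : ℕ) (i j : Fin (fibB n)) :
    fibPoint n i 1 - fibPoint n j 1
      = ((2 * π * ((((i - j) * fibB (n - 1) : ℤ) : ℝ) / fibB n) : ℝ) : Circ) := by
  rw [fibPoint_apply_one, fibPoint_apply_one, ← AddCircle.coe_sub]
  congr 1
  push_cast
  ring

lemma exists_norm_fibPoint_sub_eq (n : ℕ) {i j : Fin (fibB (n + 1))} (hij : i ≠ j) :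
    ∃ μ ν : ℤ, μ ≠ 0 ∧ ν ≠ 0 ∧ (fibB (n + 1) : ℤ) ∣ μ * fibB n - ν ∧
      ‖fibPoint (n + 1) i 0 - fibPoint (n + 1) j 0‖ = 2 * π * (|(μ : ℝ)| / fibB (n + 1)) ∧
      ‖fibPoint (n + 1) i 1 - fibPoint (n + 1) j 1‖ = 2 * π * (|(ν : ℝ)| / fibB (n + 1)) := by
  rw [fibPoint_sub_apply_zero, fibPoint_sub_apply_one, Nat.add_sub_cancel]
  obtain ⟨μ, hμ, hμ_le, hμ_norm⟩ := exists_norm_coe_two_pi_mul_div_eq (i - j) (fibB_pos (n + 1))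
  obtain ⟨ν, hν, -, hν_norm⟩ :=
    exists_norm_coe_two_pi_mul_div_eq ((i - j) * fibB n) (fibB_pos (n + 1))
  have hdvd : (fibB (n + 1) : ℤ) ∣ μ * fibB n - ν := by
    have hcomb : μ * fibB n - ν
        = ((i - j : ℤ) * fibB n - ν) - ((i - j : ℤ) - μ) * fibB n := by ring
    rw [hcomb]
    exact dvd_sub hν (hμ.mul_right _)
  have hμ0 : μ ≠ 0 := by
    rintro rfl
    have hzero := Int.eq_zero_of_abs_lt_dvd (sub_zero (_ : ℤ) ▸ hμ) (by rw [abs_lt]; omega)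
    exact hij (Fin.ext (by omega))
  have hν0 : ν ≠ 0 := by
    rintro rfl
    have hsq := fibB_succ_sq_le n hdvd (by simp [hμ0])
    have hb := fibB_pos (n + 1)
    simp only [mul_zero, abs_zero, add_zero, ne_eq, OfNat.ofNat_ne_zero, not_false_eq_true,
      zero_pow, ← sq_abs μ] at hsq
    nlinarith [abs_nonneg μ]
  exact ⟨μ, ν, hμ0, hν0, hdvd, hμ_norm, hν_norm⟩

lemma isHyperbolicallySeparated_fibPoint (n : ℕ) :
    IsHyperbolicallySeparated (fibPoint (n + 1)) := by
  intro i j hij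
  obtain ⟨μ, ν, hμ, hν, hdvd, hμ_norm, hν_norm⟩ := exists_norm_fibPoint_sub_eq n hij
  have hb : (0 : ℝ) < fibB (n + 1) := by exact_mod_cast fibB_pos (n + 1)
  have hprod : (fibB (n + 1) : ℝ) ≤ 6 * |(μ : ℝ)| * |(ν : ℝ)| := by
    have := fibB_succ_le_six_mul n hdvd (by simp [hμ])
    rw [max_eq_right (Int.one_le_abs hμ), max_eq_right (Int.one_le_abs hν)] at this
    exact_mod_cast this
  have hpi : 6 ≤ 4 * π ^ 2 := by nlinarith [Real.pi_gt_three]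
  calc (1 : ℝ) ≤ 6 * |(μ : ℝ)| * |(ν : ℝ)| / fibB (n + 1) := (one_le_div hb).2 hprod
    _ ≤ 4 * π ^ 2 * |(μ : ℝ)| * |(ν : ℝ)| / fibB (n + 1) := by gcongr
    _ = _ := by
        rw [hμ_norm, hν_norm]
        field_simp
        ring

lemma sum_torusChar_fibPoint_eq_zero (n : ℕ) {k₁ k₂ : ℤ}
    (h : ¬(fibB (n + 1) : ℤ) ∣ k₁ + k₂ * fibB n) :
    ∑ j, torusChar k₁ k₂ (fibPoint (n + 1) j) = 0 := by
  set k : ℤ := k₁ + k₂ * fibB n with hk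
  have hb : (fibB (n + 1) : ℂ) ≠ 0 := by exact_mod_cast (fibB_pos (n + 1)).ne'
  have hroot := Complex.isPrimitiveRoot_exp (fibB (n + 1)) (fibB_pos _).ne'
  set ζ : ℂ := Complex.exp (2 * π * Complex.I / fibB (n + 1)) with hζ
  have hpow (j : Fin (fibB (n + 1))) :
      torusChar k₁ k₂ (fibPoint (n + 1) j) = ζ ^ k * (ζ ^ k) ^ (j : ℕ) := by
    rw [torusChar, fibPoint_apply_zero (n + 1) j, fibPoint_apply_one (n + 1) j, fourier_coe_apply,
      fourier_coe_apply, ← Complex.exp_add, ← pow_succ', hζ, ← Complex.exp_int_mul,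
      ← Complex.exp_nat_mul, Nat.add_sub_cancel, hk]
    congr 1
    push_cast
    field_simp
  have hne : ζ ^ k ≠ 1 := mt (hroot.zpow_eq_one_iff_dvd k).1 h
  have hone : (ζ ^ k) ^ fibB (n + 1) = 1 := by
    rw [← zpow_natCast, ← zpow_mul, mul_comm, zpow_mul, zpow_natCast, hroot.pow_eq_one, one_zpow]
  rw [Finset.sum_congr rfl fun j _ => hpow j, ← Finset.mul_sum,
    Fin.sum_univ_eq_sum_range (fun j => (ζ ^ k) ^ j), geom_sum_eq hne, hone]
  simp

lemma isHyperbolicNodeSet_fibPoint (n : ℕ) : IsHyperbolicNodeSet 6 (fibPoint (n + 1)) where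
  separated := isHyperbolicallySeparated_fibPoint n
  sum_torusChar_eq_zero k₁ k₂ hk hlt := by
    refine sum_torusChar_fibPoint_eq_zero n fun hdvd => hlt.not_ge ?_
    have hle := fibB_succ_le_six_mul n (μ := k₂) (ν := -k₁)
      (by rwa [sub_neg_eq_add, add_comm (k₂ * _)]) (by simpa [and_comm] using hk)
    rw [abs_neg] at hle
    exact hle.trans_eq (by push_cast; ring)

end FibonacciNodes

/-! ### The upper bound on the class `H^r_p` -/

section MixedDiff

variable {𝕜 𝕜' F : Type*} [RCLike 𝕜] [RCLike 𝕜'] [FunLike F 𝕜 𝕜'] [AddMonoidHomClass F 𝕜 𝕜']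
  {d : ℕ}

lemma comp_coordDiff (φ : F) (l : ℕ) (t : ℝ) (j : Fin d) (g : Torus d → 𝕜) :
    φ ∘ coordDiff l t j g = coordDiff l t j (φ ∘ g) :=
  Function.Semiconj.iterate_right (f := (φ ∘ ·))
    (fun g => funext fun x => by simp only [fwdDiff, Function.comp_apply, map_sub]) l g

lemma comp_mixedDiff (φ : F) (l : ℕ) (t : Fin d → ℝ) (e : Finset (Fin d)) (f : Torus d → 𝕜) :
    φ ∘ mixedDiff l t e f = mixedDiff l t e (φ ∘ f) := by
  refine (List.foldl_hom (φ ∘ ·) fun g j => ?_).symm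
  split_ifs
  · exact (comp_coordDiff φ l (t j) j g).symm
  · rfl

lemma continuous_coordDiff {g : Torus d → 𝕜} (hg : Continuous g) (l : ℕ) (t : ℝ) (j : Fin d) :
    Continuous (coordDiff l t j g) :=
  Function.Iterate.rec Continuous hg
    (fun _ hg => (hg.comp (continuous_add_const (Pi.single j (t : Circ)))).sub hg) l

lemma continuous_mixedDiff {f : Torus d → 𝕜} (hf : Continuous f) (l : ℕ) (t : Fin d → ℝ)
    (e : Finset (Fin d)) : Continuous (mixedDiff l t e f) := by
  refine List.foldlRecOn (motive := Continuous) _ _ hf fun g hg j _ => ?_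
  split_ifs
  · exact continuous_coordDiff hg l (t j) j
  · exact hg

lemma classH_anti {r : ℝ} {p p' : ℝ≥0∞} (h : p' ≤ p) : classH 𝕜 d r p ⊆ classH 𝕜 d r p' :=
  fun f hf e t => (eLpNorm_le_eLpNorm_of_exponent_le h
    (continuous_mixedDiff f.continuous _ t e).aestronglyMeasurable).trans (hf e t)

end MixedDiff

lemma integral_norm_rpow_le_of_eLpNorm_le {α E : Type*} {_ : MeasurableSpace α} {μ : Measure α}
    [NormedAddCommGroup E] {g : α → E} {q B : ℝ} (hq : 0 < q) (hB : 0 ≤ B)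
    (hg : AEStronglyMeasurable g μ) (h : eLpNorm g (ENNReal.ofReal q) μ ≤ ENNReal.ofReal B) :
    ∫ x, ‖g x‖ ^ q ∂μ ≤ B ^ q := by
  have hint : 0 ≤ ∫ x, ‖g x‖ ^ q ∂μ := integral_nonneg fun x => by positivity
  have hmem : MemLp g (ENNReal.ofReal q) μ := ⟨hg, h.trans_lt ENNReal.ofReal_lt_top⟩
  rw [MeasureTheory.MemLp.eLpNorm_eq_integral_rpow_norm (ENNReal.ofReal_pos.2 hq).ne'
    ENNReal.ofReal_ne_top hmem, ENNReal.toReal_ofReal hq.le, ENNReal.ofReal_le_ofReal_iff hB] at h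
  exact (Real.rpow_inv_le_iff_of_pos hint hB hq).1 h

lemma stepWeight_mul (r q : ℝ) (u : ℕ) (t : Circ) :
    stepWeight (r * q) u t = stepWeight r u t ^ q := by
  unfold stepWeight
  split_ifs
  · exact (Real.one_rpow q).symm
  · exact Real.rpow_mul (norm_nonneg t) r q

lemma norm_map_complex {𝕜 : Type*} [RCLike 𝕜] (z : 𝕜) : ‖RCLike.map 𝕜 ℂ z‖ = ‖z‖ := by
  rw [← sq_eq_sq₀ (norm_nonneg _) (norm_nonneg _), RCLike.norm_sq_eq_def, RCLike.norm_sq_eq_def]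
  simp

section ClassH

variable {𝕜 : Type*} [RCLike 𝕜]

lemma hasMixedBound_of_mem_classH {r q : ℝ} (hq : 0 < q) {f : C(Torus 2, 𝕜)}
    (hf : f ∈ classH 𝕜 2 r (ENNReal.ofReal q)) :
    HasMixedBound (⌊r⌋₊ + 1) r q (RCLike.map 𝕜 ℂ ∘ f) := by
  intro s t
  set τ : Fin 2 → ℝ := fun j => circRep (t j)
  have hτ : (fun j => (τ j : Circ)) = t := funext fun j => coe_circRep (t j)
  have hdiff : RCLike.map 𝕜 ℂ ∘ mixedDiff (⌊r⌋₊ + 1) τ {j | s j ≠ 0} f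
      = blockDiff (⌊r⌋₊ + 1) s t (RCLike.map 𝕜 ℂ ∘ f) := by
    rw [comp_mixedDiff, mixedDiff_eq_blockDiff, hτ]
  have hweight : ∏ j with s j ≠ 0, |τ j| ^ r
      = stepWeight r (s 0) (t 0) * stepWeight r (s 1) (t 1) := by
    simp only [Finset.prod_filter, Fin.prod_univ_two, stepWeight, ne_eq, ite_not, τ, abs_circRep]
  have hbound := integral_norm_rpow_le_of_eLpNorm_le hq
    (mul_nonneg (stepWeight_nonneg r _ _) (stepWeight_nonneg r _ _))
    (continuous_mixedDiff f.continuous _ τ _).aestronglyMeasurable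
    ((hf {j | s j ≠ 0} τ).trans_eq (congrArg _ hweight))
  rw [stepWeight_mul, stepWeight_mul,
    ← Real.mul_rpow (stepWeight_nonneg r _ _) (stepWeight_nonneg r _ _), ← hdiff]
  simpa only [Function.comp_apply, norm_map_complex] using hbound

lemma abs_integral_norm_sq_sub_eq_norm_cubatureError (f : C(Torus 2, 𝕜)) {m : ℕ}
    (ξ : Fin m → Torus 2) :
    |(∫ x, ‖f x‖ ^ (2 : ℝ) ∂torusMeasure 2) - (1 / (m : ℝ)) * ∑ j, ‖f (ξ j)‖ ^ (2 : ℝ)|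
      = ‖cubatureError ξ fun x => RCLike.map 𝕜 ℂ (f x) *
          (starRingEnd ℂ) (RCLike.map 𝕜 ℂ (f x))‖ := by
  have hsq (x : Torus 2) : RCLike.map 𝕜 ℂ (f x) * (starRingEnd ℂ) (RCLike.map 𝕜 ℂ (f x))
      = ((‖f x‖ ^ (2 : ℝ) : ℝ) : ℂ) := by
    rw [Complex.mul_conj', norm_map_complex, Real.rpow_two, Complex.ofReal_pow]
  simp only [cubatureError, hsq]
  rw [integral_complex_ofReal, ← Complex.ofReal_sum, ← Complex.ofReal_natCast,
    ← Complex.ofReal_div, ← Complex.ofReal_sub, Complex.norm_real, Real.norm_eq_abs,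
    one_div_mul_eq_div]

end ClassH

lemma exists_real_exponent {p : ℝ≥0∞} (hp : 1 ≤ p) {r : ℝ} (hr : 1 / p < ENNReal.ofReal r) :
    ∃ q : ℝ, 1 ≤ q ∧ 1 / q < r ∧ ENNReal.ofReal q ≤ p := by
  have hr0 : 0 < r := ENNReal.ofReal_pos.1 (bot_le.trans_lt hr)
  rcases eq_or_ne p ⊤ with rfl | hp_top
  · refine ⟨max 1 (2 / r), le_max_left _ _, ?_, le_top⟩
    calc 1 / max 1 (2 / r) ≤ 1 / (2 / r) := by
          gcongr
          exact le_max_right _ _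
      _ = r / 2 := one_div_div 2 r
      _ < r := half_lt_self hr0
  · refine ⟨p.toReal, ENNReal.toReal_mono hp_top hp, ?_, (ENNReal.ofReal_toReal hp_top).le⟩
    have hlt := (ENNReal.toReal_lt_toReal hr.ne_top ENNReal.ofReal_ne_top).2 hr
    rwa [ENNReal.toReal_ofReal hr0.le, ENNReal.toReal_div, ENNReal.toReal_one] at hlt

lemma exists_samplingError_classH_le {𝕜 : Type*} [RCLike 𝕜] {p : ℝ≥0∞} (hp : 1 ≤ p) {r : ℝ}
    (hr : 1 / p < ENNReal.ofReal r) (A : ℕ) :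
    ∃ C : ℝ, 0 < C ∧ ∀ {m : ℕ} {ξ : Fin m → Torus 2}, 2 ≤ m → IsHyperbolicNodeSet A ξ →
      samplingError (torusMeasure 2) 2 (classH 𝕜 2 r p) ξ
        ≤ ENNReal.ofReal (C * ((m : ℝ) ^ (-r) * Real.log m)) := by
  obtain ⟨q, hq, hqr, hqp⟩ := exists_real_exponent hp hr
  obtain ⟨C, hC, herr⟩ := exists_norm_cubatureError_mul_conj_le hq hqr (⌊r⌋₊ + 1) A
  refine ⟨C, hC, fun {m ξ} hm hξ => iSup₂_le fun f hf => ENNReal.ofReal_le_ofReal ?_⟩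
  rw [abs_integral_norm_sq_sub_eq_norm_cubatureError]
  exact herr hm hξ _ ((RCLike.map 𝕜 ℂ).continuous.comp f.continuous)
    (hasMixedBound_of_mem_classH (by linarith) (classH_anti hqp hf))

/-! ### Smooth bumps on the circle -/

lemma hasDerivAt_fwdDiff_iter {h h' : ℝ → ℝ} (hh : ∀ x, HasDerivAt h (h' x) x) (k : ℕ) (t x : ℝ) :
    HasDerivAt ((fwdDiff t)^[k] h) ((fwdDiff t)^[k] h' x) x := by
  induction k generalizing x with
  | zero => exact hh x
  | succ k ih =>
    rw [Function.iterate_succ_apply', Function.iterate_succ_apply']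
    exact ((ih (x + t)).comp_add_const x t).sub (ih x)

lemma abs_fwdDiff_iter_le_of_contDiff {h : ℝ → ℝ} {l : ℕ} (hh : ContDiff ℝ l h) {M : ℝ}
    (hM : ∀ x, |iteratedDeriv l h x| ≤ M) (t x : ℝ) : |(fwdDiff t)^[l] h x| ≤ M * |t| ^ l := by
  induction l generalizing h x with
  | zero => simpa using hM x
  | succ l ih =>
    rw [Nat.cast_add_one, contDiff_succ_iff_deriv] at hh
    obtain ⟨hdiff, -, hderiv⟩ := hh
    have hM' (y : ℝ) : |(fwdDiff t)^[l] (deriv h) y| ≤ M * |t| ^ l :=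
      ih hderiv (fun z => by simpa only [iteratedDeriv_succ'] using hM z) y
    have hmvt := Convex.norm_image_sub_le_of_norm_hasDerivWithin_le (x := x) (y := x + t)
      (fun y _ => (hasDerivAt_fwdDiff_iter (fun z => (hdiff z).hasDerivAt) l t y).hasDerivWithinAt)
      (fun y _ => hM' y) convex_univ trivial trivial
    rw [add_sub_cancel_left] at hmvt
    rw [Function.iterate_succ_apply', pow_succ, ← mul_assoc]
    exact hmvt

lemma abs_fwdDiff_iter_le {M : Type*} [AddCommMonoid M] {f : M → ℝ} {K : ℝ} (hf : ∀ x, |f x| ≤ K)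
    (h : M) (l : ℕ) (x : M) : |(fwdDiff h)^[l] f x| ≤ 2 ^ l * K := by
  induction l generalizing x with
  | zero => simpa using hf x
  | succ l ih =>
    rw [Function.iterate_succ_apply', fwdDiff]
    calc _ ≤ |(fwdDiff h)^[l] f (x + h)| + |(fwdDiff h)^[l] f x| := abs_sub _ _
      _ ≤ 2 ^ l * K + 2 ^ l * K := add_le_add (ih _) (ih _)
      _ = _ := by ring

/-- A smooth bump function on the unit interval: it equals `1` on `[3/8, 5/8]` and vanishes outside
`(1/4, 3/4)`. -/
def unitBump : ContDiffBump (1 / 2 : ℝ) := ⟨1 / 8, 1 / 4, by norm_num, by norm_num⟩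

lemma unitBump_eq_zero {y : ℝ} (hy : y ∉ Set.Ioo (1 / 4) (3 / 4)) : unitBump y = 0 := by
  refine unitBump.zero_of_le_dist (not_lt.1 fun h => hy ?_)
  rw [Real.dist_eq, show unitBump.rOut = 1 / 4 from rfl, abs_lt] at h
  constructor <;> linarith

lemma unitBump_eq_one {y : ℝ} (hy : y ∈ Set.Icc (3 / 8) (5 / 8)) : unitBump y = 1 := by
  refine unitBump.one_of_mem_closedBall ?_
  rw [Metric.mem_closedBall, Real.dist_eq, show unitBump.rIn = 1 / 8 from rfl, abs_le]
  constructor <;> linarith [hy.1, hy.2]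

lemma exists_abs_iteratedDeriv_unitBump_le (l : ℕ) :
    ∃ M : ℝ, ∀ x, |iteratedDeriv l unitBump x| ≤ M := by
  have hcomp : HasCompactSupport (iteratedFDeriv ℝ l unitBump) :=
    unitBump.hasCompactSupport.iteratedFDeriv l
  obtain ⟨M, hM⟩ :=
    hcomp.exists_bound_of_continuous (unitBump.contDiff.continuous_iteratedFDeriv le_rfl)
  exact ⟨M, fun x => (norm_iteratedFDeriv_eq_norm_iteratedDeriv (𝕜 := ℝ)).symm.trans_le (hM x)⟩

/-- The `1`-periodic function equal to the bump `unitBump (c * y)` on the unit interval; for `c ≥ 1`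
it is supported, modulo one, in `[0, 1/c]`. -/
def perBump (c : ℕ) (y : ℝ) : ℝ := unitBump (c * Int.fract y)

lemma perBump_nonneg (c : ℕ) (y : ℝ) : 0 ≤ perBump c y := unitBump.nonneg

lemma abs_perBump_le_one (c : ℕ) (y : ℝ) : |perBump c y| ≤ 1 :=
  (abs_of_nonneg (perBump_nonneg c y)).trans_le unitBump.le_one

lemma perBump_add_one (c : ℕ) (y : ℝ) : perBump c (y + 1) = perBump c y := by
  rw [perBump, Int.fract_add_one, perBump]

section PerBump

variable {c : ℕ} (hc : 1 ≤ c)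
include hc

lemma perBump_eq_unitBump {k : ℤ} {y : ℝ} (hy : y ∈ Set.Ioo (k - 1 / 4 : ℝ) (k + 1)) :
    perBump c y = unitBump (c * (y - k)) := by
  have hc' : (1 : ℝ) ≤ c := by exact_mod_cast hc
  obtain ⟨hky, hyk⟩ := hy
  rcases lt_or_ge y k with h | h
  · have hfloor : ⌊y⌋ = k - 1 := by
      rw [Int.floor_eq_iff]
      push_cast
      constructor <;> linarith
    rw [perBump, Int.fract, hfloor, unitBump_eq_zero, unitBump_eq_zero]
    · exact fun hmem => by nlinarith [hmem.1]
    · push_cast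
      exact fun hmem => by nlinarith [hmem.2]
  · rw [perBump, Int.fract, Int.floor_eq_iff.2 ⟨h, hyk⟩]

lemma perBump_eventuallyEq (x : ℝ) :
    perBump c =ᶠ[nhds x] fun y => unitBump (c * (y - ⌊x⌋)) := by
  have hmem : x ∈ Set.Ioo (⌊x⌋ - 1 / 4 : ℝ) (⌊x⌋ + 1) :=
    ⟨by linarith [Int.floor_le x], Int.lt_floor_add_one x⟩
  filter_upwards [isOpen_Ioo.mem_nhds hmem] with y hy using perBump_eq_unitBump hc hy

lemma contDiff_perBump (n : ℕ) : ContDiff ℝ n (perBump c) :=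
  contDiff_iff_contDiffAt.2 fun x =>
    (unitBump.contDiff.comp (by fun_prop)).contDiffAt.congr_of_eventuallyEq
      (perBump_eventuallyEq hc x)

lemma iteratedDeriv_perBump (l : ℕ) (x : ℝ) :
    iteratedDeriv l (perBump c) x = c ^ l * iteratedDeriv l unitBump (c * Int.fract x) := by
  rw [(perBump_eventuallyEq hc x).iteratedDeriv_eq l,
    iteratedDeriv_comp_sub_const l (fun y => unitBump (c * y)),
    iteratedDeriv_comp_const_mul unitBump.contDiff]
  rfl

lemma perBump_shift_injective {y : ℝ} {i i' : ℕ} (hi : i < c)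
    (hi' : i' < c) (h : perBump c (y - i / c) ≠ 0) (h' : perBump c (y - i' / c) ≠ 0) :
    i = i' := by
  have hc0 : (0 : ℝ) < c := by exact_mod_cast hc
  have hmem (j : ℕ) (hj : perBump c (y - j / c) ≠ 0) :
      c * y - j - c * ⌊y - j / c⌋ ∈ Set.Ioo (1 / 4 : ℝ) (3 / 4) := by
    convert not_imp_comm.1 unitBump_eq_zero hj using 1
    rw [Int.fract, mul_sub, mul_sub, mul_div_cancel₀ _ hc0.ne']
  obtain ⟨hlo, hup⟩ := hmem i h
  obtain ⟨hlo', hup'⟩ := hmem i' h'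
  set k := ⌊y - i / c⌋
  set k' := ⌊y - i' / c⌋
  have hlt : |((i' : ℤ) - i + c * (k' - k) : ℤ)| < 1 := by
    rw [← @Int.cast_lt ℝ]
    push_cast
    rw [abs_lt]
    constructor <;> linarith
  have heq : (i : ℤ) - i' = c * (k' - k) := by linarith [Int.abs_lt_one_iff.1 hlt]
  have hzero := Int.eq_zero_of_abs_lt_dvd ⟨_, heq⟩ (by rw [abs_lt]; omega)
  omega

end PerBump

lemma exists_abs_fwdDiff_perBump_le (l : ℕ) : ∃ A : ℝ, 0 < A ∧ ∀ c : ℕ, 1 ≤ c → ∀ t x : ℝ,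
    |(fwdDiff t)^[l] (perBump c) x| ≤ A * min 1 (c * |t|) ^ l := by
  obtain ⟨M, hM⟩ := exists_abs_iteratedDeriv_unitBump_le l
  refine ⟨max (2 ^ l) M, by positivity, fun c hc t x => ?_⟩
  rcases le_total 1 (c * |t|) with h | h
  · rw [min_eq_left h, one_pow, mul_one]
    refine le_trans ?_ (le_max_left _ _)
    simpa only [mul_one] using abs_fwdDiff_iter_le (abs_perBump_le_one c) t l x
  · have hderiv (y : ℝ) : |iteratedDeriv l (perBump c) y| ≤ c ^ l * M := by
      rw [iteratedDeriv_perBump hc, abs_mul, abs_of_nonneg (by positivity)]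
      exact mul_le_mul_of_nonneg_left (hM _) (by positivity)
    calc _ ≤ c ^ l * M * |t| ^ l :=
          abs_fwdDiff_iter_le_of_contDiff (contDiff_perBump hc l) hderiv t x
      _ = M * (c * |t|) ^ l := by ring
      _ ≤ max (2 ^ l) M * min 1 (c * |t|) ^ l := by
        rw [min_eq_right h]
        gcongr
        exact le_max_right _ _

/-- The bump `perBump c` transplanted to the `i`-th of `c` equal arcs of the circle. -/
def arcBump (c i : ℕ) : Circ → ℝ :=
  Function.Periodic.lift (f := fun y : ℝ => perBump c (y / (2 * π) - i / c)) (c := 2 * π)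
    fun y => by
      beta_reduce
      rw [add_div, div_self Real.two_pi_pos.ne', add_sub_right_comm, perBump_add_one]

lemma arcBump_coe (c i : ℕ) (y : ℝ) :
    arcBump c i (y : Circ) = perBump c (y / (2 * π) - i / c) := rfl

lemma arcBump_eq_perBump_circRep (c i : ℕ) (x : Circ) :
    arcBump c i x = perBump c (circRep x / (2 * π) - i / c) := by
  rw [← arcBump_coe, coe_circRep]

lemma fwdDiff_iter_arcBump_coe (c i l : ℕ) (t y : ℝ) :
    (fwdDiff (t : Circ))^[l] (arcBump c i) (y : Circ)
      = (fwdDiff (t / (2 * π)))^[l] (perBump c) (y / (2 * π) - i / c) := by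
  rw [fwdDiff_iter_eq_sum_shift, fwdDiff_iter_eq_sum_shift]
  refine Finset.sum_congr rfl fun k _ => congrArg _ ?_
  rw [← AddCircle.coe_nsmul, ← AddCircle.coe_add, arcBump_coe]
  congr 1
  simp only [nsmul_eq_mul]
  ring

lemma exists_abs_fwdDiff_arcBump_le (l : ℕ) : ∃ A : ℝ, 0 < A ∧ ∀ c : ℕ, 1 ≤ c →
    ∀ (i : ℕ) (t : ℝ) (x : Circ),
      |(fwdDiff (t : Circ))^[l] (arcBump c i) x| ≤ A * min 1 (c * |t|) ^ l := by
  obtain ⟨A, hA, hdiff⟩ := exists_abs_fwdDiff_perBump_le l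
  refine ⟨A, hA, fun c hc i t x => ?_⟩
  have hstep : |t / (2 * π)| ≤ |t| := by
    rw [abs_div, abs_of_pos Real.two_pi_pos]
    exact div_le_self (abs_nonneg t) (by linarith [Real.pi_gt_three])
  rw [← coe_circRep x, fwdDiff_iter_arcBump_coe]
  refine (hdiff c hc _ _).trans ?_
  gcongr

lemma integral_arcBump (c i : ℕ) :
    ∫ x, arcBump c i x ∂circMeasure = ∫ s in 0..1, perBump c s := by
  have h2pi := Real.two_pi_pos.ne'
  rw [AddCircle.integral_haarAddCircle, ← AddCircle.intervalIntegral_preimage _ (2 * π * (i / c))]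
  simp only [arcBump_coe]
  rw [intervalIntegral.integral_comp_div_sub _ h2pi, inv_smul_smul₀ h2pi,
    add_div, mul_div_cancel_left₀ _ h2pi, div_self h2pi, sub_self, add_sub_cancel_left]

section ArcBump

variable {c : ℕ} (hc : 1 ≤ c)
include hc

lemma continuous_arcBump (i : ℕ) : Continuous (arcBump c i) :=
  continuous_coinduced_dom.2 ((contDiff_perBump hc 0).continuous.comp (by fun_prop))

lemma arcBump_index_eq {x : Circ} {i i' : ℕ} (hi : i < c) (hi' : i' < c)
    (h : arcBump c i x ≠ 0) (h' : arcBump c i' x ≠ 0) : i = i' := by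
  rw [arcBump_eq_perBump_circRep] at h h'
  exact perBump_shift_injective hc hi hi' h h'

lemma card_fwdDiff_arcBump_ne_zero_le (l : ℕ) (t x : Circ) :
    {i ∈ Finset.range c | (fwdDiff t)^[l] (arcBump c i) x ≠ 0}.card ≤ l + 1 := by
  set active : ℕ → Finset ℕ := fun k => {i ∈ Finset.range c | arcBump c i (x + k • t) ≠ 0}
  have hcard (k : ℕ) : (active k).card ≤ 1 := Finset.card_le_one.2 fun i hi i' hi' => by
    simp only [active, Finset.mem_filter, Finset.mem_range] at hi hi'
    exact arcBump_index_eq hc hi.1 hi'.1 hi.2 hi'.2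
  have hsub : {i ∈ Finset.range c | (fwdDiff t)^[l] (arcBump c i) x ≠ 0}
      ⊆ (Finset.range (l + 1)).biUnion active := by
    intro i hi
    rw [Finset.mem_filter, fwdDiff_iter_eq_sum_shift] at hi
    obtain ⟨k, hk, hne⟩ := Finset.exists_ne_zero_of_sum_ne_zero hi.2
    exact Finset.mem_biUnion.2 ⟨k, hk, Finset.mem_filter.2 ⟨hi.1, right_ne_zero_of_smul hne⟩⟩
  refine (Finset.card_le_card hsub).trans ?_
  simpa using Finset.card_biUnion_le_card_mul (Finset.range (l + 1)) active 1 fun k _ => hcard k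

lemma le_integral_arcBump (i : ℕ) : 1 / (4 * c : ℝ) ≤ ∫ x, arcBump c i x ∂circMeasure := by
  have hc' : (1 : ℝ) ≤ c := by exact_mod_cast hc
  have hc0 : (0 : ℝ) < c := by linarith
  have hle : 3 / 8 / (c : ℝ) ≤ 5 / 8 / c := by gcongr; norm_num
  have hle' : 5 / 8 / (c : ℝ) ≤ 1 := by rw [div_le_one hc0]; linarith
  have hone (s : ℝ) (hs : s ∈ Set.uIcc (3 / 8 / (c : ℝ)) (5 / 8 / c)) : perBump c s = 1 := by
    rw [Set.uIcc_of_le hle, Set.mem_Icc, div_le_iff₀ hc0, le_div_iff₀ hc0] at hs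
    have hfract : Int.fract s = s := Int.fract_eq_self.2 (by constructor <;> nlinarith)
    rw [perBump, hfract, unitBump_eq_one]
    constructor <;> linarith
  calc 1 / (4 * c : ℝ) = ∫ _ in 3 / 8 / (c : ℝ)..5 / 8 / c, (1 : ℝ) := by
        rw [intervalIntegral.integral_const, smul_eq_mul]
        field
    _ = ∫ s in 3 / 8 / (c : ℝ)..5 / 8 / c, perBump c s :=
        (intervalIntegral.integral_congr hone).symm
    _ ≤ ∫ s in 0..1, perBump c s :=
        intervalIntegral.integral_mono_interval (by positivity) hle hle'
          (Filter.Eventually.of_forall (perBump_nonneg c))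
          ((contDiff_perBump hc 0).continuous.intervalIntegrable _ _)
    _ = _ := (integral_arcBump c i).symm

end ArcBump

lemma exists_sum_abs_fwdDiff_arcBump_le (l : ℕ) : ∃ A : ℝ, 0 < A ∧ ∀ c : ℕ, 1 ≤ c →
    ∀ (t : ℝ) (x : Circ), ∑ i ∈ Finset.range c, |(fwdDiff (t : Circ))^[l] (arcBump c i) x|
      ≤ A * min 1 (c * |t|) ^ l := by
  obtain ⟨A, hA, hdiff⟩ := exists_abs_fwdDiff_arcBump_le l
  refine ⟨(l + 1) * A, by positivity, fun c hc t x => ?_⟩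
  set S := {i ∈ Finset.range c | (fwdDiff (t : Circ))^[l] (arcBump c i) x ≠ 0}
  have hcard : (S.card : ℝ) ≤ l + 1 := by exact_mod_cast card_fwdDiff_arcBump_ne_zero_le hc l t x
  calc ∑ i ∈ Finset.range c, |(fwdDiff (t : Circ))^[l] (arcBump c i) x|
      = ∑ i ∈ S, |(fwdDiff (t : Circ))^[l] (arcBump c i) x| :=
        (Finset.sum_filter_of_ne fun i _ h => abs_ne_zero.1 h).symm
    _ ≤ S.card • (A * min 1 (c * |t|) ^ l) :=
        Finset.sum_le_card_nsmul _ _ _ fun i _ => hdiff c hc i t x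
    _ ≤ (l + 1) * (A * min 1 (c * |t|) ^ l) := by
        rw [nsmul_eq_mul]
        gcongr
    _ = (l + 1) * A * min 1 (c * |t|) ^ l := (mul_assoc _ _ _).symm

/-! ### Bumps on boxes -/

lemma coordDiff_sum {𝕜 ι : Type*} [RCLike 𝕜] {d : ℕ} (l : ℕ) (t : ℝ) (j : Fin d) (I : Finset ι)
    (g : ι → Torus d → 𝕜) : coordDiff l t j (∑ i ∈ I, g i) = ∑ i ∈ I, coordDiff l t j (g i) :=
  fwdDiff_iter_finsetSum _ _ _ _

lemma mixedDiff_sum {𝕜 ι : Type*} [RCLike 𝕜] (l : ℕ) (t : Fin 2 → ℝ) (e : Finset (Fin 2))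
    (I : Finset ι) (g : ι → Torus 2 → 𝕜) :
    mixedDiff l t e (∑ i ∈ I, g i) = ∑ i ∈ I, mixedDiff l t e (g i) := by
  simp only [mixedDiff_eq_coordDiff, coordDiff_sum]

lemma coordDiff_zero_mul (l : ℕ) (t : ℝ) (a b : Circ → ℝ) :
    coordDiff l t 0 (fun x : Torus 2 => a (x 0) * b (x 1))
      = fun x => (fwdDiff (t : Circ))^[l] a (x 0) * b (x 1) := by
  refine (Function.Semiconj.iterate_right
    (f := fun (a : Circ → ℝ) (x : Torus 2) => a (x 0) * b (x 1)) (fun a => ?_) l a).symm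
  funext x
  simp only [fwdDiff, Pi.add_apply, Pi.single_eq_same, Pi.single_eq_of_ne one_ne_zero, add_zero,
    sub_mul]

lemma coordDiff_one_mul (l : ℕ) (t : ℝ) (a b : Circ → ℝ) :
    coordDiff l t 1 (fun x : Torus 2 => a (x 0) * b (x 1))
      = fun x => a (x 0) * (fwdDiff (t : Circ))^[l] b (x 1) := by
  refine (Function.Semiconj.iterate_right
    (f := fun (b : Circ → ℝ) (x : Torus 2) => a (x 0) * b (x 1)) (fun b => ?_) l b).symm
  funext x
  simp only [fwdDiff, Pi.add_apply, Pi.single_eq_same, Pi.single_eq_of_ne zero_ne_one, add_zero,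
    mul_sub]

/-- The bump on the box of index `i` among the `c₁ c₂` congruent boxes obtained by cutting the torus
into `c₁` arcs in the first and `c₂` arcs in the second variable. -/
def boxBump (c₁ c₂ : ℕ) (i : ℕ × ℕ) (x : Torus 2) : ℝ :=
  arcBump c₁ i.1 (x 0) * arcBump c₂ i.2 (x 1)

lemma mixedDiff_boxBump (l : ℕ) (t : Fin 2 → ℝ) (e : Finset (Fin 2)) (c₁ c₂ : ℕ) (i : ℕ × ℕ)
    (x : Torus 2) :
    mixedDiff l t e (boxBump c₁ c₂ i) x
      = (fwdDiff (t 0 : Circ))^[if 0 ∈ e then l else 0] (arcBump c₁ i.1) (x 0)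
        * (fwdDiff (t 1 : Circ))^[if 1 ∈ e then l else 0] (arcBump c₂ i.2) (x 1) := by
  unfold boxBump
  rw [mixedDiff_eq_coordDiff, coordDiff_zero_mul, coordDiff_one_mul]

lemma exists_sum_abs_mixedDiff_boxBump_le (l : ℕ) (e : Finset (Fin 2)) :
    ∃ B : ℝ, 0 < B ∧ ∀ c₁ c₂ : ℕ, 1 ≤ c₁ → 1 ≤ c₂ → ∀ (t : Fin 2 → ℝ) (x : Torus 2),
      ∑ i ∈ Finset.range c₁ ×ˢ Finset.range c₂, |mixedDiff l t e (boxBump c₁ c₂ i) x|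
        ≤ B * (min 1 (c₁ * |t 0|) ^ (if 0 ∈ e then l else 0) *
          min 1 (c₂ * |t 1|) ^ (if 1 ∈ e then l else 0)) := by
  obtain ⟨A₁, hA₁, hsum₁⟩ := exists_sum_abs_fwdDiff_arcBump_le (if 0 ∈ e then l else 0)
  obtain ⟨A₂, hA₂, hsum₂⟩ := exists_sum_abs_fwdDiff_arcBump_le (if 1 ∈ e then l else 0)
  refine ⟨A₁ * A₂, by positivity, fun c₁ c₂ h₁ h₂ t x => ?_⟩
  simp only [mixedDiff_boxBump, abs_mul]
  rw [Finset.sum_product]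
  dsimp only
  rw [← Finset.sum_mul_sum, mul_mul_mul_comm]
  exact mul_le_mul (hsum₁ c₁ h₁ _ _) (hsum₂ c₂ h₂ _ _)
    (Finset.sum_nonneg fun _ _ => abs_nonneg _) (by positivity)

section BoxBump

variable {c₁ c₂ : ℕ} (h₁ : 1 ≤ c₁) (h₂ : 1 ≤ c₂)
include h₁ h₂

lemma continuous_boxBump (i : ℕ × ℕ) : Continuous (boxBump c₁ c₂ i) :=
  ((continuous_arcBump h₁ _).comp (continuous_apply 0)).mul
    ((continuous_arcBump h₂ _).comp (continuous_apply 1))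

lemma le_integral_boxBump (i : ℕ × ℕ) :
    1 / (16 * (c₁ * c₂) : ℝ) ≤ ∫ x, boxBump c₁ c₂ i x ∂torusMeasure 2 := by
  have hle₁ := le_integral_arcBump h₁ i.1
  calc 1 / (16 * (c₁ * c₂) : ℝ) = 1 / (4 * c₁) * (1 / (4 * c₂)) := by ring
    _ ≤ (∫ y, arcBump c₁ i.1 y ∂circMeasure) * ∫ y, arcBump c₂ i.2 y ∂circMeasure :=
        mul_le_mul hle₁ (le_integral_arcBump h₂ i.2) (by positivity)
          (le_trans (by positivity) hle₁)
    _ = _ := (integral_torus_mul _ _).symm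

lemma exists_boxBump_eq_zero {m : ℕ} (ξ : Fin m → Torus 2) :
    ∃ U ⊆ Finset.range c₁ ×ˢ Finset.range c₂, c₁ * c₂ ≤ m + U.card ∧
      ∀ i ∈ U, ∀ j, boxBump c₁ c₂ i (ξ j) = 0 := by
  set boxes := Finset.range c₁ ×ˢ Finset.range c₂
  set hit : Fin m → Finset (ℕ × ℕ) := fun j => {i ∈ boxes | boxBump c₁ c₂ i (ξ j) ≠ 0}
  have hhit (j : Fin m) : (hit j).card ≤ 1 := by
    refine Finset.card_le_one.2 fun i hi i' hi' => ?_
    simp only [hit, boxes, Finset.mem_filter, Finset.mem_product, Finset.mem_range] at hi hi'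
    exact Prod.ext
      (arcBump_index_eq h₁ hi.1.1 hi'.1.1 (left_ne_zero_of_mul hi.2) (left_ne_zero_of_mul hi'.2))
      (arcBump_index_eq h₂ hi.1.2 hi'.1.2 (right_ne_zero_of_mul hi.2) (right_ne_zero_of_mul hi'.2))
  have hcard : (Finset.univ.biUnion hit).card ≤ m := by
    simpa using Finset.card_biUnion_le_card_mul Finset.univ hit 1 fun j _ => hhit j
  have hboxes : boxes.card = c₁ * c₂ := by
    rw [Finset.card_product, Finset.card_range, Finset.card_range]
  refine ⟨boxes \ Finset.univ.biUnion hit, Finset.sdiff_subset, ?_, fun i hi j => ?_⟩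
  · have := Finset.le_card_sdiff (Finset.univ.biUnion hit) boxes
    omega
  · rw [Finset.mem_sdiff, Finset.mem_biUnion] at hi
    by_contra hne
    exact hi.2 ⟨j, Finset.mem_univ j, Finset.mem_filter.2 ⟨hi.1, hne⟩⟩

end BoxBump

/-! ### Sums over the dyadic scales -/

lemma min_one_pow_le_rpow {u r : ℝ} {l : ℕ} (hu : 0 ≤ u) (hr : 0 < r) (hl : r ≤ l) :
    min 1 u ^ l ≤ u ^ r := by
  rcases le_total u 1 with h | h
  · rw [min_eq_right h, ← Real.rpow_natCast]
    exact Real.rpow_le_rpow_of_exponent_ge' hu h hr.le hl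
  · rw [min_eq_left h, one_pow]
    exact Real.one_le_rpow h hr.le

lemma min_one_pow_le_rpow_mul {u r δ : ℝ} {l : ℕ} (hu : 0 ≤ u) (hδ : 0 < δ) (hδr : δ ≤ r)
    (hl : r + δ ≤ l) : min 1 u ^ l ≤ u ^ r * (4 * (u ^ δ / (1 + u ^ δ) ^ 2)) := by
  have hr : 0 < r := hδ.trans_le hδr
  have : 0 ≤ u ^ δ := Real.rpow_nonneg hu _
  rw [← mul_div_assoc, ← mul_div_assoc, le_div_iff₀ (by positivity)]
  rcases le_total u 1 with h | h
  · have hpow : u ^ l ≤ u ^ r * u ^ δ := by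
      rw [← Real.rpow_add_of_nonneg hu hr.le hδ.le, ← Real.rpow_natCast]
      exact Real.rpow_le_rpow_of_exponent_ge' hu h (by positivity) hl
    have hsq : (1 + u ^ δ) ^ 2 ≤ 4 := by nlinarith [Real.rpow_le_one hu h hδ.le]
    rw [min_eq_right h]
    calc u ^ l * (1 + u ^ δ) ^ 2 ≤ u ^ r * u ^ δ * 4 := by gcongr
      _ = u ^ r * (4 * u ^ δ) := by ring
  · have hle : u ^ δ ≤ u ^ r := Real.rpow_le_rpow_of_exponent_le h hδr
    have hone : 1 ≤ u ^ δ := Real.one_le_rpow h hδ.le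
    rw [min_eq_left h, one_pow, one_mul]
    nlinarith

lemma sum_pow_le_mul_pow {q : ℝ} (hq : 1 < q) (N : ℕ) :
    ∑ a ∈ Finset.range (N + 1), q ^ a ≤ q / (q - 1) * q ^ N := by
  rw [geom_sum_eq hq.ne', div_mul_eq_mul_div, ← pow_succ']
  exact div_le_div_of_nonneg_right (by linarith) (by linarith)

/- The summand is at most a multiple of the increment of `w ↦ w / (1 + w)` from `q ^ a * v` to
`q ^ (a + 1) * v`, so the sum telescopes. -/
lemma sum_div_one_add_sq_le {q v : ℝ} (hq : 1 < q) (hv : 0 ≤ v) (N : ℕ) :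
    ∑ a ∈ Finset.range N, q ^ a * v / (1 + q ^ a * v) ^ 2 ≤ q / (q - 1) := by
  have hq0 : 0 < q := by linarith
  have hq1 : 0 < q - 1 := by linarith
  have hincr {w : ℝ} (hw : 0 ≤ w) : w / (1 + w) ^ 2
      ≤ q / (q - 1) * (q * w / (1 + q * w) - w / (1 + w)) := by
    calc w / (1 + w) ^ 2 = q * w / (q * (1 + w) ^ 2) := (mul_div_mul_left _ _ hq0.ne').symm
      _ ≤ q * w / ((1 + q * w) * (1 + w)) := by
          refine div_le_div_of_nonneg_left (by positivity) (by positivity) ?_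
          nlinarith [mul_nonneg hq1.le hw]
      _ = q / (q - 1) * (q * w / (1 + q * w) - w / (1 + w)) := by
          field
  set F : ℕ → ℝ := fun a => q ^ a * v / (1 + q ^ a * v)
  have hF0 (a : ℕ) : 0 ≤ F a := by positivity
  have hF1 (a : ℕ) : F a ≤ 1 := div_le_one_of_le₀ (by linarith) (by positivity)
  calc ∑ a ∈ Finset.range N, q ^ a * v / (1 + q ^ a * v) ^ 2
      ≤ ∑ a ∈ Finset.range N, q / (q - 1) * (F (a + 1) - F a) :=
        Finset.sum_le_sum fun a _ =>
          (hincr (by positivity)).trans_eq (by rw [← mul_assoc, ← pow_succ'])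
    _ = q / (q - 1) * (F N - F 0) := by rw [← Finset.mul_sum, Finset.sum_range_sub]
    _ ≤ q / (q - 1) * 1 := by
        gcongr
        linarith [hF0 0, hF1 N]
    _ = q / (q - 1) := mul_one _

lemma rpow_two_pow_mul {s : ℝ} (hs : 0 ≤ s) (r : ℝ) (a : ℕ) :
    ((2 : ℝ) ^ a * s) ^ r = (2 ^ r) ^ a * s ^ r := by
  rw [Real.mul_rpow (by positivity) hs, Real.rpow_pow_comm two_pos.le]

section ScaleSums

variable {r : ℝ} (hr : 0 < r) {l : ℕ} (hl : r < l)
include hr hl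

lemma sum_min_one_pow_le {s : ℝ} (hs : 0 ≤ s) (N : ℕ) :
    ∑ a ∈ Finset.range (N + 1), min 1 (2 ^ a * s) ^ l
      ≤ 2 ^ r / (2 ^ r - 1) * (2 ^ r) ^ N * s ^ r := by
  calc ∑ a ∈ Finset.range (N + 1), min 1 (2 ^ a * s) ^ l
      ≤ ∑ a ∈ Finset.range (N + 1), (2 ^ r) ^ a * s ^ r := by
        refine Finset.sum_le_sum fun a _ => ?_
        rw [← rpow_two_pow_mul hs]
        exact min_one_pow_le_rpow (by positivity) hr hl.le
    _ ≤ 2 ^ r / (2 ^ r - 1) * (2 ^ r) ^ N * s ^ r := by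
        rw [← Finset.sum_mul]
        gcongr
        exact sum_pow_le_mul_pow (Real.one_lt_rpow one_lt_two hr) N

lemma exists_sum_min_one_pow_mul_min_one_pow_le : ∃ C : ℝ, 0 < C ∧
    ∀ {s s' : ℝ}, 0 ≤ s → 0 ≤ s' → ∀ N : ℕ,
      ∑ a ∈ Finset.range (N + 1), min 1 (2 ^ a * s) ^ l * min 1 (2 ^ (N - a) * s') ^ l
        ≤ C * (2 ^ r) ^ N * (s ^ r * s' ^ r) := by
  set δ := min (l - r) r
  have hδ : 0 < δ := lt_min (by linarith) hr
  have hδr : δ ≤ r := min_le_right _ _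
  have hδl : r + δ ≤ l := by linarith [min_le_left (l - r) r]
  have hq : 1 < (2 : ℝ) ^ δ := Real.one_lt_rpow one_lt_two hδ
  refine ⟨4 * (2 ^ δ / (2 ^ δ - 1)), mul_pos four_pos (div_pos (by linarith) (by linarith)),
    fun {s s'} hs hs' N => ?_⟩
  have hterm (a : ℕ) (ha : a ∈ Finset.range (N + 1)) :
      min 1 (2 ^ a * s) ^ l * min 1 (2 ^ (N - a) * s') ^ l
        ≤ 4 * (2 ^ r) ^ N * (s ^ r * s' ^ r) *
          ((2 ^ δ) ^ a * s ^ δ / (1 + (2 ^ δ) ^ a * s ^ δ) ^ 2) := by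
    have hfst := min_one_pow_le_rpow_mul (u := 2 ^ a * s) (by positivity) hδ hδr hδl
    have hsnd := min_one_pow_le_rpow (u := 2 ^ (N - a) * s') (by positivity) hr hl.le
    rw [rpow_two_pow_mul hs, rpow_two_pow_mul hs] at hfst
    rw [rpow_two_pow_mul hs'] at hsnd
    refine (mul_le_mul hfst hsnd (by positivity) (by positivity)).trans_eq ?_
    rw [← pow_mul_pow_sub ((2 : ℝ) ^ r) (Finset.mem_range_succ_iff.1 ha)]
    ring
  calc _ ≤ ∑ a ∈ Finset.range (N + 1), 4 * (2 ^ r) ^ N * (s ^ r * s' ^ r) *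
          ((2 ^ δ) ^ a * s ^ δ / (1 + (2 ^ δ) ^ a * s ^ δ) ^ 2) := Finset.sum_le_sum hterm
    _ ≤ 4 * (2 ^ r) ^ N * (s ^ r * s' ^ r) * (2 ^ δ / (2 ^ δ - 1)) := by
        rw [← Finset.mul_sum]
        gcongr
        exact sum_div_one_add_sq_le hq (by positivity) _
    _ = _ := by ring

lemma exists_sum_min_one_pow_le_prod (e : Finset (Fin 2)) : ∃ C : ℝ, 0 < C ∧
    ∀ (N : ℕ) (t : Fin 2 → ℝ),
      ∑ a ∈ Finset.range (N + 1), min 1 (2 ^ a * |t 0|) ^ (if 0 ∈ e then l else 0) *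
        min 1 (2 ^ (N - a) * |t 1|) ^ (if 1 ∈ e then l else 0)
      ≤ C * (2 ^ r) ^ N * ∏ j ∈ e, |t j| ^ r := by
  have hq : 1 < (2 : ℝ) ^ r := Real.one_lt_rpow one_lt_two hr
  have hC : 0 < (2 : ℝ) ^ r / (2 ^ r - 1) := div_pos (by linarith) (by linarith)
  have hprod (t : Fin 2 → ℝ) : ∏ j ∈ e, |t j| ^ r
      = (if 0 ∈ e then |t 0| ^ r else 1) * (if 1 ∈ e then |t 1| ^ r else 1) := by
    rw [← Fin.prod_univ_two (fun j => if j ∈ e then |t j| ^ r else 1), Finset.prod_ite_mem,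
      Finset.univ_inter]
  simp only [hprod]
  by_cases h0 : 0 ∈ e <;> by_cases h1 : 1 ∈ e <;>
    simp only [h0, h1, if_true, if_false, pow_zero, mul_one, one_mul]
  · obtain ⟨C, hC, hsum⟩ := exists_sum_min_one_pow_mul_min_one_pow_le hr hl
    exact ⟨C, hC, fun N t => hsum (abs_nonneg _) (abs_nonneg _) N⟩
  · exact ⟨_, hC, fun N t => sum_min_one_pow_le hr hl (abs_nonneg _) N⟩
  · refine ⟨_, hC, fun N t => ?_⟩
    rw [← Finset.sum_range_reflect]
    refine (Finset.sum_le_sum fun a ha => ?_).trans (sum_min_one_pow_le hr hl (abs_nonneg _) N)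
    have haN : a ≤ N := Finset.mem_range_succ_iff.1 ha
    rw [Nat.add_sub_cancel, Nat.sub_sub_self haN]
  · exact ⟨_, hC, fun N _ => (Finset.sum_le_sum fun a _ => one_le_pow₀ hq.le).trans
      (sum_pow_le_mul_pow hq N)⟩

end ScaleSums

/-! ### The lower bound -/

lemma mem_classH_of_forall_norm_le {𝕜 : Type*} [RCLike 𝕜] {d : ℕ} {r : ℝ} {f : C(Torus d, 𝕜)}
    (hf : ∀ (e : Finset (Fin d)) (t : Fin d → ℝ) (x : Torus d),
      ‖mixedDiff (⌊r⌋₊ + 1) t e f x‖ ≤ ∏ j ∈ e, |t j| ^ r) (p : ℝ≥0∞) :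
    f ∈ classH 𝕜 d r p := fun e t =>
  (eLpNorm_le_of_ae_bound (.of_forall (hf e t))).trans_eq (by
    rw [measure_univ, ENNReal.one_rpow, one_mul])

lemma coordDiff_const_add_mul {d : ℕ} (l : ℕ) (t : ℝ) (j : Fin d) (k κ : ℝ) (g : Torus d → ℝ) :
    coordDiff l t j (fun x => k + κ * g x)
      = fun x => (if l = 0 then k else 0) + κ * coordDiff l t j g x := by
  have hadd : (fun x => k + κ * g x) = (fun _ => k) + κ • g := rfl
  rw [hadd, coordDiff, fwdDiff_iter_add, fwdDiff_iter_const_smul]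
  cases l with
  | zero => rfl
  | succ l =>
    have hzero : (fwdDiff (Pi.single j (t : Circ) : Torus d))^[l] (fun _ => (0 : ℝ)) = fun _ => 0 :=
      Function.iterate_fixed (fwdDiff_const _ _) l
    rw [Function.iterate_succ_apply, fwdDiff_const, hzero]
    rfl

lemma mixedDiff_const_add_mul {l : ℕ} (hl : l ≠ 0) (t : Fin 2 → ℝ) (e : Finset (Fin 2)) (k κ : ℝ)
    (g : Torus 2 → ℝ) (x : Torus 2) :
    mixedDiff l t e (fun x => k + κ * g x) x
      = (if e = ∅ then k else 0) + κ * mixedDiff l t e g x := by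
  have he : e = ∅ ↔ 0 ∉ e ∧ 1 ∉ e := by
    rw [Finset.eq_empty_iff_forall_notMem, Fin.forall_fin_two]
  simp only [mixedDiff_eq_coordDiff, coordDiff_const_add_mul, he]
  by_cases h0 : 0 ∈ e <;> by_cases h1 : 1 ∈ e <;> simp [h0, h1, hl]

/-- The sum, over the dyadic cuttings of the torus into `2 ^ a` by `2 ^ (N - a)` boxes, of the bumps
on the boxes with indices in `U a`. -/
def layeredBump (N : ℕ) (U : ℕ → Finset (ℕ × ℕ)) : Torus 2 → ℝ :=
  ∑ a ∈ Finset.range (N + 1), ∑ i ∈ U a, boxBump (2 ^ a) (2 ^ (N - a)) i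

lemma layeredBump_apply (N : ℕ) (U : ℕ → Finset (ℕ × ℕ)) (x : Torus 2) :
    layeredBump N U x
      = ∑ a ∈ Finset.range (N + 1), ∑ i ∈ U a, boxBump (2 ^ a) (2 ^ (N - a)) i x := by
  simp only [layeredBump, Finset.sum_apply]

lemma continuous_layeredBump (N : ℕ) (U : ℕ → Finset (ℕ × ℕ)) : Continuous (layeredBump N U) := by
  simp_rw [funext (layeredBump_apply N U)]
  exact continuous_finsetSum _ fun a _ => continuous_finsetSum _ fun i _ =>
    continuous_boxBump Nat.one_le_two_pow Nat.one_le_two_pow i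

lemma le_integral_layeredBump {N : ℕ} {U : ℕ → Finset (ℕ × ℕ)}
    (hU : ∀ a ≤ N, 2 ^ N ≤ 2 * (U a).card) :
    ((N : ℝ) + 1) / 32 ≤ ∫ x, layeredBump N U x ∂torusMeasure 2 := by
  have hint (a : ℕ) (i : ℕ × ℕ) : Integrable (boxBump (2 ^ a) (2 ^ (N - a)) i) (torusMeasure 2) :=
    integrable_of_continuous (continuous_boxBump Nat.one_le_two_pow Nat.one_le_two_pow i)
  have hlayer (a : ℕ) (ha : a ∈ Finset.range (N + 1)) :
      1 / 32 ≤ ∑ i ∈ U a, ∫ x, boxBump (2 ^ a) (2 ^ (N - a)) i x ∂torusMeasure 2 := by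
    have haN : a ≤ N := Finset.mem_range_succ_iff.1 ha
    have hcard : (2 : ℝ) ^ N ≤ 2 * (U a).card := by exact_mod_cast hU a haN
    have hbox (i : ℕ × ℕ) : 1 / (16 * 2 ^ N : ℝ)
        ≤ ∫ x, boxBump (2 ^ a) (2 ^ (N - a)) i x ∂torusMeasure 2 := by
      rw [← pow_mul_pow_sub (2 : ℝ) haN]
      exact_mod_cast le_integral_boxBump Nat.one_le_two_pow Nat.one_le_two_pow i
    calc (1 / 32 : ℝ) ≤ (U a).card * (1 / (16 * 2 ^ N)) := by
          rw [mul_one_div, div_le_div_iff₀ (by norm_num) (by positivity)]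
          linarith
      _ ≤ _ := by
          rw [← nsmul_eq_mul]
          exact Finset.card_nsmul_le_sum _ _ _ fun i _ => hbox i
  simp only [layeredBump_apply]
  rw [integral_finsetSum _ fun a _ => integrable_finsetSum _ fun i _ => hint a i]
  simp only [integral_finsetSum _ fun i _ => hint _ i]
  calc ((N : ℝ) + 1) / 32 = (Finset.range (N + 1)).card • (1 / 32 : ℝ) := by
        rw [Finset.card_range, nsmul_eq_mul]
        push_cast
        ring
    _ ≤ _ := Finset.card_nsmul_le_sum _ _ _ hlayer

lemma exists_layeredBump_eq_zero {m N : ℕ} (ξ : Fin m → Torus 2) (hm : 2 * m ≤ 2 ^ N) :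
    ∃ U : ℕ → Finset (ℕ × ℕ),
      (∀ a, U a ⊆ Finset.range (2 ^ a) ×ˢ Finset.range (2 ^ (N - a))) ∧
      (∀ a ≤ N, 2 ^ N ≤ 2 * (U a).card) ∧ ∀ j, layeredBump N U (ξ j) = 0 := by
  choose U hUsub hUcard hUzero using fun a : ℕ =>
    exists_boxBump_eq_zero (c₁ := 2 ^ a) (c₂ := 2 ^ (N - a)) Nat.one_le_two_pow
      Nat.one_le_two_pow ξ
  refine ⟨U, hUsub, fun a ha => ?_, fun j => ?_⟩
  · have := hUcard a
    rw [pow_mul_pow_sub 2 ha] at this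
    omega
  · rw [layeredBump_apply]
    exact Finset.sum_eq_zero fun a _ => Finset.sum_eq_zero fun i hi => hUzero a i hi j

section ClassH

variable {r : ℝ} (hr : 0 < r)
include hr

lemma exists_abs_mixedDiff_layeredBump_le {l : ℕ} (hl : r < l) : ∃ K : ℝ, 0 < K ∧
    ∀ (N : ℕ) (U : ℕ → Finset (ℕ × ℕ)),
      (∀ a, U a ⊆ Finset.range (2 ^ a) ×ˢ Finset.range (2 ^ (N - a))) →
      ∀ (e : Finset (Fin 2)) (t : Fin 2 → ℝ) (x : Torus 2),
        |mixedDiff l t e (layeredBump N U) x| ≤ K * (2 ^ r) ^ N * ∏ j ∈ e, |t j| ^ r := by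
  choose B hB hbump using exists_sum_abs_mixedDiff_boxBump_le l
  choose C hC hsum using exists_sum_min_one_pow_le_prod hr hl
  refine ⟨∑ e, B e * C e, Finset.sum_pos (fun e _ => mul_pos (hB e) (hC e)) Finset.univ_nonempty,
    fun N U hU e t x => ?_⟩
  have hlayer (a : ℕ) : ∑ i ∈ U a, |mixedDiff l t e (boxBump (2 ^ a) (2 ^ (N - a)) i) x|
      ≤ B e * (min 1 (2 ^ a * |t 0|) ^ (if 0 ∈ e then l else 0) *
        min 1 (2 ^ (N - a) * |t 1|) ^ (if 1 ∈ e then l else 0)) := by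
    have hall := hbump e (2 ^ a) (2 ^ (N - a)) Nat.one_le_two_pow Nat.one_le_two_pow t x
    push_cast at hall
    exact (Finset.sum_le_sum_of_subset_of_nonneg (hU a) fun _ _ _ => abs_nonneg _).trans hall
  calc |mixedDiff l t e (layeredBump N U) x|
      ≤ ∑ a ∈ Finset.range (N + 1),
          ∑ i ∈ U a, |mixedDiff l t e (boxBump (2 ^ a) (2 ^ (N - a)) i) x| := by
        simp only [layeredBump, mixedDiff_sum, Finset.sum_apply]
        exact (Finset.abs_sum_le_sum_abs _ _).trans
          (Finset.sum_le_sum fun a _ => Finset.abs_sum_le_sum_abs _ _)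
    _ ≤ B e * (C e * (2 ^ r) ^ N * ∏ j ∈ e, |t j| ^ r) := by
        refine (Finset.sum_le_sum fun a _ => hlayer a).trans ?_
        rw [← Finset.mul_sum]
        exact mul_le_mul_of_nonneg_left (hsum e N t) (hB e).le
    _ = B e * C e * ((2 ^ r) ^ N * ∏ j ∈ e, |t j| ^ r) := by ring
    _ ≤ (∑ e, B e * C e) * ((2 ^ r) ^ N * ∏ j ∈ e, |t j| ^ r) := by
        gcongr
        exact Finset.single_le_sum (f := fun e => B e * C e)
          (fun e _ => (mul_pos (hB e) (hC e)).le) (Finset.mem_univ e)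
    _ = _ := (mul_assoc _ _ _).symm

lemma exists_mem_classH_eq_half_add_layeredBump {𝕜 : Type*} [RCLike 𝕜] : ∃ κ : ℝ, 0 < κ ∧
    ∀ (N : ℕ) (U : ℕ → Finset (ℕ × ℕ)),
      (∀ a, U a ⊆ Finset.range (2 ^ a) ×ˢ Finset.range (2 ^ (N - a))) →
      ∃ f : C(Torus 2, 𝕜), (∀ p, f ∈ classH 𝕜 2 r p) ∧
        ∀ x, f x = ((1 / 2 + κ / (2 ^ r) ^ N * layeredBump N U x : ℝ) : 𝕜) := by
  set l := ⌊r⌋₊ + 1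
  have hl : r < l := by exact_mod_cast Nat.lt_floor_add_one r
  obtain ⟨K, hK, hbound⟩ := exists_abs_mixedDiff_layeredBump_le hr hl
  refine ⟨1 / (2 * K), by positivity, fun N U hU => ?_⟩
  set κ := 1 / (2 * K) / (2 ^ r) ^ N with hκ
  have hκ0 : 0 < κ := by positivity
  set g : Torus 2 → ℝ := fun x => 1 / 2 + κ * layeredBump N U x
  have hg : Continuous g := by
    have := continuous_layeredBump N U
    fun_prop
  refine ⟨⟨fun x => (g x : 𝕜), RCLike.continuous_ofReal.comp hg⟩,
    mem_classH_of_forall_norm_le fun e t x => ?_, fun x => rfl⟩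
  have hconst : |if e = ∅ then (1 / 2 : ℝ) else 0| ≤ 1 / 2 * ∏ j ∈ e, |t j| ^ r := by
    split_ifs with he
    · rw [he, Finset.prod_empty, mul_one, abs_of_pos one_half_pos]
    · rw [abs_zero]
      positivity
  have hbump : κ * |mixedDiff l t e (layeredBump N U) x| ≤ 1 / 2 * ∏ j ∈ e, |t j| ^ r := by
    refine (mul_le_mul_of_nonneg_left (hbound N U hU e t x) hκ0.le).trans_eq ?_
    rw [hκ]
    field_simp
  calc ‖mixedDiff l t e (fun x => (g x : 𝕜)) x‖ = |mixedDiff l t e g x| := by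
        rw [← RCLike.norm_ofReal (K := 𝕜)]
        exact congrArg norm (congrFun (comp_mixedDiff (RCLike.ofRealAm (K := 𝕜)) l t e g) x).symm
    _ ≤ |if e = ∅ then (1 / 2 : ℝ) else 0| + |κ * mixedDiff l t e (layeredBump N U) x| := by
        rw [mixedDiff_const_add_mul (by omega)]
        exact abs_add_le _ _
    _ ≤ ∏ j ∈ e, |t j| ^ r := by
        rw [abs_mul, abs_of_pos hκ0]
        linarith

end ClassH

lemma ofReal_le_samplingError {𝕜 Ω : Type*} [RCLike 𝕜] [TopologicalSpace Ω] [MeasurableSpace Ω]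
    {μ : Measure Ω} {q : ℝ} {W : Set C(Ω, 𝕜)} {f : C(Ω, 𝕜)} (hf : f ∈ W) {m : ℕ}
    (ξ : Fin m → Ω) :
    ENNReal.ofReal ((∫ x, ‖f x‖ ^ q ∂μ) - (1 / (m : ℝ)) * ∑ j, ‖f (ξ j)‖ ^ q)
      ≤ samplingError μ q W ξ :=
  (ENNReal.ofReal_le_ofReal (le_abs_self _)).trans (le_iSup₂_of_le f hf le_rfl)

lemma le_integral_sub_average_of_eq_half_add {𝕜 Ω : Type*} [RCLike 𝕜] [TopologicalSpace Ω]
    [CompactSpace Ω] [MeasurableSpace Ω] [OpensMeasurableSpace Ω] {μ : Measure Ω}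
    [IsProbabilityMeasure μ] {G : Ω → ℝ} (hG : Continuous G) {m : ℕ} (hm : m ≠ 0) {ξ : Fin m → Ω}
    (hξ : ∀ j, G (ξ j) = 0) {f : Ω → 𝕜} (hf : ∀ x, f x = ((1 / 2 + G x : ℝ) : 𝕜)) :
    ∫ x, G x ∂μ ≤ (∫ x, ‖f x‖ ^ (2 : ℝ) ∂μ) - (1 / (m : ℝ)) * ∑ j, ‖f (ξ j)‖ ^ (2 : ℝ) := by
  have hsq (x : Ω) : ‖f x‖ ^ (2 : ℝ) = (1 / 2 + G x) ^ 2 := by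
    rw [hf, RCLike.norm_ofReal, Real.rpow_two, sq_abs]
  have haverage : (1 / (m : ℝ)) * ∑ j, ‖f (ξ j)‖ ^ (2 : ℝ) = 1 / 4 := by
    simp only [hsq, hξ, Finset.sum_const, Finset.card_univ, Fintype.card_fin, nsmul_eq_mul]
    field
  have hintegral : 1 / 4 + ∫ x, G x ∂μ ≤ ∫ x, ‖f x‖ ^ (2 : ℝ) ∂μ := by
    calc 1 / 4 + ∫ x, G x ∂μ = ∫ x, (1 / 4 + G x) ∂μ := by
          rw [integral_add (integrable_const _) (integrable_of_continuous hG), integral_const,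
            probReal_univ, one_smul]
      _ ≤ ∫ x, ‖f x‖ ^ (2 : ℝ) ∂μ := by
          simp only [hsq]
          refine integral_mono (integrable_of_continuous (by fun_prop))
            (integrable_of_continuous (by fun_prop)) fun x => ?_
          nlinarith [sq_nonneg (G x)]
  linarith

lemma four_rpow_neg_mul_rpow_neg_mul_log_le {r : ℝ} (hr : 0 ≤ r) {m N : ℕ} (hm : 0 < m)
    (hmN : m ≤ 2 ^ N) (hNm : 2 ^ N ≤ 4 * m) :
    (4 : ℝ) ^ (-r) * ((m : ℝ) ^ (-r) * Real.log m) ≤ 1 / (2 ^ r) ^ N * (N + 1) := by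
  have hm1 : (1 : ℝ) ≤ m := by exact_mod_cast hm
  have hpow : (4 : ℝ) ^ (-r) * (m : ℝ) ^ (-r) ≤ 1 / (2 ^ r) ^ N := by
    rw [← Real.mul_rpow (by norm_num) (by positivity), Real.rpow_neg (by positivity), ← one_div,
      Real.rpow_pow_comm two_pos.le]
    gcongr
    exact_mod_cast hNm
  have hlog : Real.log m ≤ N + 1 := by
    calc Real.log m ≤ Real.log (2 ^ N) := Real.log_le_log (by positivity) (by exact_mod_cast hmN)
      _ = N * Real.log 2 := Real.log_pow _ _
      _ ≤ N * 1 := by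
          gcongr
          linarith [Real.log_two_lt_d9]
      _ ≤ N + 1 := by linarith
  rw [← mul_assoc]
  exact mul_le_mul hpow hlog (Real.log_nonneg hm1) (by positivity)

lemma exists_le_er_classH {𝕜 : Type*} [RCLike 𝕜] {r : ℝ} (hr : 0 < r) :
    ∃ c : ℝ, 0 < c ∧ ∀ (p : ℝ≥0∞) (m : ℕ), 0 < m →
      ENNReal.ofReal (c * ((m : ℝ) ^ (-r) * Real.log m))
        ≤ er (torusMeasure 2) 2 (classH 𝕜 2 r p) m := by
  obtain ⟨κ, hκ, hclass⟩ := exists_mem_classH_eq_half_add_layeredBump hr (𝕜 := 𝕜)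
  refine ⟨κ / 32 * 4 ^ (-r), by positivity, fun p m hm => le_iInf fun ξ => ?_⟩
  have hpow_log : 2 ^ Nat.log 2 m ≤ m := Nat.pow_log_le_self 2 hm.ne'
  have hlt_pow : m < 2 ^ (Nat.log 2 m + 1) := Nat.lt_pow_succ_log_self one_lt_two m
  obtain ⟨N, hmN, hNm⟩ : ∃ N, 2 * m ≤ 2 ^ N ∧ 2 ^ N ≤ 4 * m :=
    ⟨Nat.log 2 m + 2, by rw [pow_succ]; omega, by rw [pow_add]; omega⟩
  obtain ⟨U, hUsub, hUcard, hUzero⟩ := exists_layeredBump_eq_zero ξ hmN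
  obtain ⟨f, hfmem, hf⟩ := hclass N U hUsub
  refine (ENNReal.ofReal_le_ofReal ?_).trans (ofReal_le_samplingError (hfmem p) ξ)
  calc κ / 32 * 4 ^ (-r) * ((m : ℝ) ^ (-r) * Real.log m)
      = κ / 32 * (4 ^ (-r) * ((m : ℝ) ^ (-r) * Real.log m)) := mul_assoc _ _ _
    _ ≤ κ / 32 * (1 / (2 ^ r) ^ N * (N + 1)) := by
        refine mul_le_mul_of_nonneg_left ?_ (by positivity)
        exact four_rpow_neg_mul_rpow_neg_mul_log_le hr.le hm (by omega) hNm
    _ = κ / (2 ^ r) ^ N * ((N + 1) / 32) := by ring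
    _ ≤ κ / (2 ^ r) ^ N * ∫ x, layeredBump N U x ∂torusMeasure 2 := by
        gcongr
        exact le_integral_layeredBump hUcard
    _ = ∫ x, κ / (2 ^ r) ^ N * layeredBump N U x ∂torusMeasure 2 :=
        (integral_const_mul _ _).symm
    _ ≤ _ := le_integral_sub_average_of_eq_half_add
        (continuous_const.mul (continuous_layeredBump N U)) hm.ne'
        (fun j => mul_eq_zero_of_right _ (hUzero j)) hf

end

theorem theorem5p3 {𝕜 : Type*} [RCLike 𝕜] (p : ℝ≥0∞) (hp : 1 ≤ p)
    (r : ℝ) (hr : 1 / p < ENNReal.ofReal r) :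
    ∃ c C : ℝ, 0 < c ∧ 0 < C ∧ ∀ n : ℕ, 2 ≤ n →
      ENNReal.ofReal (c * ((fibB n : ℝ) ^ (-r) * Real.log (fibB n)))
          ≤ er (torusMeasure 2) 2 (classH 𝕜 2 r p) (fibB n) ∧
      er (torusMeasure 2) 2 (classH 𝕜 2 r p) (fibB n)
          ≤ ENNReal.ofReal (C * ((fibB n : ℝ) ^ (-r) * Real.log (fibB n))) ∧
      samplingError (torusMeasure 2) 2 (classH 𝕜 2 r p) (fibPoint n)
          ≤ ENNReal.ofReal (C * ((fibB n : ℝ) ^ (-r) * Real.log (fibB n))) := by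
  have hr0 : 0 < r := ENNReal.ofReal_pos.1 (bot_le.trans_lt hr)
  obtain ⟨c, hc, hlower⟩ := exists_le_er_classH (𝕜 := 𝕜) hr0
  obtain ⟨C, hC, hupper⟩ := exists_samplingError_classH_le (𝕜 := 𝕜) hp hr 6
  refine ⟨c, C, hc, hC, fun n hn => ?_⟩
  have hb : 2 ≤ fibB n := two_le_fibB hn
  have hnodes : IsHyperbolicNodeSet 6 (fibPoint n) := by
    obtain ⟨k, rfl⟩ := Nat.exists_eq_add_of_le' (one_le_two.trans hn)
    exact isHyperbolicNodeSet_fibPoint k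
  exact ⟨hlower p _ (two_pos.trans_le hb), (iInf_le _ (fibPoint n)).trans (hupper hb hnodes),
    hupper hb hnodes⟩
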